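/- **Definitions.** A *mixed Lie algebra* is a graded Lie algebra $\mathfrak g=\bigoplus_{n\ge1}\mathfrak g_n$ over $\mathbb F_2$ (with $[x,x]=0$) together with maps $P:\mathfrak g_n\to\mathfrak g_{n+1}$ such that, for $x,x'\in\mathfrak g_m$ and $y$ homogeneous, $P(x+x')=P(x)+P(x')$ and $[Px,y]=P[x,y]$ if $m>1$, while $P(x+x')=P(x)+P(x')+[x,x']$ and $[Px,y]=P[x,y]+[x,[x,y]]$ if $m=1$. On $\mathfrak g^+=\bigoplus_{n>1}\mathfrak g_n$ the operator $P$ is linear and makes $\mathfrak g^+$ a module over $\mathbb F_2[\pi]$, with $\pi u=P(u)$. A *quadratic Lie algebra* is a graded Lie algebra $\mathfrak h=\bigoplus_{n\ge1}\mathfrak h_n$ over $\mathbb F_2$ with a map $P:\mathfrak h_1\to\mathfrak h_2$ such that $P(x+x')=P(x)+P(x')+[x,x']$ and $[Px,y]=[x,[x,y]]$ for $x,x'\in\mathfrak h_1$ and $y$ homogeneous; equivalently, it is a mixed Lie algebra with $P=0$ in degrees $>1$. Ideals are graded Lie ideals stable under $P$. The *enveloping algebra* $U_{\rm mix}(\mathfrak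 g)$ is the universal associative $\mathbb F_2[\pi]$-algebra with an additive map from $\mathfrak g$ under which $[x,y]=xy-yx$ for all $x,y\in\mathfrak g$, $Px=\pi x$ for $x$ homogeneous of degree $>1$, and $Px=\pi x+x^2$ for $x$ of degree $1$; $U_{\rm quad}(\mathfrak h)$ is the universal associative $\mathbb F_2$-algebra with an additive map from $\mathfrak h$ under which $[x,y]=xy-yx$ for all $x,y\in\mathfrak h$, and $Px=x^2$ for $x$ of degree $1$. Let $X=\{\xi_1,\dots,\xi_d\}$ be a finite set with weights $e_1,\dots,e_d\ge1$, let $L=L_{\rm mix}(X)$ be the free mixed Lie algebra on $X$ (with $\xi_i$ of degree $e_i$), and let $\tilde L=L/\pi L^+$, which is the free quadratic Lie algebra on $X$. Let $\rho_1,\dots,\rho_m\in L$ with $\rho_i$ homogeneous of degree $h_i>1$, and let $\tilde\rho_i$ be the image of $\rho_i$ in $\tilde L$. Let $\mathfrak r$ be the ideal of $L$ generated by $\rho_1,\dots,\rho_m$ and $U=U_{\rm mix}(L/\mathfrak r)$. The sequence $\rho_1,\dots,\rho_m$ is *strongly free* in $L$ if the $\mathbb F_2[\pi]$-module $U$ is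 torsion free and the $U$-module $\mathfrak r/[\mathfrak r,\mathfrak r]$ (via the adjoint representation) is free on the images of $\rho_1,\dots,\rho_m$. Let $\tilde{\mathfrak r}$ be the ideal of $\tilde L$ generated by $\tilde\rho_1,\dots,\tilde\rho_m$ and $\tilde U=U_{\rm quad}(\tilde L/\tilde{\mathfrak r})$. The sequence $\tilde\rho_1,\dots,\tilde\rho_m$ is *strongly free* in $\tilde L$ if the $\tilde U$-module $\tilde{\mathfrak r}/[\tilde{\mathfrak r},\tilde{\mathfrak r}]$ (via the adjoint representation) is free on the images of $\tilde\rho_1,\dots,\tilde\rho_m$. **Theorem 4.4.** The sequence $\rho_1,\dots,\rho_m$ is strongly free in $L=L_{\rm mix}(X)$ if and only if the sequence $\tilde\rho_1,\dots,\tilde\rho_m$ is strongly free in $\tilde L$. -/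

import Mathlib

open scoped DirectSum Polynomial

universe u v

/-- A mixed Lie algebra (in the sense of Lazard, for the prime `2`): a graded Lie algebra
`⨁_{n ≥ 1} L_n` over `𝔽₂`, given by its homogeneous components, with operators
`P : L_n → L_{n+1}`.  Degrees are attached to the operations through equations, so that no transport
is needed.  A component in degree `0` is kept for convenience and required to vanish; hence
"degree `≠ 1`" means "degree `> 1`" throughout. -/
structure MixedLieAlgebra where
  carrier : ℕ → Type u
  [addCommGroup : ∀ n, AddCommGroup (carrier n)]
  [module : ∀ n, Module (ZMod 2) (carrier n)]
  subsingleton_zero : Subsingleton (carrier 0)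
  /-- the Lie bracket of homogeneous elements -/
  br : ∀ {m n k : ℕ}, m + n = k →
    (carrier m →ₗ[ZMod 2] carrier n →ₗ[ZMod 2] carrier k)
  /-- the operator `P` on homogeneous elements -/
  P : ∀ {n k : ℕ}, n + 1 = k → carrier n → carrier k
  br_self : ∀ {n k : ℕ} (h : n + n = k) (x : carrier n), br h x x = 0
  br_comm : ∀ {m n k : ℕ} (h : m + n = k) (h' : n + m = k) (x : carrier m) (y : carrier n),
    br h x y = - br h' y x
  jacobi : ∀ {a b c ab bc ca k : ℕ} (hab : a + b = ab) (h₁ : ab + c = k)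
    (hbc : b + c = bc) (h₂ : bc + a = k) (hca : c + a = ca) (h₃ : ca + b = k)
    (x : carrier a) (y : carrier b) (z : carrier c),
    br h₁ (br hab x y) z + br h₂ (br hbc y z) x + br h₃ (br hca z x) y = 0
  P_add_one : ∀ {k : ℕ} (h : 1 + 1 = k) (x y : carrier 1),
    P h (x + y) = P h x + P h y + br h x y
  P_add : ∀ {n k : ℕ} (h : n + 1 = k), n ≠ 1 → ∀ x y : carrier n,
    P h (x + y) = P h x + P h y
  br_P_one : ∀ {n a b c : ℕ} (ha : 1 + 1 = a) (h : a + n = c) (hb : 1 + n = b)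
    (h₁ : b + 1 = c) (h₂ : 1 + b = c) (x : carrier 1) (y : carrier n),
    br h (P ha x) y = P h₁ (br hb x y) + br h₂ x (br hb x y)
  br_P : ∀ {m n a b c : ℕ} (ha : m + 1 = a) (h : a + n = c) (hb : m + n = b)
    (h₁ : b + 1 = c), m ≠ 1 → ∀ (x : carrier m) (y : carrier n),
    br h (P ha x) y = P h₁ (br hb x y)

namespace MixedLieAlgebra

attribute [instance] MixedLieAlgebra.addCommGroup MixedLieAlgebra.module

/-- A quadratic Lie algebra, i.e. a graded Lie algebra over `𝔽₂` with a map `P : L_1 → L_2` such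
that `P (x + y) = P x + P y + [x, y]` and `[P x, y] = [x, [x, y]]`, is the same thing as a mixed Lie
algebra whose operator `P` is zero in all degrees `> 1`.  Homomorphisms, and ideals
(Lie ideals containing `P s` for each of their elements `s` of degree `1`), agree as well. -/
def IsQuadratic (L : MixedLieAlgebra.{u}) : Prop :=
  ∀ {n k : ℕ} (h : n + 1 = k), n ≠ 1 → ∀ x : L.carrier n, L.P h x = 0

variable {L : MixedLieAlgebra.{u}}

theorem P_zero {n k : ℕ} (h : n + 1 = k) : L.P h 0 = 0 := by
  by_cases h1 : n = 1
  · subst h1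
    simpa using L.P_add_one h 0 0
  · simpa using L.P_add h h1 0 0

theorem leibniz {a b c bc ab ac k : ℕ} (hbc : b + c = bc) (h₁ : a + bc = k) (hab : a + b = ab)
    (h₂ : ab + c = k) (hac : a + c = ac) (h₃ : b + ac = k)
    (x : L.carrier a) (y : L.carrier b) (z : L.carrier c) :
    L.br h₁ x (L.br hbc y z) = L.br h₂ (L.br hab x y) z + L.br h₃ y (L.br hac x z) := by
  have J := L.jacobi hab h₂ hbc (by omega : bc + a = k) (by omega : c + a = ac)
    (by omega : ac + b = k) x y z
  rw [L.br_comm h₁ (by omega) x, L.br_comm h₃ (by omega) y,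
    L.br_comm hac (by omega) x z]
  simp only [map_neg, LinearMap.neg_apply, neg_neg]
  rw [neg_eq_iff_add_eq_zero, ← J]
  abel

variable (L)

/-! ### Ideals and quotients -/

/-- A (graded) ideal of a mixed Lie algebra: a graded Lie ideal stable under `P`. -/
structure MIdeal where
  part : ∀ n, Submodule (ZMod 2) (L.carrier n)
  br_mem : ∀ {m n k : ℕ} (h : m + n = k) (x : L.carrier m) {y : L.carrier n},
    y ∈ part n → L.br h x y ∈ part k
  P_mem : ∀ {n k : ℕ} (h : n + 1 = k) {x : L.carrier n}, x ∈ part n → L.P h x ∈ part k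

variable {L}

/-- The ideal generated by a family of homogeneous elements: the smallest ideal that contains it. -/
def idealSpan {ι : Type v} {deg : ι → ℕ} (ρ : ∀ i, L.carrier (deg i)) : L.MIdeal where
  part n := ⨅ I : {I : L.MIdeal // ∀ i, ρ i ∈ I.part (deg i)}, I.1.part n
  br_mem h x y hy := by
    simp only [Submodule.mem_iInf] at hy ⊢
    exact fun I => I.1.br_mem h x (hy I)
  P_mem h x hx := by
    simp only [Submodule.mem_iInf] at hx ⊢
    exact fun I => I.1.P_mem h (hx I)

theorem mem_idealSpan {ι : Type v} {deg : ι → ℕ} (ρ : ∀ i, L.carrier (deg i)) (i : ι) :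
    ρ i ∈ (idealSpan ρ).part (deg i) := by
  simp only [idealSpan, Submodule.mem_iInf]
  exact fun I => I.2 i

/-- Everything in degree `> 1`. -/
def plusIdeal (L : MixedLieAlgebra.{u}) : L.MIdeal where
  part n := if n ≤ 1 then ⊥ else ⊤
  br_mem {m n k} h x y hy := by
    by_cases hk : k ≤ 1
    · have hn : n ≤ 1 := by omega
      simp only [hn, if_true, Submodule.mem_bot] at hy
      simp [hy]
    · simp [hk]
  P_mem {n k} h x hx := by
    by_cases hk : k ≤ 1
    · have hn : n ≤ 1 := by omega
      simp only [hn, if_true, Submodule.mem_bot] at hx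
      simp [hx, P_zero]
    · simp [hk]

theorem idealSpan_part_one {ι : Type v} {deg : ι → ℕ} (ρ : ∀ i, L.carrier (deg i))
    (hdeg : ∀ i, 1 < deg i) : (idealSpan ρ).part 1 = ⊥ := by
  have h : ∀ i, ρ i ∈ L.plusIdeal.part (deg i) := fun i => by
    simp [plusIdeal, not_le.mpr (hdeg i)]
  have : (idealSpan ρ).part 1 ≤ L.plusIdeal.part 1 :=
    iInf_le (fun I : {I : L.MIdeal // ∀ i, ρ i ∈ I.part (deg i)} => I.1.part 1) ⟨_, h⟩
  simpa [plusIdeal] using this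

variable (L) in
/-- Multiplication by `π` on `L^+ = ⨁_{n > 1} L_n`, i.e. the linear operator given by `P` there;
it is zero on `L_1`. -/
def piMap {n k : ℕ} (h : n + 1 = k) : L.carrier n →ₗ[ZMod 2] L.carrier k :=
  (if hn : n = 1 then 0 else
    { toFun := L.P h
      map_zero' := P_zero h
      map_add' := L.P_add h hn } : L.carrier n →+ L.carrier k).toZModLinearMap 2

theorem piMap_apply {n k : ℕ} (h : n + 1 = k) (hn : n ≠ 1) (x : L.carrier n) :
    L.piMap h x = L.P h x := by
  simp [piMap, hn]

theorem P_congr (I : L.MIdeal) {n k : ℕ} (h : n + 1 = k) {x y : L.carrier n}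
    (hxy : x - y ∈ I.part n) : L.P h x - L.P h y ∈ I.part k := by
  obtain ⟨z, rfl⟩ : ∃ z, x = y + z := ⟨x - y, by abel⟩
  rw [add_sub_cancel_left] at hxy
  by_cases hn : n = 1
  · subst hn
    rw [L.P_add_one, add_sub_right_comm, add_sub_cancel_left]
    exact add_mem (I.P_mem h hxy) (I.br_mem h y hxy)
  · rw [L.P_add h hn, add_sub_cancel_left]
    exact I.P_mem h hxy

/-- The bracket induced on a quotient. -/
def quotientBr (I : L.MIdeal) {m n k : ℕ} (h : m + n = k) :
    (L.carrier m ⧸ I.part m) →ₗ[ZMod 2] (L.carrier n ⧸ I.part n) →ₗ[ZMod 2]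
      (L.carrier k ⧸ I.part k) :=
  (I.part m).liftQ
    { toFun := fun x => (I.part n).mapQ (I.part k) (L.br h x) (fun _ hy => I.br_mem h x hy)
      map_add' := fun x y => by ext; simp
      map_smul' := fun c x => by ext; simp }
    (fun x hx => by
      rw [LinearMap.mem_ker]
      ext y
      simp only [LinearMap.coe_mk, AddHom.coe_mk, LinearMap.coe_comp, Function.comp_apply,
        Submodule.mkQ_apply, Submodule.mapQ_apply, LinearMap.zero_apply]
      rw [Submodule.Quotient.mk_eq_zero, L.br_comm h (by omega)]
      exact neg_mem (I.br_mem _ y hx))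

theorem quotientBr_mk (I : L.MIdeal) {m n k : ℕ} (h : m + n = k) (x : L.carrier m)
    (y : L.carrier n) :
    quotientBr I h ((I.part m).mkQ x) ((I.part n).mkQ y) = (I.part k).mkQ (L.br h x y) := rfl

/-- The operator `P` induced on a quotient. -/
def quotientP (I : L.MIdeal) {n k : ℕ} (h : n + 1 = k) :
    (L.carrier n ⧸ I.part n) → (L.carrier k ⧸ I.part k) :=
  Quotient.map' (L.P h) (fun x y hxy => by
    rw [Submodule.quotientRel_def] at hxy ⊢
    exact P_congr I h hxy)

theorem quotientP_mk (I : L.MIdeal) {n k : ℕ} (h : n + 1 = k) (x : L.carrier n) :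
    quotientP I h ((I.part n).mkQ x) = (I.part k).mkQ (L.P h x) := rfl

/-- The quotient of a mixed Lie algebra by an ideal. -/
def quotient (L : MixedLieAlgebra.{u}) (I : L.MIdeal) : MixedLieAlgebra.{u} where
  carrier n := L.carrier n ⧸ I.part n
  subsingleton_zero := by
    have := L.subsingleton_zero
    exact (Submodule.mkQ_surjective (I.part 0)).subsingleton
  br h := quotientBr I h
  P h := quotientP I h
  br_self h x := by
    obtain ⟨x, rfl⟩ := Submodule.mkQ_surjective _ x
    rw [quotientBr_mk, L.br_self, map_zero]
  br_comm h h' x y := by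
    obtain ⟨x, rfl⟩ := Submodule.mkQ_surjective _ x
    obtain ⟨y, rfl⟩ := Submodule.mkQ_surjective _ y
    rw [quotientBr_mk, quotientBr_mk, L.br_comm h h', map_neg]
  jacobi hab h₁ hbc h₂ hca h₃ x y z := by
    obtain ⟨x, rfl⟩ := Submodule.mkQ_surjective _ x
    obtain ⟨y, rfl⟩ := Submodule.mkQ_surjective _ y
    obtain ⟨z, rfl⟩ := Submodule.mkQ_surjective _ z
    simp only [quotientBr_mk]
    rw [← map_add, ← map_add, L.jacobi, map_zero]
  P_add_one h x y := by
    obtain ⟨x, rfl⟩ := Submodule.mkQ_surjective _ x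
    obtain ⟨y, rfl⟩ := Submodule.mkQ_surjective _ y
    rw [← map_add, quotientP_mk, L.P_add_one, map_add, map_add]
    rfl
  P_add h hn x y := by
    obtain ⟨x, rfl⟩ := Submodule.mkQ_surjective _ x
    obtain ⟨y, rfl⟩ := Submodule.mkQ_surjective _ y
    rw [← map_add, quotientP_mk, L.P_add h hn, map_add]
    rfl
  br_P_one ha h hb h₁ h₂ x y := by
    obtain ⟨x, rfl⟩ := Submodule.mkQ_surjective _ x
    obtain ⟨y, rfl⟩ := Submodule.mkQ_surjective _ y
    rw [quotientP_mk, quotientBr_mk, L.br_P_one ha h hb h₁ h₂, map_add]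
    rfl
  br_P ha h hb h₁ hm x y := by
    obtain ⟨x, rfl⟩ := Submodule.mkQ_surjective _ x
    obtain ⟨y, rfl⟩ := Submodule.mkQ_surjective _ y
    rw [quotientP_mk, quotientBr_mk, L.br_P ha h hb h₁ hm]
    rfl

/-- The quotient map on homogeneous elements. -/
def quotientMk (I : L.MIdeal) (n : ℕ) : L.carrier n →ₗ[ZMod 2] (L.quotient I).carrier n :=
  (I.part n).mkQ

theorem quotientMk_surjective (I : L.MIdeal) (n : ℕ) : Function.Surjective (quotientMk I n) :=
  Submodule.mkQ_surjective _

theorem quotientMk_br (I : L.MIdeal) {m n k : ℕ} (h : m + n = k) (x : L.carrier m)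
    (y : L.carrier n) :
    (L.quotient I).br h (quotientMk I m x) (quotientMk I n y) = quotientMk I k (L.br h x y) := rfl

theorem quotientMk_P (I : L.MIdeal) {n k : ℕ} (h : n + 1 = k) (x : L.carrier n) :
    (L.quotient I).P h (quotientMk I n x) = quotientMk I k (L.P h x) := rfl

theorem IsQuadratic.quotient (hq : L.IsQuadratic) (I : L.MIdeal) :
    (L.quotient I).IsQuadratic := by
  intro n k h hn x
  obtain ⟨x, rfl⟩ := quotientMk_surjective I n x
  rw [quotientMk_P, hq h hn, map_zero]

/-- The ideal `π L^+`; its component of degree `n + 1` is `P (L_n)` for `n > 1`, and it is zero in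
degrees `≤ 2`. -/
def piIdeal (L : MixedLieAlgebra.{u}) : L.MIdeal where
  part k := ⨆ (n : ℕ) (h : n + 1 = k), LinearMap.range (L.piMap h)
  br_mem {m n k} h x y hy := by
    suffices H : (⨆ (a : ℕ) (ha : a + 1 = n), LinearMap.range (L.piMap ha)) ≤
        (⨆ (a : ℕ) (ha : a + 1 = k), LinearMap.range (L.piMap ha)).comap (L.br h x) from H hy
    refine iSup_le fun a => iSup_le fun ha => ?_
    rintro _ ⟨z, rfl⟩
    by_cases h1 : a = 1
    · subst h1
      simp [piMap]
    · rw [piMap_apply ha h1, Submodule.mem_comap]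
      by_cases hma : a + m = 1
      · have : a = 0 := by omega
        subst this
        have := L.subsingleton_zero
        rw [Subsingleton.elim z 0, P_zero, map_zero]
        exact zero_mem _
      · rw [L.br_comm h (by omega), L.br_P ha (by omega) rfl (by omega) h1, ← piMap_apply _ hma]
        exact neg_mem (Submodule.mem_iSup_of_mem _ (Submodule.mem_iSup_of_mem (by omega) ⟨_, rfl⟩))
  P_mem {n k} h x hx := by
    by_cases hn : n = 1
    · subst hn
      have hb : (⨆ (a : ℕ) (ha : a + 1 = 1), LinearMap.range (L.piMap ha)) = ⊥ := by
        refine eq_bot_iff.mpr (iSup_le fun a => iSup_le fun ha => ?_)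
        have : a = 0 := by omega
        subst this
        rintro _ ⟨z, rfl⟩
        have := L.subsingleton_zero
        rw [Subsingleton.elim z 0, map_zero]
        exact zero_mem _
      rw [hb, Submodule.mem_bot] at hx
      rw [hx, P_zero]
      exact zero_mem _
    · rw [← piMap_apply h hn]
      exact Submodule.mem_iSup_of_mem _ (Submodule.mem_iSup_of_mem h ⟨_, rfl⟩)

/-- The reduced algebra `L / π L^+`. -/
def reduced (L : MixedLieAlgebra.{u}) : MixedLieAlgebra.{u} := L.quotient L.piIdeal

/-- Reduction modulo `π` on homogeneous elements. -/
def reduction (L : MixedLieAlgebra.{u}) (n : ℕ) :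
    L.carrier n →ₗ[ZMod 2] L.reduced.carrier n := quotientMk L.piIdeal n

theorem reduced_isQuadratic (L : MixedLieAlgebra.{u}) : L.reduced.IsQuadratic := by
  intro n k h hn x
  obtain ⟨x, rfl⟩ := quotientMk_surjective L.piIdeal n x
  refine (Submodule.Quotient.mk_eq_zero _).mpr ?_
  rw [← piMap_apply h hn]
  exact Submodule.mem_iSup_of_mem _ (Submodule.mem_iSup_of_mem h ⟨_, rfl⟩)


/-! ### The free mixed Lie algebra on a weighted set -/

section Free

variable {X : Type u} (w : X → ℕ+)

/-- Formal homogeneous expressions in the elements of a weighted set. -/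
inductive FreeTerm : ℕ → Type u
  | of (x : X) : FreeTerm (w x)
  | zero (n : ℕ) : FreeTerm n
  | add {n : ℕ} (a b : FreeTerm n) : FreeTerm n
  | br {m n k : ℕ} (h : m + n = k) (a : FreeTerm m) (b : FreeTerm n) : FreeTerm k
  | P {n k : ℕ} (h : n + 1 = k) (a : FreeTerm n) : FreeTerm k

/-- The congruence on expressions generated by the axioms of a mixed Lie algebra. -/
inductive FreeRel : ∀ n : ℕ, FreeTerm w n → FreeTerm w n → Prop
  | refl {n : ℕ} (a : FreeTerm w n) : FreeRel n a a
  | symm {n : ℕ} {a b : FreeTerm w n} : FreeRel n a b → FreeRel n b a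
  | trans {n : ℕ} {a b c : FreeTerm w n} : FreeRel n a b → FreeRel n b c → FreeRel n a c
  | add_congr {n : ℕ} {a a' b b' : FreeTerm w n} :
      FreeRel n a a' → FreeRel n b b' → FreeRel n (.add a b) (.add a' b')
  | br_congr {m n k : ℕ} (h : m + n = k) {a a' : FreeTerm w m} {b b' : FreeTerm w n} :
      FreeRel m a a' → FreeRel n b b' → FreeRel k (.br h a b) (.br h a' b')
  | P_congr {n k : ℕ} (h : n + 1 = k) {a a' : FreeTerm w n} :
      FreeRel n a a' → FreeRel k (.P h a) (.P h a')
  | add_assoc {n : ℕ} (a b c : FreeTerm w n) : FreeRel n (.add (.add a b) c) (.add a (.add b c))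
  | add_comm {n : ℕ} (a b : FreeTerm w n) : FreeRel n (.add a b) (.add b a)
  | zero_add {n : ℕ} (a : FreeTerm w n) : FreeRel n (.add (.zero n) a) a
  | add_self {n : ℕ} (a : FreeTerm w n) : FreeRel n (.add a a) (.zero n)
  | br_add {m n k : ℕ} (h : m + n = k) (a : FreeTerm w m) (b b' : FreeTerm w n) :
      FreeRel k (.br h a (.add b b')) (.add (.br h a b) (.br h a b'))
  | add_br {m n k : ℕ} (h : m + n = k) (a a' : FreeTerm w m) (b : FreeTerm w n) :
      FreeRel k (.br h (.add a a') b) (.add (.br h a b) (.br h a' b))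
  | br_self {n k : ℕ} (h : n + n = k) (a : FreeTerm w n) : FreeRel k (.br h a a) (.zero k)
  | br_comm {m n k : ℕ} (h : m + n = k) (h' : n + m = k) (a : FreeTerm w m) (b : FreeTerm w n) :
      FreeRel k (.br h a b) (.br h' b a)
  | jacobi {p q r pq qr rp k : ℕ} (hpq : p + q = pq) (h₁ : pq + r = k)
      (hqr : q + r = qr) (h₂ : qr + p = k) (hrp : r + p = rp) (h₃ : rp + q = k)
      (a : FreeTerm w p) (b : FreeTerm w q) (c : FreeTerm w r) :
      FreeRel k (.add (.add (.br h₁ (.br hpq a b) c) (.br h₂ (.br hqr b c) a)) (.br h₃ (.br hrp c a) b))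
        (.zero k)
  | P_add_one {k : ℕ} (h : 1 + 1 = k) (a b : FreeTerm w 1) :
      FreeRel k (.P h (.add a b)) (.add (.add (.P h a) (.P h b)) (.br h a b))
  | P_add {n k : ℕ} (h : n + 1 = k) (hn : n ≠ 1) (a b : FreeTerm w n) :
      FreeRel k (.P h (.add a b)) (.add (.P h a) (.P h b))
  | br_P_one {n p q r : ℕ} (hp : 1 + 1 = p) (h : p + n = r) (hq : 1 + n = q)
      (h₁ : q + 1 = r) (h₂ : 1 + q = r) (a : FreeTerm w 1) (b : FreeTerm w n) :
      FreeRel r (.br h (.P hp a) b) (.add (.P h₁ (.br hq a b)) (.br h₂ a (.br hq a b)))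
  | br_P {m n p q r : ℕ} (hp : m + 1 = p) (h : p + n = r) (hq : m + n = q)
      (h₁ : q + 1 = r) (hm : m ≠ 1) (a : FreeTerm w m) (b : FreeTerm w n) :
      FreeRel r (.br h (.P hp a) b) (.P h₁ (.br hq a b))

/-- The congruence as a setoid. -/
def freeSetoid (n : ℕ) : Setoid (FreeTerm w n) where
  r := FreeRel w n
  iseqv := ⟨FreeRel.refl, FreeRel.symm, FreeRel.trans⟩

/-- Homogeneous component of degree `n` of the free mixed Lie algebra. -/
def FreeCarrier (n : ℕ) : Type u := Quotient (freeSetoid w n)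

/-- The element given by an expression. -/
def freeMk {n : ℕ} (a : FreeTerm w n) : FreeCarrier w n := Quotient.mk _ a

instance (n : ℕ) : Zero (FreeCarrier w n) := ⟨freeMk w (FreeTerm.zero n)⟩

instance (n : ℕ) : Neg (FreeCarrier w n) := ⟨id⟩

instance (n : ℕ) : Add (FreeCarrier w n) :=
  ⟨Quotient.map₂ FreeTerm.add fun _ _ h _ _ h' => FreeRel.add_congr h h'⟩

theorem freeCarrier_add_self {n : ℕ} (a : FreeCarrier w n) : a + a = 0 := by
  rcases a with ⟨a⟩
  exact Quotient.sound (FreeRel.add_self a)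

theorem freeCarrier_zero_add {n : ℕ} (a : FreeCarrier w n) : 0 + a = a := by
  rcases a with ⟨a⟩
  exact Quotient.sound (FreeRel.zero_add a)

theorem freeCarrier_add_comm {n : ℕ} (a b : FreeCarrier w n) : a + b = b + a := by
  rcases a with ⟨a⟩
  rcases b with ⟨b⟩
  exact Quotient.sound (FreeRel.add_comm a b)

instance (n : ℕ) : AddCommGroup (FreeCarrier w n) where
  nsmul := nsmulRec
  zsmul := zsmulRec
  add_assoc a b c := by
    rcases a with ⟨a⟩
    rcases b with ⟨b⟩
    rcases c with ⟨c⟩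
    exact Quotient.sound (FreeRel.add_assoc a b c)
  zero_add := freeCarrier_zero_add w
  add_zero a := by rw [freeCarrier_add_comm, freeCarrier_zero_add]
  add_comm := freeCarrier_add_comm w
  neg_add_cancel := freeCarrier_add_self w

theorem freeCarrier_neg {n : ℕ} (a : FreeCarrier w n) : -a = a := rfl

instance (n : ℕ) : Module (ZMod 2) (FreeCarrier w n) :=
  AddCommGroup.zmodModule fun a => by rw [two_nsmul, freeCarrier_add_self]

/-- The bracket on the free mixed Lie algebra, as a map. -/
def freeBr {m n k : ℕ} (h : m + n = k) :
    FreeCarrier w m → FreeCarrier w n → FreeCarrier w k :=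
  Quotient.map₂ (FreeTerm.br h) fun _ _ h₁ _ _ h₂ => FreeRel.br_congr h h₁ h₂

theorem freeBr_add {m n k : ℕ} (h : m + n = k) (a : FreeCarrier w m) (b b' : FreeCarrier w n) :
    freeBr w h a (b + b') = freeBr w h a b + freeBr w h a b' := by
  rcases a with ⟨a⟩
  rcases b with ⟨b⟩
  rcases b' with ⟨c⟩
  exact Quotient.sound (FreeRel.br_add h a b c)

theorem free_add_br {m n k : ℕ} (h : m + n = k) (a a' : FreeCarrier w m) (b : FreeCarrier w n) :
    freeBr w h (a + a') b = freeBr w h a b + freeBr w h a' b := by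
  rcases a with ⟨a⟩
  rcases a' with ⟨c⟩
  rcases b with ⟨b⟩
  exact Quotient.sound (FreeRel.add_br h a c b)

theorem freeCarrier_subsingleton {n : ℕ} (hn : n = 0) (a : FreeTerm w n) :
    freeMk w a = 0 := by
  induction a with
  | of x => exact absurd hn (w x).ne_zero
  | zero n => rfl
  | @add n a b iha ihb =>
    exact (congrArg₂ (· + ·) (iha hn) (ihb hn)).trans (freeCarrier_zero_add w _)
  | @br m n k h a b iha ihb =>
    have h1 : freeBr w h (0 : FreeCarrier w m) (freeMk w b) = 0 := by
      have := free_add_br w h 0 0 (freeMk w b)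
      rw [freeCarrier_zero_add] at this
      exact left_eq_add.mp this
    have h2 := iha (by omega)
    rw [← h2] at h1
    exact h1
  | @P n k h a ih => omega

/-- The free mixed Lie algebra `L_mix(X)` on the weighted set `X`, with weights `w`: the
homogeneous expressions in `X` modulo the axioms. -/
def free : MixedLieAlgebra.{u} where
  carrier := FreeCarrier w
  subsingleton_zero := ⟨fun a b => by
    rcases a with ⟨a⟩
    rcases b with ⟨b⟩
    exact (freeCarrier_subsingleton w rfl a).trans (freeCarrier_subsingleton w rfl b).symm⟩
  br h := (AddMonoidHom.mk' (fun a =>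
      (AddMonoidHom.mk' (freeBr w h a) (freeBr_add w h a)).toZModLinearMap 2)
      (fun a a' => by ext b; exact free_add_br w h a a' b)).toZModLinearMap 2
  P h := Quotient.map (FreeTerm.P h) fun _ _ h' => FreeRel.P_congr h h'
  br_self h a := by
    rcases a with ⟨a⟩
    exact Quotient.sound (FreeRel.br_self h a)
  br_comm h h' a b := by
    rcases a with ⟨a⟩
    rcases b with ⟨b⟩
    exact Quotient.sound (FreeRel.br_comm h h' a b)
  jacobi hab h₁ hbc h₂ hca h₃ a b c := by
    rcases a with ⟨a⟩
    rcases b with ⟨b⟩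
    rcases c with ⟨c⟩
    exact Quotient.sound (FreeRel.jacobi hab h₁ hbc h₂ hca h₃ a b c)
  P_add_one h a b := by
    rcases a with ⟨a⟩
    rcases b with ⟨b⟩
    exact Quotient.sound (FreeRel.P_add_one h a b)
  P_add h hn a b := by
    rcases a with ⟨a⟩
    rcases b with ⟨b⟩
    exact Quotient.sound (FreeRel.P_add h hn a b)
  br_P_one ha h hb h₁ h₂ a b := by
    rcases a with ⟨a⟩
    rcases b with ⟨b⟩
    exact Quotient.sound (FreeRel.br_P_one ha h hb h₁ h₂ a b)
  br_P ha h hb h₁ hm a b := by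
    rcases a with ⟨a⟩
    rcases b with ⟨b⟩
    exact Quotient.sound (FreeRel.br_P ha h hb h₁ hm a b)

/-- The generators of the free mixed Lie algebra. -/
def freeOf (x : X) : (free w).carrier (w x) := freeMk w (FreeTerm.of x)

end Free

/-- Homomorphisms of mixed Lie algebras. -/
structure Hom (L : MixedLieAlgebra.{u}) (L' : MixedLieAlgebra.{v}) where
  toFun : ∀ n, L.carrier n →ₗ[ZMod 2] L'.carrier n
  map_br : ∀ {m n k : ℕ} (h : m + n = k) (x : L.carrier m) (y : L.carrier n),
    toFun k (L.br h x y) = L'.br h (toFun m x) (toFun n y)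
  map_P : ∀ {n k : ℕ} (h : n + 1 = k) (x : L.carrier n),
    toFun k (L.P h x) = L'.P h (toFun n x)

section FreeUniversal

variable {X : Type u} (w : X → ℕ+) {L' : MixedLieAlgebra.{v}} (φ : ∀ x, L'.carrier (w x))

/-- Evaluation of formal expressions in a mixed Lie algebra. -/
def interp : ∀ {n : ℕ}, FreeTerm w n → L'.carrier n
  | _, .of x => φ x
  | _, .zero _ => 0
  | _, .add a b => interp a + interp b
  | _, .br h a b => L'.br h (interp a) (interp b)
  | _, .P h a => L'.P h (interp a)

theorem interp_rel {n : ℕ} {a b : FreeTerm w n} (h : FreeRel w n a b) :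
    interp w φ a = interp w φ b := by
  induction h with
  | refl => rfl
  | symm _ ih => exact ih.symm
  | trans _ _ ih ih' => exact ih.trans ih'
  | add_congr _ _ ih ih' => simp only [interp, ih, ih']
  | br_congr _ _ _ ih ih' => simp only [interp, ih, ih']
  | P_congr _ _ ih => simp only [interp, ih]
  | add_assoc => exact add_assoc _ _ _
  | add_comm => exact add_comm _ _
  | zero_add => exact zero_add _
  | add_self => exact ZModModule.add_self _
  | br_add => exact map_add _ _ _
  | add_br => simp only [interp, map_add, LinearMap.add_apply]
  | br_self => exact L'.br_self _ _
  | br_comm h h' => exact (L'.br_comm h h' _ _).trans (ZModModule.neg_eq_self _)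
  | jacobi => exact L'.jacobi _ _ _ _ _ _ _ _ _
  | P_add_one => exact L'.P_add_one _ _ _
  | P_add _ hn => exact L'.P_add _ hn _ _
  | br_P_one => exact L'.br_P_one _ _ _ _ _ _ _
  | br_P _ _ _ _ hm => exact L'.br_P _ _ _ _ hm _ _

/-- The universal property of the free mixed Lie algebra on a weighted set. -/
theorem free_universal :
    ∃! f : Hom (free w) L', ∀ x, f.toFun (w x) (freeOf w x) = φ x := by
  refine ⟨⟨fun n => (AddMonoidHom.mk' (M := FreeCarrier w n)
      (Quotient.lift (interp w φ) fun _ _ h => interp_rel w φ h) (by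
        rintro ⟨a⟩ ⟨b⟩
        rfl)).toZModLinearMap 2, ?_, ?_⟩, fun x => rfl, ?_⟩
  · rintro m n k h ⟨a⟩ ⟨b⟩
    rfl
  · rintro n k h ⟨a⟩
    rfl
  · rintro ⟨g, hbr, hP⟩ hg
    congr
    funext n
    refine LinearMap.ext (Quotient.ind fun a => ?_)
    change g n (Quotient.mk _ a) = interp w φ a
    induction a with
    | of x => exact hg x
    | zero n => exact map_zero (g n)
    | add a b iha ihb => exact (map_add (g _) _ _).trans (congrArg₂ _ iha ihb)
    | br h a b iha ihb =>
      exact (hbr h (Quotient.mk _ a) (Quotient.mk _ b)).trans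
        (congrArg₂ (fun s t => L'.br h s t) iha ihb)
    | P h a ih => exact (hP h (Quotient.mk _ a)).trans (congrArg (L'.P h) ih)

end FreeUniversal

/-! ### Enveloping algebras -/

section Enveloping

variable (L)

/-- The defining relations of the enveloping algebra over `𝔽₂[π]` (the variable `X` is `π`):
additivity, `[x, y] = x y - y x`, `P x = π x + x ^ 2` in degree `1` and `P x = π x` in degree
`> 1`. -/
inductive UMixRel : FreeAlgebra (ZMod 2)[X] (Σ n, L.carrier n) →
    FreeAlgebra (ZMod 2)[X] (Σ n, L.carrier n) → Prop
  | add {n : ℕ} (x y : L.carrier n) :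
      UMixRel (.ι _ ⟨n, x + y⟩) (.ι _ ⟨n, x⟩ + .ι _ ⟨n, y⟩)
  | br {m n k : ℕ} (h : m + n = k) (x : L.carrier m) (y : L.carrier n) :
      UMixRel (.ι _ ⟨k, L.br h x y⟩)
        (.ι _ ⟨m, x⟩ * .ι _ ⟨n, y⟩ - .ι _ ⟨n, y⟩ * .ι _ ⟨m, x⟩)
  | P_one {k : ℕ} (h : 1 + 1 = k) (x : L.carrier 1) :
      UMixRel (.ι _ ⟨k, L.P h x⟩)
        ((Polynomial.X : (ZMod 2)[X]) • .ι _ ⟨1, x⟩ + .ι _ ⟨1, x⟩ * .ι _ ⟨1, x⟩)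
  | P {n k : ℕ} (h : n + 1 = k) (hn : n ≠ 1) (x : L.carrier n) :
      UMixRel (.ι _ ⟨k, L.P h x⟩) ((Polynomial.X : (ZMod 2)[X]) • .ι _ ⟨n, x⟩)

/-- The enveloping algebra `U_mix(L)` of a mixed Lie algebra, an associative algebra over
`𝔽₂[π]`. -/
abbrev UMix : Type u := RingQuot (UMixRel L)

/-- The canonical map of a mixed Lie algebra into its enveloping algebra. -/
noncomputable def uMixOf {n : ℕ} (x : L.carrier n) : L.UMix :=
  RingQuot.mkAlgHom (ZMod 2)[X] (UMixRel L) (.ι _ ⟨n, x⟩)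

/-- The defining relations of the enveloping algebra of a quadratic Lie algebra over `𝔽₂`:
additivity, `[x, y] = x y - y x`, and `P x = x ^ 2` in degree `1`. -/
inductive UQuadRel : FreeAlgebra (ZMod 2) (Σ n, L.carrier n) →
    FreeAlgebra (ZMod 2) (Σ n, L.carrier n) → Prop
  | add {n : ℕ} (x y : L.carrier n) :
      UQuadRel (.ι _ ⟨n, x + y⟩) (.ι _ ⟨n, x⟩ + .ι _ ⟨n, y⟩)
  | br {m n k : ℕ} (h : m + n = k) (x : L.carrier m) (y : L.carrier n) :
      UQuadRel (.ι _ ⟨k, L.br h x y⟩)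
        (.ι _ ⟨m, x⟩ * .ι _ ⟨n, y⟩ - .ι _ ⟨n, y⟩ * .ι _ ⟨m, x⟩)
  | P_one {k : ℕ} (h : 1 + 1 = k) (x : L.carrier 1) :
      UQuadRel (.ι _ ⟨k, L.P h x⟩) (.ι _ ⟨1, x⟩ * .ι _ ⟨1, x⟩)

/-- The enveloping algebra `U_quad(L)` of a quadratic Lie algebra, an associative algebra over
`𝔽₂`. -/
abbrev UQuad : Type u := RingQuot (UQuadRel L)

/-- The canonical map of a quadratic Lie algebra into its enveloping algebra. -/
noncomputable def uQuadOf {n : ℕ} (x : L.carrier n) : L.UQuad :=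
  RingQuot.mkAlgHom (ZMod 2) (UQuadRel L) (.ι _ ⟨n, x⟩)

variable {L}

/-- The universal property of `U_mix(L)`: extension of homomorphisms. -/
noncomputable def uMixLift {B : Type v} [Ring B] [Algebra (ZMod 2)[X] B]
    (φ : ∀ n, L.carrier n →+ B)
    (hbr : ∀ {m n k : ℕ} (h : m + n = k) (x : L.carrier m) (y : L.carrier n),
      φ k (L.br h x y) = φ m x * φ n y - φ n y * φ m x)
    (hP_one : ∀ {k : ℕ} (h : 1 + 1 = k) (x : L.carrier 1),
      φ k (L.P h x) = (Polynomial.X : (ZMod 2)[X]) • φ 1 x + φ 1 x * φ 1 x)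
    (hP : ∀ {n k : ℕ} (h : n + 1 = k), n ≠ 1 → ∀ x : L.carrier n,
      φ k (L.P h x) = (Polynomial.X : (ZMod 2)[X]) • φ n x) :
    L.UMix →ₐ[(ZMod 2)[X]] B :=
  RingQuot.liftAlgHom (ZMod 2)[X] ⟨FreeAlgebra.lift (ZMod 2)[X] fun s => φ s.1 s.2, by
    rintro _ _ (⟨x, y⟩ | ⟨h, x, y⟩ | ⟨h, x⟩ | ⟨h, hn, x⟩)
    · simp
    · simp [hbr]
    · simp [hP_one]
    · simp [hP h hn]⟩

/-- The universal property of `U_quad(L)`: extension of homomorphisms. -/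
noncomputable def uQuadLift {B : Type v} [Ring B] [Algebra (ZMod 2) B]
    (φ : ∀ n, L.carrier n →+ B)
    (hbr : ∀ {m n k : ℕ} (h : m + n = k) (x : L.carrier m) (y : L.carrier n),
      φ k (L.br h x y) = φ m x * φ n y - φ n y * φ m x)
    (hP_one : ∀ {k : ℕ} (h : 1 + 1 = k) (x : L.carrier 1),
      φ k (L.P h x) = φ 1 x * φ 1 x) :
    L.UQuad →ₐ[ZMod 2] B :=
  RingQuot.liftAlgHom (ZMod 2) ⟨FreeAlgebra.lift (ZMod 2) fun s => φ s.1 s.2, by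
    rintro _ _ (⟨x, y⟩ | ⟨h, x, y⟩ | ⟨h, x⟩)
    · simp
    · simp [hbr]
    · simp [hP_one]⟩

theorem uMixLift_of {B : Type v} [Ring B] [Algebra (ZMod 2)[X] B]
    (φ : ∀ n, L.carrier n →+ B) (hbr) (hP_one) (hP) {n : ℕ} (x : L.carrier n) :
    uMixLift φ hbr hP_one hP (L.uMixOf x) = φ n x := by
  rw [uMixLift, uMixOf, RingQuot.liftAlgHom_mkAlgHom_apply, FreeAlgebra.lift_ι_apply]

theorem uQuadLift_of {B : Type v} [Ring B] [Algebra (ZMod 2) B]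
    (φ : ∀ n, L.carrier n →+ B) (hbr) (hP_one) {n : ℕ} (x : L.carrier n) :
    uQuadLift φ hbr hP_one (L.uQuadOf x) = φ n x := by
  rw [uQuadLift, uQuadOf, RingQuot.liftAlgHom_mkAlgHom_apply, FreeAlgebra.lift_ι_apply]

/-- The universal property of `U_mix(L)`: uniqueness. -/
theorem uMix_ext {B : Type v} [Ring B] [Algebra (ZMod 2)[X] B] {f g : L.UMix →ₐ[(ZMod 2)[X]] B}
    (h : ∀ (n : ℕ) (x : L.carrier n), f (L.uMixOf x) = g (L.uMixOf x)) : f = g := by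
  refine RingQuot.ringQuot_ext' _ _ _ (FreeAlgebra.hom_ext ?_)
  funext s
  exact h s.1 s.2

/-- The universal property of `U_quad(L)`: uniqueness. -/
theorem uQuad_ext {B : Type v} [Ring B] [Algebra (ZMod 2) B] {f g : L.UQuad →ₐ[ZMod 2] B}
    (h : ∀ (n : ℕ) (x : L.carrier n), f (L.uQuadOf x) = g (L.uQuadOf x)) : f = g := by
  refine RingQuot.ringQuot_ext' _ _ _ (FreeAlgebra.hom_ext ?_)
  funext s
  exact h s.1 s.2

end Enveloping

/-! ### The module `r / [r, r]` -/

section Adjoint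

variable (I : L.MIdeal)

/-- Homogeneous component of `[r, r]`. -/
def derivedPart (n : ℕ) : Submodule (ZMod 2) (L.carrier n) :=
  Submodule.span (ZMod 2) {z | ∃ (a b : ℕ) (h : a + b = n) (x : L.carrier a) (y : L.carrier b),
    x ∈ I.part a ∧ y ∈ I.part b ∧ L.br h x y = z}

/-- Homogeneous component of `r / [r, r]`. -/
def abelPart (n : ℕ) : Type u := I.part n ⧸ (derivedPart I n).submoduleOf (I.part n)

instance (n : ℕ) : AddCommGroup (abelPart I n) :=
  inferInstanceAs (AddCommGroup (I.part n ⧸ (derivedPart I n).submoduleOf (I.part n)))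

instance (n : ℕ) : Module (ZMod 2) (abelPart I n) :=
  inferInstanceAs (Module (ZMod 2) (I.part n ⧸ (derivedPart I n).submoduleOf (I.part n)))

/-- The quotient map in degree `n`. -/
def abelPartMk (n : ℕ) : I.part n →ₗ[ZMod 2] abelPart I n :=
  Submodule.mkQ ((derivedPart I n).submoduleOf (I.part n))

theorem abelPartMk_surjective (n : ℕ) : Function.Surjective (abelPartMk I n) :=
  Submodule.mkQ_surjective _

/-- The map on `r / [r, r]` induced by a linear map that preserves `r` and `[r, r]`. -/
def abelPartMap {n k : ℕ} (f : L.carrier n →ₗ[ZMod 2] L.carrier k)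
    (hf : ∀ y ∈ I.part n, f y ∈ I.part k) (hd : ∀ y ∈ derivedPart I n, f y ∈ derivedPart I k) :
    abelPart I n →ₗ[ZMod 2] abelPart I k :=
  Submodule.mapQ ((derivedPart I n).submoduleOf (I.part n))
    ((derivedPart I k).submoduleOf (I.part k)) (f.restrict hf) (fun y hy => hd y hy)

theorem abelPartMap_mk {n k : ℕ} (f : L.carrier n →ₗ[ZMod 2] L.carrier k)
    (hf : ∀ y ∈ I.part n, f y ∈ I.part k) (hd : ∀ y ∈ derivedPart I n, f y ∈ derivedPart I k)
    (y : L.carrier n) (hy : y ∈ I.part n) :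
    abelPartMap I f hf hd (abelPartMk I n ⟨y, hy⟩) = abelPartMk I k ⟨f y, hf y hy⟩ := rfl

/-- `r / [r, r]` as a vector space over `𝔽₂`. -/
abbrev Abel : Type u := ⨁ n, abelPart I n

/-- The class in `r / [r, r]` of a homogeneous element of `r`. -/
def abelMk {n : ℕ} : I.part n →ₗ[ZMod 2] Abel I :=
  DirectSum.lof (ZMod 2) ℕ (abelPart I) n ∘ₗ abelPartMk I n

theorem abelMk_derived {n : ℕ} {y : L.carrier n} (hy : y ∈ I.part n)
    (hd : y ∈ derivedPart I n) : abelMk I ⟨y, hy⟩ = 0 := by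
  have : abelPartMk I n ⟨y, hy⟩ = 0 :=
    (Submodule.Quotient.mk_eq_zero _).mpr hd
  rw [abelMk, LinearMap.comp_apply, this, map_zero]

theorem abel_ext {f g : Abel I →ₗ[ZMod 2] Abel I}
    (h : ∀ n (y : L.carrier n) (hy : y ∈ I.part n), f (abelMk I ⟨y, hy⟩) = g (abelMk I ⟨y, hy⟩)) :
    f = g := by
  refine DirectSum.linearMap_ext _ fun n => LinearMap.ext fun z => ?_
  obtain ⟨⟨y, hy⟩, rfl⟩ := abelPartMk_surjective I n z
  exact h n y hy

theorem br_mem_derived {m n k : ℕ} (h : m + n = k) (x : L.carrier m) {y : L.carrier n}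
    (hy : y ∈ derivedPart I n) : L.br h x y ∈ derivedPart I k := by
  suffices H : derivedPart I n ≤ (derivedPart I k).comap (L.br h x) from H hy
  refine Submodule.span_le.mpr ?_
  rintro _ ⟨a, b, hab, s, t, hs, ht, rfl⟩
  rw [SetLike.mem_coe, Submodule.mem_comap,
    L.leibniz hab h rfl (by omega : (m + a) + b = k) rfl (by omega : a + (m + b) = k)]
  exact add_mem (Submodule.subset_span ⟨_, _, _, _, _, I.br_mem _ _ hs, ht, rfl⟩)
    (Submodule.subset_span ⟨_, _, _, _, _, hs, I.br_mem _ _ ht, rfl⟩)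

theorem piMap_mem {n k : ℕ} (h : n + 1 = k) {y : L.carrier n}
    (hy : y ∈ I.part n) : L.piMap h y ∈ I.part k := by
  by_cases hn : n = 1
  · subst hn
    simp [piMap]
  · rw [piMap_apply h hn]
    exact I.P_mem h hy

theorem piMap_mem_derived {n k : ℕ} (h : n + 1 = k) {y : L.carrier n}
    (hy : y ∈ derivedPart I n) : L.piMap h y ∈ derivedPart I k := by
  suffices H : derivedPart I n ≤ (derivedPart I k).comap (L.piMap h) from H hy
  refine Submodule.span_le.mpr ?_
  rintro _ ⟨a, b, hab, s, t, hs, ht, rfl⟩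
  rw [SetLike.mem_coe, Submodule.mem_comap]
  by_cases hn : n = 1
  · subst hn
    simp [piMap]
  · rw [piMap_apply h hn]
    by_cases ha : a = 1
    · subst ha
      have e := L.br_P_one (c := k) rfl (by omega) hab h (by omega) s t
      rw [← sub_eq_iff_eq_add] at e
      rw [← e]
      exact sub_mem (Submodule.subset_span ⟨_, _, _, _, _, I.P_mem rfl hs, ht, rfl⟩)
        (Submodule.subset_span ⟨_, _, _, _, _, hs, I.br_mem _ _ ht, rfl⟩)
    · rw [← L.br_P (c := k) rfl (by omega) hab h ha s t]
      exact Submodule.subset_span ⟨_, _, _, _, _, I.P_mem rfl hs, ht, rfl⟩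

/-- The adjoint action of a homogeneous element of `L` on `r / [r, r]`. -/
def adEnd {m : ℕ} (x : L.carrier m) : Abel I →ₗ[ZMod 2] Abel I :=
  DirectSum.toModule (ZMod 2) ℕ _ fun n =>
    DirectSum.lof (ZMod 2) ℕ (abelPart I) (m + n) ∘ₗ
      abelPartMap I (L.br rfl x) (fun _ hy => I.br_mem rfl x hy)
        (fun _ hy => br_mem_derived I rfl x hy)

/-- Multiplication by `π` on `r / [r, r]`, given by the operator `P` in degrees `> 1`. -/
def piEnd : Abel I →ₗ[ZMod 2] Abel I :=
  DirectSum.toModule (ZMod 2) ℕ _ fun n =>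
    DirectSum.lof (ZMod 2) ℕ (abelPart I) (n + 1) ∘ₗ
      abelPartMap I (L.piMap rfl) (fun _ hy => piMap_mem I rfl hy)
        (fun _ hy => piMap_mem_derived I rfl hy)

theorem adEnd_mk {m n k : ℕ} (h : m + n = k) (x : L.carrier m) (y : L.carrier n)
    (hy : y ∈ I.part n) :
    adEnd I x (abelMk I ⟨y, hy⟩) = abelMk I ⟨L.br h x y, I.br_mem h x hy⟩ := by
  subst h
  simp only [adEnd, abelMk, LinearMap.comp_apply, DirectSum.toModule_lof,
    abelPartMap_mk]

theorem piEnd_mk {n k : ℕ} (h : n + 1 = k) (hn : n ≠ 1) (y : L.carrier n) (hy : y ∈ I.part n) :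
    piEnd I (abelMk I ⟨y, hy⟩) = abelMk I ⟨L.P h y, I.P_mem h hy⟩ := by
  subst h
  simp only [← piMap_apply _ hn, piEnd, abelMk, LinearMap.comp_apply, DirectSum.toModule_lof,
    abelPartMap_mk]

theorem abelMk_add {n : ℕ} {y z : L.carrier n} (hy : y ∈ I.part n) (hz : z ∈ I.part n)
    (hyz : y + z ∈ I.part n) : abelMk I ⟨y + z, hyz⟩ = abelMk I ⟨y, hy⟩ + abelMk I ⟨z, hz⟩ :=
  map_add (abelMk I) ⟨y, hy⟩ ⟨z, hz⟩

theorem abelMk_congr {n : ℕ} {y z : L.carrier n} (hyz : y = z) (hy : y ∈ I.part n) :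
    abelMk I ⟨y, hy⟩ = abelMk I ⟨z, hyz ▸ hy⟩ := by
  subst hyz
  rfl

theorem adEnd_add {m : ℕ} (x y : L.carrier m) : adEnd I (x + y) = adEnd I x + adEnd I y := by
  refine abel_ext I fun n z hz => ?_
  rw [LinearMap.add_apply, adEnd_mk I rfl, adEnd_mk I rfl, adEnd_mk I rfl, ← map_add]
  exact abelMk_congr I (by simp) _

theorem adEnd_zero {m : ℕ} : adEnd I (0 : L.carrier m) = 0 := by
  have := adEnd_add I (0 : L.carrier m) 0
  rw [add_zero] at this
  exact left_eq_add.mp this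

theorem adEnd_of_mem {m : ℕ} {x : L.carrier m} (hx : x ∈ I.part m) : adEnd I x = 0 := by
  refine abel_ext I fun n z hz => ?_
  rw [adEnd_mk I rfl]
  exact abelMk_derived I _ (Submodule.subset_span ⟨_, _, _, _, _, hx, hz, rfl⟩)

theorem adEnd_br {m n k : ℕ} (h : m + n = k) (x : L.carrier m) (y : L.carrier n) :
    adEnd I (L.br h x y) = adEnd I x ∘ₗ adEnd I y - adEnd I y ∘ₗ adEnd I x := by
  rw [eq_sub_iff_add_eq (G := Module.End (ZMod 2) (Abel I))]
  refine abel_ext I fun c z hz => ?_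
  rw [LinearMap.add_apply, LinearMap.comp_apply, LinearMap.comp_apply, adEnd_mk I rfl,
    adEnd_mk I rfl, adEnd_mk I (k := k + c) (by omega), adEnd_mk I rfl,
    adEnd_mk I (k := k + c) (by omega), ← map_add]
  exact abelMk_congr I (L.leibniz _ _ _ _ _ _ x y z).symm _

theorem adEnd_P_one {k : ℕ} (h : 1 + 1 = k) (x : L.carrier 1) :
    adEnd I (L.P h x) = piEnd I ∘ₗ adEnd I x + adEnd I x ∘ₗ adEnd I x := by
  refine abel_ext I fun c z hz => ?_
  rw [LinearMap.add_apply, LinearMap.comp_apply, LinearMap.comp_apply]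
  by_cases hc : c = 0
  · subst hc
    have := L.subsingleton_zero
    obtain rfl : z = 0 := Subsingleton.elim _ _
    have : abelMk I ⟨(0 : L.carrier 0), hz⟩ = 0 := map_zero (abelMk I)
    simp [this]
  · rw [adEnd_mk I (k := k + c) rfl, adEnd_mk I (k := 1 + c) rfl,
      piEnd_mk I (k := k + c) (by omega) (by omega),
      adEnd_mk I (k := k + c) (by omega), ← map_add]
    exact abelMk_congr I (L.br_P_one _ _ _ _ _ x z) _

theorem adEnd_P {n k : ℕ} (h : n + 1 = k) (hn : n ≠ 1) (x : L.carrier n) :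
    adEnd I (L.P h x) = piEnd I ∘ₗ adEnd I x := by
  by_cases h0 : n = 0
  · subst h0
    have := L.subsingleton_zero
    obtain rfl : x = 0 := Subsingleton.elim _ _
    rw [P_zero, adEnd_zero, adEnd_zero, LinearMap.comp_zero]
  refine abel_ext I fun c z hz => ?_
  rw [LinearMap.comp_apply, adEnd_mk I (k := k + c) rfl, adEnd_mk I (k := n + c) rfl,
    piEnd_mk I (k := k + c) (by omega) (by omega)]
  exact abelMk_congr I (L.br_P _ _ _ _ hn x z) _

theorem adEnd_comm_piEnd {m : ℕ} (x : L.carrier m) (hI : I.part 1 = ⊥) :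
    adEnd I x ∘ₗ piEnd I = piEnd I ∘ₗ adEnd I x := by
  by_cases h0 : m = 0
  · subst h0
    have := L.subsingleton_zero
    obtain rfl : x = 0 := Subsingleton.elim _ _
    rw [adEnd_zero, LinearMap.comp_zero, LinearMap.zero_comp]
  refine abel_ext I fun c z hz => ?_
  rw [LinearMap.comp_apply, LinearMap.comp_apply]
  have key : ∀ hc : z = 0, adEnd I x (piEnd I (abelMk I ⟨z, hz⟩)) =
      piEnd I (adEnd I x (abelMk I ⟨z, hz⟩)) := by
    rintro rfl
    have : abelMk I ⟨(0 : L.carrier c), hz⟩ = 0 := map_zero (abelMk I)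
    simp [this]
  by_cases hc0 : c = 0
  · subst hc0
    have := L.subsingleton_zero
    exact key (Subsingleton.elim _ _)
  by_cases hc1 : c = 1
  · subst hc1
    exact key (by simpa [hI] using hz)
  rw [piEnd_mk I rfl hc1, adEnd_mk I (k := m + c) rfl, piEnd_mk I rfl (by omega),
    adEnd_mk I (k := m + c + 1) (by omega)]
  refine abelMk_congr I ?_ _
  rw [L.br_comm _ (by omega), L.br_P (b := m + c) rfl _ (by omega) rfl hc1,
    ZModModule.neg_eq_self, L.br_comm (k := m + c) (by omega) rfl, ZModModule.neg_eq_self]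

/-- The adjoint action of the quotient `L / r` on `r / [r, r]`. -/
def adQuot (m : ℕ) : (L.quotient I).carrier m →+ Module.End (ZMod 2) (Abel I) :=
  QuotientAddGroup.lift (I.part m).toAddSubgroup
    (AddMonoidHom.mk' (M := L.carrier m) (G := Module.End (ZMod 2) (Abel I)) (adEnd I)
      (adEnd_add I)) fun _ hx => adEnd_of_mem I hx

theorem adQuot_mk {m : ℕ} (x : L.carrier m) : adQuot I m (quotientMk I m x) = adEnd I x := rfl

/-- `r / [r, r]` as a module over `𝔽₂[π]`, for an ideal `r` contained in `L^+`. -/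
abbrev AbelMix (_hI : I.part 1 = ⊥) : Type u := Module.AEval' (piEnd I)

/-- The class in `r / [r, r]` of a homogeneous element of `r`. -/
noncomputable def abelMixMk (hI : I.part 1 = ⊥) {n : ℕ} (y : I.part n) : AbelMix I hI :=
  Module.AEval'.of (piEnd I) (abelMk I y)

variable (hI : I.part 1 = ⊥)

theorem adQuot_comm_piEnd (hI : I.part 1 = ⊥) {m : ℕ} (x : (L.quotient I).carrier m) (y : Abel I) :
    adQuot I m x (piEnd I y) = piEnd I (adQuot I m x y) := by
  obtain ⟨x, rfl⟩ := quotientMk_surjective I m x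
  exact LinearMap.congr_fun (adEnd_comm_piEnd I x hI) y

/-- The adjoint action of `L / r` on `r / [r, r]`, which is linear over `𝔽₂[π]`. -/
noncomputable def adMix (m : ℕ) :
    (L.quotient I).carrier m →+ Module.End (ZMod 2)[X] (AbelMix I hI) :=
  AddMonoidHom.mk' (fun x => LinearMap.ofAEval (piEnd I)
      ((Module.AEval'.of (piEnd I)).toLinearMap ∘ₗ adQuot I m x) (fun y =>
        (congrArg (Module.AEval'.of (piEnd I)) (adQuot_comm_piEnd I hI x y)).trans
          (Module.AEval'.X_smul_of (piEnd I) _).symm))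
    (fun x y => LinearMap.ext fun z => by
      obtain ⟨z, rfl⟩ := (Module.AEval'.of (piEnd I)).surjective z
      change Module.AEval'.of (piEnd I) (adQuot I m (x + y) z) =
        Module.AEval'.of (piEnd I) (adQuot I m x z) + Module.AEval'.of (piEnd I) (adQuot I m y z)
      rw [map_add, LinearMap.add_apply, map_add])

theorem adMix_apply {m : ℕ} (x : (L.quotient I).carrier m) (z : Abel I) :
    adMix I hI m x (Module.AEval'.of (piEnd I) z) =
      Module.AEval'.of (piEnd I) (adQuot I m x z) := rfl

theorem adMix_br {m n k : ℕ} (h : m + n = k) (x : (L.quotient I).carrier m)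
    (y : (L.quotient I).carrier n) :
    adMix I hI k ((L.quotient I).br h x y) =
      adMix I hI m x * adMix I hI n y - adMix I hI n y * adMix I hI m x := by
  obtain ⟨x, rfl⟩ := quotientMk_surjective I m x
  obtain ⟨y, rfl⟩ := quotientMk_surjective I n y
  refine LinearMap.ext fun z => ?_
  obtain ⟨z, rfl⟩ := (Module.AEval'.of (piEnd I)).surjective z
  rw [LinearMap.sub_apply, Module.End.mul_apply, Module.End.mul_apply]
  simp only [adMix_apply]
  rw [quotientMk_br, adQuot_mk, adQuot_mk, adQuot_mk, adEnd_br, ← map_sub]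
  rfl

theorem adMix_P_one {k : ℕ} (h : 1 + 1 = k) (x : (L.quotient I).carrier 1) :
    adMix I hI k ((L.quotient I).P h x) =
      (Polynomial.X : (ZMod 2)[X]) • adMix I hI 1 x + adMix I hI 1 x * adMix I hI 1 x := by
  obtain ⟨x, rfl⟩ := quotientMk_surjective I 1 x
  refine LinearMap.ext fun z => ?_
  obtain ⟨z, rfl⟩ := (Module.AEval'.of (piEnd I)).surjective z
  rw [LinearMap.add_apply, LinearMap.smul_apply, Module.End.mul_apply]
  simp only [adMix_apply]
  rw [quotientMk_P, adQuot_mk, adQuot_mk, adEnd_P_one, Module.AEval'.X_smul_of, ← map_add]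
  rfl

theorem adMix_P {n k : ℕ} (h : n + 1 = k) (hn : n ≠ 1) (x : (L.quotient I).carrier n) :
    adMix I hI k ((L.quotient I).P h x) = (Polynomial.X : (ZMod 2)[X]) • adMix I hI n x := by
  obtain ⟨x, rfl⟩ := quotientMk_surjective I n x
  refine LinearMap.ext fun z => ?_
  obtain ⟨z, rfl⟩ := (Module.AEval'.of (piEnd I)).surjective z
  rw [LinearMap.smul_apply]
  simp only [adMix_apply]
  rw [quotientMk_P, adQuot_mk, adQuot_mk, adEnd_P I h hn, Module.AEval'.X_smul_of]
  rfl

/-- The adjoint representation of `U_mix(L / r)` on `r / [r, r]`. -/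
noncomputable def adRepMix :
    (L.quotient I).UMix →ₐ[(ZMod 2)[X]] Module.End (ZMod 2)[X] (AbelMix I hI) :=
  uMixLift (L := L.quotient I) (B := Module.End (ZMod 2)[X] (AbelMix I hI))
    (adMix I hI) (adMix_br I hI) (adMix_P_one I hI) (adMix_P I hI)

/-- `r / [r, r]` as a module over `U_mix(L / r)` via the adjoint representation. -/
noncomputable instance instModuleUMix : Module (L.quotient I).UMix (AbelMix I hI) :=
  Module.compHom _ (adRepMix I hI).toRingHom

/-- Elements of `L` act on `r / [r, r]` through the bracket. -/
theorem uMixOf_smul {m n k : ℕ} (h : m + n = k) (x : L.carrier m) (y : L.carrier n)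
    (hy : y ∈ I.part n) :
    (L.quotient I).uMixOf (quotientMk I m x) • abelMixMk I hI ⟨y, hy⟩ =
      abelMixMk I hI ⟨L.br h x y, I.br_mem h x hy⟩ := by
  change adRepMix I hI ((L.quotient I).uMixOf (quotientMk I m x)) (abelMixMk I hI ⟨y, hy⟩) = _
  rw [adRepMix, uMixLift_of, abelMixMk, adMix_apply, adQuot_mk, adEnd_mk I h]
  rfl

theorem adQuot_br {m n k : ℕ} (h : m + n = k) (x : (L.quotient I).carrier m)
    (y : (L.quotient I).carrier n) :
    adQuot I k ((L.quotient I).br h x y) =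
      adQuot I m x * adQuot I n y - adQuot I n y * adQuot I m x := by
  obtain ⟨x, rfl⟩ := quotientMk_surjective I m x
  obtain ⟨y, rfl⟩ := quotientMk_surjective I n y
  exact adEnd_br I h x y

theorem adQuot_P_one (hq : L.IsQuadratic) {k : ℕ} (h : 1 + 1 = k)
    (x : (L.quotient I).carrier 1) :
    adQuot I k ((L.quotient I).P h x) = adQuot I 1 x * adQuot I 1 x := by
  obtain ⟨x, rfl⟩ := quotientMk_surjective I 1 x
  change adEnd I (L.P h x) = adEnd I x ∘ₗ adEnd I x
  refine abel_ext I fun c z hz => ?_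
  rw [LinearMap.comp_apply, adEnd_mk I (k := k + c) rfl, adEnd_mk I (k := 1 + c) rfl,
    adEnd_mk I (k := k + c) (by omega)]
  refine abelMk_congr I ?_ _
  rw [L.br_P_one (b := 1 + c) h rfl rfl (by omega) (by omega) x z]
  by_cases hc : c = 0
  · subst hc
    have := L.subsingleton_zero
    obtain rfl : z = 0 := Subsingleton.elim _ _
    simp [P_zero]
  · rw [hq _ (by omega), zero_add]

/-- The adjoint representation of `U_quad(L / r)` on `r / [r, r]`, for a quadratic Lie
algebra `L`. -/
noncomputable def adRepQuad (hq : L.IsQuadratic) :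
    (L.quotient I).UQuad →ₐ[ZMod 2] Module.End (ZMod 2) (Abel I) :=
  uQuadLift (L := L.quotient I) (B := Module.End (ZMod 2) (Abel I))
    (adQuot I) (adQuot_br I) (adQuot_P_one I hq)

/-- A type synonym for `r / [r, r]`, for a quadratic Lie algebra. -/
def AbelQuad (_hq : L.IsQuadratic) : Type u := Abel I

noncomputable instance (hq : L.IsQuadratic) : AddCommGroup (AbelQuad I hq) :=
  inferInstanceAs (AddCommGroup (Abel I))

/-- The class in `r / [r, r]` of a homogeneous element of `r`. -/
def abelQuadMk (hq : L.IsQuadratic) {n : ℕ} (y : I.part n) : AbelQuad I hq := abelMk I y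

/-- `r / [r, r]` as a module over `U_quad(L / r)` via the adjoint representation. -/
noncomputable instance instModuleUQuad (hq : L.IsQuadratic) :
    Module (L.quotient I).UQuad (AbelQuad I hq) :=
  letI : Module (Module.End (ZMod 2) (Abel I)) (AbelQuad I hq) :=
    inferInstanceAs (Module (Module.End (ZMod 2) (Abel I)) (Abel I))
  Module.compHom _ (adRepQuad I hq).toRingHom

/-- Elements of `L` act on `r / [r, r]` through the bracket. -/
theorem uQuadOf_smul (hq : L.IsQuadratic) {m n k : ℕ} (h : m + n = k) (x : L.carrier m)
    (y : L.carrier n) (hy : y ∈ I.part n) :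
    (L.quotient I).uQuadOf (quotientMk I m x) • abelQuadMk I hq ⟨y, hy⟩ =
      abelQuadMk I hq ⟨L.br h x y, I.br_mem h x hy⟩ := by
  exact (LinearMap.congr_fun (uQuadLift_of (L := L.quotient I)
    (B := Module.End (ZMod 2) (Abel I)) (adQuot I) (adQuot_br I) (adQuot_P_one I hq)
    (quotientMk I m x)) (abelMk I ⟨y, hy⟩)).trans (adEnd_mk I h x y hy)

end Adjoint

/-! ### Strongly free sequences -/

/-- A sequence of homogeneous elements `ρ_i` of degrees `> 1` of a mixed Lie algebra `L` is strongly
free if, with `r` the ideal it generates and `U = U_mix(L / r)`, the `𝔽₂[π]`-module `U` is torsion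
free and the `U`-module `r / [r, r]` is free on the images of the `ρ_i`. -/
def StronglyFree {ι : Type v} {deg : ι → ℕ} (hdeg : ∀ i, 1 < deg i)
    (ρ : ∀ i, L.carrier (deg i)) : Prop :=
  Module.IsTorsionFree (ZMod 2)[X] (L.quotient (idealSpan ρ)).UMix ∧
    ∃ b : Module.Basis ι (L.quotient (idealSpan ρ)).UMix
        (AbelMix (idealSpan ρ) (idealSpan_part_one ρ hdeg)),
      ∀ i, b i = abelMixMk (idealSpan ρ) (idealSpan_part_one ρ hdeg) ⟨ρ i, mem_idealSpan ρ i⟩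

/-- A sequence of homogeneous elements `ρ_i` of a quadratic Lie algebra `L` is strongly
free if, with `r` the ideal it generates and `U = U_quad(L / r)`, the `U`-module `r / [r, r]` is
free on the images of the `ρ_i`. -/
def QuadStronglyFree (hq : L.IsQuadratic) {ι : Type v} {deg : ι → ℕ}
    (ρ : ∀ i, L.carrier (deg i)) : Prop :=
  ∃ b : Module.Basis ι (L.quotient (idealSpan ρ)).UQuad (AbelQuad (idealSpan ρ) hq),
    ∀ i, b i = abelQuadMk (idealSpan ρ) hq ⟨ρ i, mem_idealSpan ρ i⟩

end MixedLieAlgebra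

/-! Write M for 𝔯/[𝔯,𝔯] and M̃ for 𝔯̃/[𝔯̃,𝔯̃]. Killing π turns the relations of `UMix` into those of
`UQuad`, so U/πU = Ũ (`exists_uMix_reduction`), and the theorem becomes a Nakayama argument along π.
Such an argument needs two facts: U has no π-torsion, and the powers of π have zero intersection.
The second always holds, because U is graded with π in degree 1 (`eq_zero_of_forall_eq_pow_mul`).

The tool is a functional on the enveloping algebra of a quadratic Lie algebra (`exists_functional`),
used in place of a Poincaré–Birkhoff–Witt basis. If I is an ideal in degrees > 1 and φ is linear,
vanishes on [I,I] and is zero in large degrees, then some additive g satisfies g(xu) = ε(u)φ(x) for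
x in I, with ε the augmentation. It is obtained by enlarging I to L one hyperplane at a time. Two
consequences are used: a quadratic Lie algebra embeds in its enveloping algebra in degrees > 1
(`uQuadOf_injective`), and a relation in the enveloping algebra modulo (two-sided ideal of
I)·(augmentation ideal) gives a relation in I/[I,I] (`sum_smul_abelQuadMk_eq_zero`).

Direct implication (`quadStronglyFree_of_stronglyFree`). If U has no π-torsion, an induction on
degree using `uQuadOf_injective` shows that 𝔯 is saturated: Px in 𝔯 forces x in 𝔯 (`mem_of_P_mem`).
Hence the kernel of M → M̃ is exactly πM (`exists_piEnd_eq`), and a basis of M over U reduces to a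
basis of M̃ over Ũ = U/πU.

Converse (`stronglyFree_of_quadStronglyFree`). Fox derivatives over the free algebra give a matrix a
with a_ji = ∂ρ_j/∂ξ_i in U, whose rows generate all relations Σ c_i ξ_i = 0 in U
(`exists_relationMatrix`). Freeness of M̃ says that va in πU^d forces v in πU^m
(`exists_eq_pi_mul`). If πu = 0, write u = Σ c_i ξ_i; then πc is a relation, so πc = va with v =
πv', and replacing c by c − v'a keeps u and makes πc = 0. Thus the annihilator of π lies in Σ
(annihilator)·ξ_i, and it vanishes by degree. Now va = 0 forces v into πU, then into π²U, and so on,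
so v = 0; since a relation Σ v_j ρ_j = 0 in M gives va = 0, the classes of the ρ_j are independent.
-/

namespace MixedLieAlgebra

/-! ### Representations in rings -/

/-- A representation of a mixed Lie algebra in a ring `B` in which `π` acts through `z`. -/
structure Rep (L : MixedLieAlgebra.{u}) (B : Type v) [Ring B] (z : B) where
  toFun : ∀ n, L.carrier n →+ B
  map_br : ∀ {m n k : ℕ} (h : m + n = k) (x : L.carrier m) (y : L.carrier n),
    toFun k (L.br h x y) = toFun m x * toFun n y - toFun n y * toFun m x
  map_P_one : ∀ {k : ℕ} (h : 1 + 1 = k) (x : L.carrier 1),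
    toFun k (L.P h x) = z * toFun 1 x + toFun 1 x * toFun 1 x
  map_P : ∀ {n k : ℕ} (h : n + 1 = k), n ≠ 1 → ∀ x : L.carrier n,
    toFun k (L.P h x) = z * toFun n x

/-- The element `π` of the enveloping algebra. -/
noncomputable def uMixPi (L : MixedLieAlgebra.{u}) : L.UMix :=
  algebraMap (ZMod 2)[X] L.UMix Polynomial.X

theorem uMixPi_commute {L : MixedLieAlgebra.{u}} (b : L.UMix) : Commute L.uMixPi b :=
  Algebra.commutes _ _

theorem X_smul_eq {L : MixedLieAlgebra.{u}} (b : L.UMix) :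
    (Polynomial.X : (ZMod 2)[X]) • b = L.uMixPi * b := Algebra.smul_def _ _

/-- Constants from 𝔽₂ are natural numbers, hence lie in every subsemiring. Ring homomorphisms out of
`UMix` are therefore determined without any linearity assumption. -/
theorem subsemiring_polynomial_eq_top (S : Subsemiring (ZMod 2)[X]) (h : Polynomial.X ∈ S)
    (p : (ZMod 2)[X]) : p ∈ S := by
  have hC : ∀ a : ZMod 2, Polynomial.C a ∈ S := fun a => by
    rw [← ZMod.natCast_zmod_val a, map_natCast]
    exact natCast_mem S _
  induction p using Polynomial.induction_on' with
  | add p q hp hq => exact add_mem hp hq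
  | monomial n a =>
    rw [← Polynomial.C_mul_X_pow_eq_monomial]
    exact mul_mem (hC a) (pow_mem h n)

/-- The induction principle for U: a property stable under sums and products need only be checked on
homogeneous elements and on π. -/
theorem uMix_mem {L : MixedLieAlgebra.{u}} (S : Subsemiring L.UMix)
    (hof : ∀ n (x : L.carrier n), L.uMixOf x ∈ S) (hpi : L.uMixPi ∈ S) (u : L.UMix) : u ∈ S := by
  obtain ⟨a, rfl⟩ := RingQuot.mkAlgHom_surjective (ZMod 2)[X] (UMixRel L) u
  induction a using FreeAlgebra.induction with
  | grade0 r =>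
    rw [AlgHom.commutes]
    have hX : Polynomial.X ∈ S.comap (algebraMap (ZMod 2)[X] L.UMix) := hpi
    exact subsemiring_polynomial_eq_top _ hX r
  | grade1 x => exact hof x.1 x.2
  | mul a b ha hb => rw [map_mul]; exact mul_mem ha hb
  | add a b ha hb => rw [map_add]; exact add_mem ha hb

theorem uQuad_mem {L : MixedLieAlgebra.{u}} (S : Subsemiring L.UQuad)
    (hof : ∀ n (x : L.carrier n), L.uQuadOf x ∈ S) (u : L.UQuad) : u ∈ S := by
  obtain ⟨a, rfl⟩ := RingQuot.mkAlgHom_surjective (ZMod 2) (UQuadRel L) u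
  induction a using FreeAlgebra.induction with
  | grade0 r =>
    rw [AlgHom.commutes, ← ZMod.natCast_zmod_val r, map_natCast]
    exact natCast_mem S _
  | grade1 x => exact hof x.1 x.2
  | mul a b ha hb => rw [map_mul]; exact mul_mem ha hb
  | add a b ha hb => rw [map_add]; exact add_mem ha hb

theorem uMix_hom_ext {L : MixedLieAlgebra.{u}} {B : Type v} [Ring B] {f g : L.UMix →+* B}
    (h : ∀ n (x : L.carrier n), f (L.uMixOf x) = g (L.uMixOf x)) (hpi : f L.uMixPi = g L.uMixPi)
    (a : L.UMix) : f a = g a :=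
  uMix_mem (RingHom.eqLocusS f g) h hpi a

theorem uQuad_hom_ext {L : MixedLieAlgebra.{u}} {B : Type v} [Ring B] {f g : L.UQuad →+* B}
    (h : ∀ n (x : L.carrier n), f (L.uQuadOf x) = g (L.uQuadOf x)) (a : L.UQuad) : f a = g a :=
  uQuad_mem (RingHom.eqLocusS f g) h a

theorem Rep.exists_uMix {L : MixedLieAlgebra.{u}} {B : Type v} [Ring B] [Algebra (ZMod 2) B] {z : B}
    (R : Rep L B z) (hz : ∀ b, Commute z b) :
    ∃ f : L.UMix →+* B, (∀ n (x : L.carrier n), f (L.uMixOf x) = R.toFun n x) ∧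
      f L.uMixPi = z := by
  -- The central element z makes B an 𝔽₂[π]-algebra. This structure stays local, so the result is
  -- stated as a ring homomorphism together with its value at π.
  let _ : Algebra (ZMod 2)[X] B := (Polynomial.aeval z).toRingHom.toAlgebra' fun p b => by
    change Commute (Polynomial.aeval z p) b
    induction p using Polynomial.induction_on' with
    | add p q hp hq => rw [map_add]; exact hp.add_left hq
    | monomial n a =>
      rw [Polynomial.aeval_monomial]
      exact Commute.mul_left (Algebra.commutes a b) ((hz b).pow_left n)
  have hX : algebraMap (ZMod 2)[X] B Polynomial.X = z := Polynomial.aeval_X z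
  have hs : ∀ b : B, (Polynomial.X : (ZMod 2)[X]) • b = z * b := fun b => by
    rw [Algebra.smul_def, hX]
  refine ⟨(uMixLift R.toFun R.map_br (fun h x => ?_) (fun h hn x => ?_)).toRingHom,
    fun n x => uMixLift_of _ _ _ _ x, ?_⟩
  · rw [hs]; exact R.map_P_one h x
  · rw [hs]; exact R.map_P h hn x
  · exact (AlgHom.commutes _ _).trans hX

theorem Rep.exists_uQuad {L : MixedLieAlgebra.{u}} {B : Type v} [Ring B] [Algebra (ZMod 2) B]
    (R : Rep L B 0) :
    ∃ f : L.UQuad →+* B, ∀ n (x : L.carrier n), f (L.uQuadOf x) = R.toFun n x :=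
  ⟨(uQuadLift R.toFun R.map_br (fun h x => by
    rw [R.map_P_one, zero_mul, zero_add])).toRingHom, fun n x => uQuadLift_of _ _ _ x⟩

theorem uMix_rel {L : MixedLieAlgebra.{u}} {a b} (h : UMixRel L a b) :
    RingQuot.mkAlgHom (ZMod 2)[X] (UMixRel L) a = RingQuot.mkAlgHom (ZMod 2)[X] (UMixRel L) b :=
  RingQuot.mkAlgHom_rel _ h

theorem uQuad_rel {L : MixedLieAlgebra.{u}} {a b} (h : UQuadRel L a b) :
    RingQuot.mkAlgHom (ZMod 2) (UQuadRel L) a = RingQuot.mkAlgHom (ZMod 2) (UQuadRel L) b :=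
  RingQuot.mkAlgHom_rel _ h

/-- The tautological representation in `U_mix(L)`. -/
noncomputable def uMixRep (L : MixedLieAlgebra.{u}) : Rep L L.UMix L.uMixPi where
  toFun n := AddMonoidHom.mk' (fun x => L.uMixOf x) fun x y => by
    simpa only [uMixOf, map_add] using uMix_rel (UMixRel.add x y)
  map_br h x y := by
    simpa only [AddMonoidHom.mk'_apply, uMixOf, map_sub, map_mul] using uMix_rel (UMixRel.br h x y)
  map_P_one h x := by
    simpa only [AddMonoidHom.mk'_apply, uMixOf, map_add, map_mul, map_smul, X_smul_eq] using
      uMix_rel (UMixRel.P_one h x)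
  map_P h hn x := by
    simpa only [AddMonoidHom.mk'_apply, uMixOf, map_smul, X_smul_eq] using
      uMix_rel (UMixRel.P h hn x)

theorem uMixRep_apply {L : MixedLieAlgebra.{u}} {n : ℕ} (x : L.carrier n) :
    (uMixRep L).toFun n x = L.uMixOf x := rfl

/-- The tautological representation in `U_quad(L)`. -/
noncomputable def uQuadRep {L : MixedLieAlgebra.{u}} (hq : L.IsQuadratic) : Rep L L.UQuad 0 where
  toFun n := AddMonoidHom.mk' (fun x => L.uQuadOf x) fun x y => by
    simpa only [uQuadOf, map_add] using uQuad_rel (UQuadRel.add x y)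
  map_br h x y := by
    simpa only [AddMonoidHom.mk'_apply, uQuadOf, map_sub, map_mul] using
      uQuad_rel (UQuadRel.br h x y)
  map_P_one h x := by
    rw [zero_mul, zero_add]
    simpa only [AddMonoidHom.mk'_apply, uQuadOf, map_mul] using uQuad_rel (UQuadRel.P_one h x)
  map_P h hn x := by rw [hq h hn, map_zero, zero_mul]

/-- Restriction of a representation along a homomorphism. -/
def Rep.comp {L L' : MixedLieAlgebra.{u}} {B : Type v} [Ring B] {z : B} (R : Rep L' B z)
    (F : Hom L L') : Rep L B z where
  toFun n := (R.toFun n).comp (F.toFun n).toAddMonoidHom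
  map_br h x y := by simp [F.map_br, R.map_br]
  map_P_one h x := by simp [F.map_P, R.map_P_one]
  map_P h hn x := by simp [F.map_P, R.map_P h hn]

/-- Extension of a representation along a ring homomorphism. -/
def Rep.map {L : MixedLieAlgebra.{u}} {B : Type v} {B' : Type*} [Ring B] [Ring B'] {z : B}
    (R : Rep L B z) (f : B →+* B') {z' : B'} (hz : f z = z') : Rep L B' z' where
  toFun n := f.toAddMonoidHom.comp (R.toFun n)
  map_br h x y := by simp [R.map_br]
  map_P_one h x := by simp [R.map_P_one, hz]
  map_P h hn x := by simp [R.map_P h hn, hz]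

/-- A representation that kills an ideal factors through the quotient. -/
def Rep.descend {L : MixedLieAlgebra.{u}} {B : Type v} [Ring B] {z : B} (R : Rep L B z)
    (I : L.MIdeal) (hI : ∀ n, ∀ x ∈ I.part n, R.toFun n x = 0) : Rep (L.quotient I) B z where
  toFun n := QuotientAddGroup.lift (I.part n).toAddSubgroup (R.toFun n) (hI n)
  map_br {m n k} h x y := by
    obtain ⟨x, rfl⟩ := quotientMk_surjective I m x
    obtain ⟨y, rfl⟩ := quotientMk_surjective I n y
    exact R.map_br h x y
  map_P_one h x := by
    obtain ⟨x, rfl⟩ := quotientMk_surjective I _ x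
    exact R.map_P_one h x
  map_P h hn x := by
    obtain ⟨x, rfl⟩ := quotientMk_surjective I _ x
    exact R.map_P h hn x

theorem idealSpan_le {L : MixedLieAlgebra.{u}} {ι : Type v} {deg : ι → ℕ}
    (ρ : ∀ i, L.carrier (deg i)) (J : L.MIdeal) (hJ : ∀ i, ρ i ∈ J.part (deg i)) (n : ℕ) :
    (idealSpan ρ).part n ≤ J.part n :=
  iInf_le (fun I : {I : L.MIdeal // ∀ i, ρ i ∈ I.part (deg i)} => I.1.part n) ⟨J, hJ⟩

/-- The quotient homomorphism. -/
def quotientHom {L : MixedLieAlgebra.{u}} (I : L.MIdeal) : Hom L (L.quotient I) where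
  toFun := quotientMk I
  map_br _ _ _ := rfl
  map_P _ _ := rfl

theorem Hom.exists_uMix {L L' : MixedLieAlgebra.{u}} (F : Hom L L') :
    ∃ f : L.UMix →+* L'.UMix, (∀ n (x : L.carrier n), f (L.uMixOf x) = L'.uMixOf (F.toFun n x)) ∧
      f L.uMixPi = L'.uMixPi :=
  ((uMixRep L').comp F).exists_uMix uMixPi_commute

theorem Hom.exists_uQuad {L L' : MixedLieAlgebra.{u}} (F : Hom L L') (hq : L'.IsQuadratic) :
    ∃ f : L.UQuad →+* L'.UQuad,
      ∀ n (x : L.carrier n), f (L.uQuadOf x) = L'.uQuadOf (F.toFun n x) :=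
  ((uQuadRep hq).comp F).exists_uQuad

theorem Hom.exists_uMix_uQuad {L L' : MixedLieAlgebra.{u}} (F : Hom L L') (hq : L'.IsQuadratic) :
    ∃ f : L.UMix →+* L'.UQuad,
      (∀ n (x : L.carrier n), f (L.uMixOf x) = L'.uQuadOf (F.toFun n x)) ∧ f L.uMixPi = 0 :=
  ((uQuadRep hq).comp F).exists_uMix Commute.zero_left

/-! ### Representations of the free mixed Lie algebra -/

theorem free_induction {X : Type u} (w : X → ℕ+) {C : ∀ n, (free w).carrier n → Prop}
    (of : ∀ x, C _ (freeOf w x)) (zero : ∀ n, C n 0)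
    (add : ∀ {n} (a b : (free w).carrier n), C n a → C n b → C n (a + b))
    (br : ∀ {m n k} (h : m + n = k) (a : (free w).carrier m) (b : (free w).carrier n),
      C m a → C n b → C k ((free w).br h a b))
    (P : ∀ {n k} (h : n + 1 = k) (a : (free w).carrier n), C n a → C k ((free w).P h a))
    {n : ℕ} (a : (free w).carrier n) : C n a := by
  obtain ⟨a, rfl⟩ : ∃ b, freeMk w b = a := Quotient.exists_rep a
  induction a with
  | of x => exact of x
  | zero n => exact zero n
  | add a b iha ihb => exact add _ _ iha ihb
  | br h a b iha ihb => exact br h _ _ iha ihb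
  | P h a iha => exact P h _ iha

theorem coe_eq_zero_of_ite {B : Type v} [AddCommGroup B] [Module (ZMod 2) B] {n : ℕ} (hn : n = 0)
    (x : ↥(if n = 0 then ⊥ else ⊤ : Submodule (ZMod 2) B)) : (x : B) = 0 := by
  have hx := x.2
  simp only [hn, if_true] at hx
  exact (Submodule.mem_bot _).mp hx

/-- A ring with a central element, considered as a mixed Lie algebra with the same component in all
positive degrees. -/
def ofRing (B : Type v) [Ring B] [Algebra (ZMod 2) B] (z : B) (hz : ∀ b, Commute z b) :
    MixedLieAlgebra.{v} where
  carrier n := ↥(if n = 0 then ⊥ else ⊤ : Submodule (ZMod 2) B)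
  subsingleton_zero := by
    rw [if_pos rfl]
    infer_instance
  br {m n k} h := LinearMap.mk₂ (ZMod 2)
    (fun x y => ⟨(x : B) * y - y * x, by
      by_cases hk : k = 0
      · simp [coe_eq_zero_of_ite (by omega : m = 0) x]
      · simp [hk]⟩)
    (fun x x' y => Subtype.ext (by simp [add_mul, mul_add]; abel))
    (fun c x y => Subtype.ext (by simp [smul_sub]))
    (fun x y y' => Subtype.ext (by simp [add_mul, mul_add]; abel))
    (fun c x y => Subtype.ext (by simp [smul_sub]))
  P {n k} h x := ⟨if n = 1 then z * x + x * x else z * x, by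
    have : k ≠ 0 := by omega
    simp [this]⟩
  br_self h x := Subtype.ext (by simp)
  br_comm h h' x y := Subtype.ext (by simp)
  jacobi hab h₁ hbc h₂ hca h₃ x y z := Subtype.ext (by
    simp only [LinearMap.mk₂_apply, Submodule.coe_add, Submodule.coe_zero]
    noncomm_ring)
  P_add_one h x y := Subtype.ext (by
    have := ZModModule.add_self ((y : B) * x)
    simp only [LinearMap.mk₂_apply, Submodule.coe_add, if_true]
    rw [sub_eq_add_neg, ZModModule.neg_eq_self]
    noncomm_ring)
  P_add h hn x y := Subtype.ext (by simp [hn, mul_add])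
  br_P_one {n a b c} ha h hb h₁ h₂ x y := Subtype.ext (by
    simp only [LinearMap.mk₂_apply, Submodule.coe_add, if_true]
    have hzy : (y : B) * (z * x) = z * (y * x) := by rw [← mul_assoc, ← (hz y).eq, mul_assoc]
    by_cases hb1 : b = 1
    · simp [coe_eq_zero_of_ite (by omega : n = 0) y]
    -- In characteristic 2 one has [x², y] = [x, [x, y]]: the two sides differ by 2xyx − 2yx².
    · have e : ((x : B) * y * x + x * y * x) - (y * x * x + y * x * x) = 0 := by
        rw [ZModModule.add_self, ZModModule.add_self, sub_zero]
      rw [if_neg hb1, mul_add, hzy, ← sub_eq_zero]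
      have : ∀ s : B, s = ((x : B) * y * x + x * y * x) - (y * x * x + y * x * x) → s = 0 :=
        fun s hs => hs.trans e
      apply this
      noncomm_ring)
  br_P {m n a b c} ha h hb h₁ hm x y := Subtype.ext (by
    simp only [LinearMap.mk₂_apply, if_neg hm]
    have hzy : (y : B) * (z * x) = z * (y * x) := by rw [← mul_assoc, ← (hz y).eq, mul_assoc]
    by_cases hb1 : b = 1
    · simp [coe_eq_zero_of_ite (by omega : m = 0) x]
    · rw [if_neg hb1, hzy, mul_assoc, mul_sub])

/-- The universal property of the free mixed Lie algebra, applied to `ofRing`: generators have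
positive degree, so their images in B may be arbitrary. This is the source of the Fox derivatives.
-/
theorem exists_freeRep {X : Type u} (w : X → ℕ+) {B : Type v} [Ring B] [Algebra (ZMod 2) B] (z : B)
    (hz : ∀ b, Commute z b) (b : X → B) :
    ∃ R : Rep (free w) B z, ∀ x, R.toFun (w x) (freeOf w x) = b x := by
  obtain ⟨F, hF, -⟩ := free_universal w (L' := ofRing B z hz) (fun x => ⟨b x, by simp⟩)
  refine ⟨⟨fun n => ((if n = 0 then ⊥ else ⊤ : Submodule (ZMod 2) B).subtype ∘ₗ
    F.toFun n).toAddMonoidHom, fun h x y => ?_, fun h x => ?_, fun h hn x => ?_⟩, fun x => ?_⟩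
  · exact congrArg Subtype.val (F.map_br h x y)
  · exact congrArg Subtype.val (F.map_P h x)
  · exact (congrArg Subtype.val (F.map_P h x)).trans (if_neg hn)
  · exact congrArg Subtype.val (hF x)

theorem Rep.free_mem {X : Type u} {w : X → ℕ+} {B : Type v} [Ring B] [Algebra (ZMod 2) B] {z : B}
    (R : Rep (free w) B z) (S : Subsemiring B) (hz : z ∈ S)
    (hof : ∀ x, R.toFun (w x) (freeOf w x) ∈ S) {n : ℕ} (a : (free w).carrier n) :
    R.toFun n a ∈ S := by
  refine free_induction w (C := fun n a => R.toFun n a ∈ S) hof (fun n => ?_)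
    (fun a b ha hb => ?_) (fun h a b ha hb => ?_) (fun {n k} h a ha => ?_) a
  · rw [map_zero]; exact zero_mem S
  · rw [map_add]; exact add_mem ha hb
  · rw [R.map_br, sub_eq_add_neg, ZModModule.neg_eq_self]
    exact add_mem (mul_mem ha hb) (mul_mem hb ha)
  · by_cases hn : n = 1
    · subst hn
      rw [R.map_P_one]; exact add_mem (mul_mem hz ha) (mul_mem ha ha)
    · rw [R.map_P h hn]; exact mul_mem hz ha

/-- A component is spanned by generators and by brackets and P-values of elements of smaller degree,
of which there are finitely many by induction. The finiteness supports the counting induction in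
`exists_functional_of_eq_top`. -/
theorem free_finite {X : Type u} [Finite X] (w : X → ℕ+) (n : ℕ) : Finite ((free w).carrier n) := by
  induction n using Nat.strong_induction_on with
  | _ n ih =>
  let L := free w
  have := fun m : Fin n => ih m m.2
  let T : Set (L.carrier n) :=
    (⋃ x : X, {y | ∃ h : (w x : ℕ) = n, y = h ▸ freeOf w x}) ∪
    (⋃ a : Fin n, ⋃ b : Fin n, ⋃ x : L.carrier a, ⋃ y : L.carrier b,
      {z | ∃ h : (a : ℕ) + b = n, z = L.br h x y}) ∪
    (⋃ a : Fin n, ⋃ x : L.carrier a, {z | ∃ h : (a : ℕ) + 1 = n, z = L.P h x})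
  have hT : T.Finite := by
    refine ((Set.finite_iUnion fun x => ?_).union (Set.finite_iUnion fun a =>
      Set.finite_iUnion fun b => Set.finite_iUnion fun x => Set.finite_iUnion fun y => ?_)).union
      (Set.finite_iUnion fun a => Set.finite_iUnion fun x => ?_)
    all_goals
      refine Set.Subsingleton.finite ?_
      rintro _ ⟨h, rfl⟩ _ ⟨h', rfl⟩
      rfl
  have hspan : Submodule.span (ZMod 2) T = ⊤ := by
    refine eq_top_iff.mpr fun a₁ _ => ?_
    suffices H : ∀ m (a : L.carrier m) (h : m = n), h ▸ a ∈ Submodule.span (ZMod 2) T from H n a₁ rfl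
    intro m a₀
    refine free_induction w
      (C := fun m a => ∀ h : m = n, (h ▸ a : L.carrier n) ∈ Submodule.span (ZMod 2) T)
      (fun x h => ?_) (fun m h => ?_) (fun {m} a b ha hb h => ?_)
      (fun {a b k} hab x y _ _ h => ?_) (fun {a k} hak x _ h => ?_) a₀
    · exact Submodule.subset_span (Or.inl (Or.inl (Set.mem_iUnion.mpr ⟨x, h, rfl⟩)))
    · subst h
      exact zero_mem _
    · subst h
      exact add_mem (ha rfl) (hb rfl)
    · subst h
      by_cases ha : a = 0
      · subst ha
        have : Subsingleton ((free w).carrier 0) := L.subsingleton_zero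
        rw [Subsingleton.elim x 0]
        simp
      by_cases hb : b = 0
      · subst hb
        have : Subsingleton ((free w).carrier 0) := L.subsingleton_zero
        rw [Subsingleton.elim y 0]
        simp
      refine Submodule.subset_span (Or.inl (Or.inr ?_))
      simp only [Set.mem_iUnion]
      exact ⟨⟨a, by omega⟩, ⟨b, by omega⟩, x, y, hab, rfl⟩
    · subst h
      refine Submodule.subset_span (Or.inr ?_)
      simp only [Set.mem_iUnion]
      exact ⟨⟨a, by omega⟩, x, hak, rfl⟩
  have : Module.Finite (ZMod 2) (L.carrier n) := ⟨⟨hT.toFinset, by simpa using hspan⟩⟩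
  exact Module.finite_of_finite (ZMod 2)

theorem quotient_finite {L : MixedLieAlgebra.{u}} (I : L.MIdeal) {n : ℕ} [Finite (L.carrier n)] :
    Finite ((L.quotient I).carrier n) :=
  Finite.of_surjective _ (quotientMk_surjective I n)

/-! ### Linear functionals on the enveloping algebra of a quadratic Lie algebra

The results of this section replace the Poincaré–Birkhoff–Witt theorem. -/

/-- The mixed Lie algebra on a family of subspaces closed under the operations. -/
def sub (L : MixedLieAlgebra.{u}) (S : ∀ n, Submodule (ZMod 2) (L.carrier n))
    (hbr : ∀ {m n k : ℕ} (h : m + n = k) (x : L.carrier m) (y : L.carrier n), L.br h x y ∈ S k)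
    (hP : ∀ {n k : ℕ} (h : n + 1 = k) (x : L.carrier n), L.P h x ∈ S k) :
    MixedLieAlgebra.{u} where
  carrier n := ↥(S n)
  subsingleton_zero := by
    have := L.subsingleton_zero
    infer_instance
  br h := LinearMap.mk₂ (ZMod 2) (fun x y => ⟨L.br h x y, hbr h x y⟩)
    (fun _ _ _ => Subtype.ext (by simp)) (fun _ _ _ => Subtype.ext (by simp))
    (fun _ _ _ => Subtype.ext (by simp)) (fun _ _ _ => Subtype.ext (by simp))
  P h x := ⟨L.P h x, hP h x⟩
  br_self h x := Subtype.ext (L.br_self h x)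
  br_comm h h' x y := Subtype.ext (L.br_comm h h' x y)
  jacobi hab h₁ hbc h₂ hca h₃ x y z := Subtype.ext (L.jacobi hab h₁ hbc h₂ hca h₃ x y z)
  P_add_one h x y := Subtype.ext (L.P_add_one h x y)
  P_add h hn x y := Subtype.ext (L.P_add h hn x y)
  br_P_one ha h hb h₁ h₂ x y := Subtype.ext (L.br_P_one ha h hb h₁ h₂ x y)
  br_P ha h hb h₁ hm x y := Subtype.ext (L.br_P ha h hb h₁ hm x y)

/-- The augmentation of `U_quad(L)`. -/
noncomputable def uQuadAug (L : MixedLieAlgebra.{u}) : L.UQuad →ₐ[ZMod 2] ZMod 2 :=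
  uQuadLift (fun _ => 0) (by simp) (by simp)

theorem uQuadAug_of {L : MixedLieAlgebra.{u}} {n : ℕ} (x : L.carrier n) :
    L.uQuadAug (L.uQuadOf x) = 0 := uQuadLift_of _ _ _ x

/-- A derivation is the second component of a ring homomorphism a ↦ a + δ(a)τ into the dual numbers
over `UQuad`. The hypotheses on T are the defining relations read in that ring. -/
theorem exists_uQuad_derivation {L : MixedLieAlgebra.{u}} (hq : L.IsQuadratic)
    (T : ∀ n, L.carrier n →+ L.UQuad)
    (hbr : ∀ {m n k : ℕ} (h : m + n = k) (x : L.carrier m) (y : L.carrier n),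
      T k (L.br h x y) = (L.uQuadOf x * T n y + T m x * L.uQuadOf y) -
        (L.uQuadOf y * T m x + T n y * L.uQuadOf x))
    (hP : ∀ {k : ℕ} (h : 1 + 1 = k) (x : L.carrier 1),
      T k (L.P h x) = L.uQuadOf x * T 1 x + T 1 x * L.uQuadOf x) :
    ∃ δ : L.UQuad →+ L.UQuad, (∀ n (x : L.carrier n), δ (L.uQuadOf x) = T n x) ∧
      ∀ a b, δ (a * b) = a * δ b + δ a * b := by
  let R : Rep L (TrivSqZeroExt L.UQuad L.UQuad) 0 :=
    { toFun := fun n => AddMonoidHom.mk' (fun x => (L.uQuadOf x, T n x)) (fun x y => by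
        refine TrivSqZeroExt.ext ?_ ?_
        · exact map_add ((uQuadRep hq).toFun n) x y
        · exact map_add (T n) x y)
      map_br := fun {m n k} h x y => by
        refine TrivSqZeroExt.ext ?_ ?_
        · exact (uQuadRep hq).map_br h x y
        · exact hbr h x y
      map_P_one := fun h x => by
        rw [zero_mul, zero_add]
        refine TrivSqZeroExt.ext ?_ ?_
        · exact ((uQuadRep hq).map_P_one h x).trans (by rw [zero_mul, zero_add]; rfl)
        · exact hP h x
      map_P := fun h hn x => by
        rw [hq h hn, map_zero, zero_mul] }
  obtain ⟨f, hf⟩ := R.exists_uQuad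
  have hfst : ∀ a, (f a).fst = a := fun a =>
    uQuad_hom_ext (f := (TrivSqZeroExt.fstHom (ZMod 2) L.UQuad L.UQuad).toRingHom.comp f)
      (g := RingHom.id _) (fun n x => congrArg TrivSqZeroExt.fst (hf n x)) a
  refine ⟨AddMonoidHom.mk' (fun a => (f a).snd) fun a b => by simp, fun n x =>
    congrArg TrivSqZeroExt.snd (hf n x), fun a b => ?_⟩
  simp [hfst]

theorem sub_isQuadratic {L : MixedLieAlgebra.{u}} (hq : L.IsQuadratic)
    (S : ∀ n, Submodule (ZMod 2) (L.carrier n)) (hbr hP) :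
    (L.sub S hbr hP).IsQuadratic :=
  fun h hn x => Subtype.ext (hq h hn x.1)

/-- The element of the enveloping algebra of a subalgebra given by an element of the subalgebra. -/
noncomputable def subOf {L : MixedLieAlgebra.{u}}
    (S : ∀ n, Submodule (ZMod 2) (L.carrier n)) (hbr hP) {i : ℕ}
    (x : L.carrier i) (hx : x ∈ S i) : (L.sub S hbr hP).UQuad :=
  (L.sub S hbr hP).uQuadOf (n := i) ⟨x, hx⟩

theorem uQuadAug_subOf {L : MixedLieAlgebra.{u}}
    {S : ∀ n, Submodule (ZMod 2) (L.carrier n)} {hbr hP} {i : ℕ}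
    (x : L.carrier i) (hx : x ∈ S i) : uQuadAug _ (subOf S hbr hP x hx) = 0 :=
  uQuadAug_of _

/-- L is spanned by e and the codimension-one subalgebra ker c, which contains all brackets and
P-values. Letting e act by E extends a module over ker c to L once [E, b] = δ(b) and, when e has
degree 1, E² = Pe. Elements of ker c keep their action. -/
theorem exists_rep_of_derivation {L : MixedLieAlgebra.{u}} (hq : L.IsQuadratic) {n : ℕ}
    (e : ∀ i, L.carrier i) (c : ∀ i, L.carrier i →ₗ[ZMod 2] ZMod 2)
    (hcn : ∀ i, i ≠ n → c i = 0) (hce : c n (e n) = 1)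
    (hbr : ∀ {m n k : ℕ} (h : m + n = k) (x : L.carrier m) (y : L.carrier n),
      L.br h x y ∈ LinearMap.ker (c k))
    (hP : ∀ {n k : ℕ} (h : n + 1 = k) (x : L.carrier n), L.P h x ∈ LinearMap.ker (c k))
    {V : Type v} [AddCommGroup V] [Module (ZMod 2) V]
    [Module (L.sub (fun i => LinearMap.ker (c i)) hbr hP).UQuad V]
    [IsScalarTower (ZMod 2) (L.sub (fun i => LinearMap.ker (c i)) hbr hP).UQuad V]
    (δ : (L.sub (fun i => LinearMap.ker (c i)) hbr hP).UQuad →+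
      (L.sub (fun i => LinearMap.ker (c i)) hbr hP).UQuad)
    (hδ : ∀ {i k : ℕ} (h : n + i = k) (x : L.carrier i) (hx : x ∈ LinearMap.ker (c i)),
      δ (subOf _ hbr hP x hx) = subOf _ hbr hP (L.br h (e n) x) (hbr h _ x))
    (E : Module.End (ZMod 2) V)
    (hE : ∀ (b : (L.sub (fun i => LinearMap.ker (c i)) hbr hP).UQuad) (v : V),
      E (b • v) = b • E v + δ b • v)
    (hEE : n = 1 → ∀ v, E (E v) = subOf _ hbr hP (L.P rfl (e n)) (hP rfl (e n)) • v) :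
    ∃ R : Rep L (Module.End (ZMod 2) V) 0,
      ∀ i (x : L.carrier i), ∃ (a : ZMod 2) (x' : L.carrier i) (hx' : x' ∈ LinearMap.ker (c i)),
        (∀ v, R.toFun i x v = a • E v + subOf _ hbr hP x' hx' • v) ∧ (c i x = 0 → a = 0 ∧ x' = x) := by
  set B := (L.sub (fun i => LinearMap.ker (c i)) hbr hP).UQuad with hB
  let ι : ∀ i, LinearMap.ker (c i) →+ B := (uQuadRep (sub_isQuadratic hq _ hbr hP)).toFun
  let l : B →ₐ[ZMod 2] Module.End (ZMod 2) V := Algebra.lsmul (ZMod 2) (ZMod 2) V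
  have hp : ∀ i (x : L.carrier i), x - c i x • e i ∈ LinearMap.ker (c i) := fun i x => by
    by_cases hi : i = n
    · subst hi
      simp [hce]
    · simp [hcn i hi]
  let p : ∀ i, L.carrier i →ₗ[ZMod 2] LinearMap.ker (c i) := fun i =>
    LinearMap.codRestrict _ (LinearMap.id - (c i).smulRight (e i)) (hp i)
  let Φ : ∀ i, L.carrier i →+ Module.End (ZMod 2) V := fun i =>
    ((c i).smulRight E).toAddMonoidHom + l.toRingHom.toAddMonoidHom.comp
      ((ι i).comp (p i).toAddMonoidHom)
  have hΦ : ∀ i x, Φ i x = c i x • E + l (ι i (p i x)) := fun i x => rfl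
  have hpk : ∀ i x (hx : c i x = 0), p i x = ⟨x, hx⟩ := fun i x hx => Subtype.ext (by
    change x - c i x • e i = x
    rw [hx, zero_smul, sub_zero])
  have hΦk : ∀ i x (hx : c i x = 0), Φ i x = l (ι i ⟨x, hx⟩) := fun i x hx => by
    rw [hΦ, hx, zero_smul, zero_add, hpk i x hx]
  have hΦe : Φ n (e n) = E := by
    have : p n (e n) = 0 := Subtype.ext (by
      change e n - c n (e n) • e n = 0
      rw [hce, one_smul, sub_self])
    rw [hΦ, this, map_zero, map_zero, hce, one_smul, add_zero]
  -- Over 𝔽₂ an element outside the hyperplane is e plus an element of the hyperplane; no other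
  -- scalar occurs.
  have hcase : ∀ i (x : L.carrier i), c i x = 0 ∨
      ∃ h : n = i, ∃ x' : L.carrier i, c i x' = 0 ∧ x = h ▸ e n + x' := fun i x => by
    by_cases hx : c i x = 0
    · exact Or.inl hx
    · have hi : n = i := by
        by_contra hi
        exact hx (by rw [hcn i (Ne.symm hi), LinearMap.zero_apply])
      subst hi
      refine Or.inr ⟨rfl, x - c n x • e n, hp n x, ?_⟩
      have : c n x = 1 := (Fin.exists_fin_two.mp ⟨c n x, rfl⟩).elim
        (fun h => absurd h hx) id
      rw [this, one_smul]
      abel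
  have hEl : ∀ b : B, E * l b = l b * E + l (δ b) := fun b => LinearMap.ext fun v => hE b v
  -- the bracket relation in the four cases
  have hkk : ∀ {a b k : ℕ} (h : a + b = k) (x : L.carrier a) (y : L.carrier b), c a x = 0 →
      c b y = 0 → Φ k (L.br h x y) = Φ a x * Φ b y - Φ b y * Φ a x := fun {a b k} h x y hx hy => by
    rw [hΦk a x hx, hΦk b y hy, hΦk k _ (hbr h x y), ← map_mul, ← map_mul, ← map_sub]
    exact congrArg l ((uQuadRep (sub_isQuadratic hq _ hbr hP)).map_br h ⟨x, hx⟩ ⟨y, hy⟩)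
  have hek : ∀ {b k : ℕ} (h : n + b = k) (y : L.carrier b), c b y = 0 →
      Φ k (L.br h (e n) y) = Φ n (e n) * Φ b y - Φ b y * Φ n (e n) := fun {b k} h y hy => by
    rw [hΦe, hΦk b y hy, hEl, add_sub_cancel_left, hΦk k _ (hbr h _ y)]
    exact congrArg l (hδ h y hy).symm
  have hex : ∀ {b k : ℕ} (h : n + b = k) (y : L.carrier b),
      Φ k (L.br h (e n) y) = Φ n (e n) * Φ b y - Φ b y * Φ n (e n) := fun {b k} h y => by
    rcases hcase b y with hy | ⟨rfl, y', hy', rfl⟩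
    · exact hek h y hy
    · have := hek h y' hy'
      rw [map_add, L.br_self, zero_add, this, map_add]
      noncomm_ring
  have hkx : ∀ {a b k : ℕ} (h : a + b = k) (x : L.carrier a) (y : L.carrier b), c a x = 0 →
      Φ k (L.br h x y) = Φ a x * Φ b y - Φ b y * Φ a x := fun {a b k} h x y hx => by
    rcases hcase b y with hy | ⟨rfl, y', hy', rfl⟩
    · exact hkk h x y hx hy
    · rw [map_add, L.br_comm h (by omega) x (e n), map_add, map_neg, hex, hkk h x y' hx hy', map_add]
      noncomm_ring
  have hxx : ∀ {a b k : ℕ} (h : a + b = k) (x : L.carrier a) (y : L.carrier b),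
      Φ k (L.br h x y) = Φ a x * Φ b y - Φ b y * Φ a x := fun {a b k} h x y => by
    rcases hcase a x with hx | ⟨rfl, x', hx', rfl⟩
    · exact hkx h x y hx
    · rw [map_add, LinearMap.add_apply, map_add, hkx h x' y hx', hex, map_add]
      noncomm_ring
  have hPk : ∀ {k : ℕ} (h : 1 + 1 = k) (x : L.carrier 1), c 1 x = 0 →
      Φ k (L.P h x) = Φ 1 x * Φ 1 x := fun {k} h x hx => by
    rw [hΦk k _ (hP h x), hΦk 1 x hx, ← map_mul]
    have := (uQuadRep (sub_isQuadratic hq _ hbr hP)).map_P_one h ⟨x, hx⟩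
    rw [zero_mul, zero_add] at this
    exact congrArg l this
  refine ⟨⟨Φ, hxx, fun {k} h x => ?_, fun h hn x => ?_⟩, fun i x => ?_⟩
  · rw [zero_mul, zero_add]
    rcases hcase 1 x with hx | ⟨hn, x', hx', rfl⟩
    · exact hPk h x hx
    · subst hn
      have hPe : Φ k (L.P h (e 1)) = E * E := by
        subst h
        rw [hΦk _ _ (hP rfl _)]
        exact LinearMap.ext fun v => (hEE rfl v).symm
      -- The cross term [e, x'] of P(e + x') matches EX' − X'E, which is EX' + X'E in characteristic
      -- 2, in the square of E + X', where X' is the action of x'.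
      rw [L.P_add_one, map_add, map_add, hPk h x' hx', hex, hPe, map_add, hΦe, sub_eq_add_neg,
        ZModModule.neg_eq_self]
      noncomm_ring
  · rw [hq h hn, map_zero, zero_mul]
  · exact ⟨c i x, x - c i x • e i, hp i x, fun v => rfl, fun hx => ⟨hx, by
      rw [hx, zero_smul, sub_zero]⟩⟩

/-- Inductive passage from ker c to L. The extended action on V gives g(u) = f(ψ(u·v₀)); elements of
I act as before, so f is applied to a left multiple by x and its defining property carries over. -/
theorem exists_functional_of_derivation {L : MixedLieAlgebra.{u}} (hq : L.IsQuadratic) {n : ℕ}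
    (e : ∀ i, L.carrier i) (c : ∀ i, L.carrier i →ₗ[ZMod 2] ZMod 2)
    (hcn : ∀ i, i ≠ n → c i = 0) (hce : c n (e n) = 1)
    (hbr : ∀ {m n k : ℕ} (h : m + n = k) (x : L.carrier m) (y : L.carrier n),
      L.br h x y ∈ LinearMap.ker (c k))
    (hP : ∀ {n k : ℕ} (h : n + 1 = k) (x : L.carrier n), L.P h x ∈ LinearMap.ker (c k))
    {V : Type v} [AddCommGroup V] [Module (ZMod 2) V]
    [Module (L.sub (fun i => LinearMap.ker (c i)) hbr hP).UQuad V]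
    [IsScalarTower (ZMod 2) (L.sub (fun i => LinearMap.ker (c i)) hbr hP).UQuad V]
    (δ : (L.sub (fun i => LinearMap.ker (c i)) hbr hP).UQuad →+
      (L.sub (fun i => LinearMap.ker (c i)) hbr hP).UQuad)
    (hδ : ∀ {i k : ℕ} (h : n + i = k) (x : L.carrier i) (hx : x ∈ LinearMap.ker (c i)),
      δ (subOf _ hbr hP x hx) = subOf _ hbr hP (L.br h (e n) x) (hbr h _ x))
    (E : Module.End (ZMod 2) V)
    (hE : ∀ (b : (L.sub (fun i => LinearMap.ker (c i)) hbr hP).UQuad) (v : V),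
      E (b • v) = b • E v + δ b • v)
    (hEE : n = 1 → ∀ v, E (E v) = subOf _ hbr hP (L.P rfl (e n)) (hP rfl (e n)) • v)
    (ψ : V →ₗ[(L.sub (fun i => LinearMap.ker (c i)) hbr hP).UQuad]
      (L.sub (fun i => LinearMap.ker (c i)) hbr hP).UQuad)
    (v₀ : V) (hv₀ : ψ v₀ = 1) (hψ : ∀ v, uQuadAug _ (ψ (E v)) = 0)
    {W : Type*} [AddCommGroup W] [Module (ZMod 2) W] (I : L.MIdeal)
    (hI : ∀ i, I.part i ≤ LinearMap.ker (c i)) (φ : ∀ i, L.carrier i →ₗ[ZMod 2] W)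
    (f : (L.sub (fun i => LinearMap.ker (c i)) hbr hP).UQuad →+ W)
    (hf : ∀ (i : ℕ) (x : L.carrier i) (hx : x ∈ I.part i) u,
      f (subOf _ hbr hP x (hI i hx) * u) = uQuadAug _ u • φ i x) :
    ∃ g : L.UQuad →+ W, ∀ (i : ℕ) (x : L.carrier i), x ∈ I.part i → ∀ u,
      g (L.uQuadOf x * u) = L.uQuadAug u • φ i x := by
  obtain ⟨R, hR⟩ := exists_rep_of_derivation hq e c hcn hce hbr hP δ hδ E hE hEE
  obtain ⟨G, hG⟩ := R.exists_uQuad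
  -- The functional ε∘ψ vanishes on E(V), by `hψ`, and on x·V for x in ker c. So L kills it, and u
  -- acts on it through ε(u).
  have haug : ∀ (u : L.UQuad) (v : V), uQuadAug _ (ψ (G u v)) = L.uQuadAug u * uQuadAug _ (ψ v) := by
    let S : Subsemiring L.UQuad :=
      { carrier := {u | ∀ v : V, uQuadAug _ (ψ (G u v)) = L.uQuadAug u * uQuadAug _ (ψ v)}
        mul_mem' := fun {a b} ha hb v => by
          rw [map_mul, Module.End.mul_apply, ha, hb, map_mul, mul_assoc]
        one_mem' := fun v => by simp
        add_mem' := fun {a b} ha hb v => by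
          rw [map_add, LinearMap.add_apply, map_add, map_add, ha, hb, map_add, add_mul]
        zero_mem' := fun v => by simp }
    refine fun u => uQuad_mem S (fun i x v => ?_) u
    obtain ⟨a, x', hx', h1, -⟩ := hR i x
    have : ψ (a • E v) = a • ψ (E v) := by
      rw [← ZMod.natCast_zmod_val a, Nat.cast_smul_eq_nsmul, Nat.cast_smul_eq_nsmul, map_nsmul]
    rw [hG, h1, uQuadAug_of, zero_mul, map_add,
      map_add, this, map_smul ψ, smul_eq_mul, map_mul,
      uQuadAug_subOf, zero_mul, add_zero, map_smul, hψ, smul_zero]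
  refine ⟨f.comp (ψ.toAddMonoidHom.comp (((LinearMap.applyₗ v₀).toAddMonoidHom).comp
    G.toAddMonoidHom)), fun i x hx u => ?_⟩
  obtain ⟨a, x', hx', h1, h2⟩ := hR i x
  obtain ⟨rfl, rfl⟩ := h2 (hI i hx)
  change f (ψ (G (L.uQuadOf x' * u) v₀)) = _
  rw [map_mul, Module.End.mul_apply, hG, h1, zero_smul, zero_add, map_smul, smul_eq_mul, hf i x' hx,
    haug, hv₀, map_one, mul_one]

theorem commutator_mul_aux {R : Type*} [Ring R] (Q a b x : R) :
    a * (Q * b - b * Q) + x + (x + (Q * a - a * Q) * b) =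
      (Q * (a * b) - a * b * Q) + (x + x) := by
  noncomm_ring

theorem derivation_br_aux {R : Type*} [Ring R] (x y a b : R) :
    a * y - y * a + (x * b - b * x) = (x * b + a * y) - (y * a + b * x) := by
  noncomm_ring

section SubOf

variable {L : MixedLieAlgebra.{u}}
  {S : ∀ n, Submodule (ZMod 2) (L.carrier n)}
  {hbr : ∀ {m n k : ℕ} (h : m + n = k) (x : L.carrier m) (y : L.carrier n), L.br h x y ∈ S k}
  {hP : ∀ {n k : ℕ} (h : n + 1 = k) (x : L.carrier n), L.P h x ∈ S k}

theorem subOf_congr {i : ℕ} {x y : L.carrier i} (hxy : x = y) (hx : x ∈ S i) :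
    subOf S hbr hP x hx = subOf S hbr hP y (hxy ▸ hx) := by
  subst hxy
  rfl

theorem subOf_add (hq : L.IsQuadratic) {i : ℕ} (x y : L.carrier i) (hx : x ∈ S i) (hy : y ∈ S i) :
    subOf S hbr hP (x + y) (add_mem hx hy) = subOf S hbr hP x hx + subOf S hbr hP y hy :=
  map_add ((uQuadRep (sub_isQuadratic hq S hbr hP)).toFun i) ⟨x, hx⟩ ⟨y, hy⟩

theorem subOf_zero (hq : L.IsQuadratic) {i : ℕ} :
    subOf S hbr hP (0 : L.carrier i) (zero_mem _) = 0 :=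
  map_zero ((uQuadRep (sub_isQuadratic hq S hbr hP)).toFun i)

theorem subOf_br (hq : L.IsQuadratic) {m n k : ℕ} (h : m + n = k) (x : L.carrier m)
    (y : L.carrier n) (hx : x ∈ S m) (hy : y ∈ S n) :
    subOf S hbr hP (L.br h x y) (hbr h x y) =
      subOf S hbr hP x hx * subOf S hbr hP y hy - subOf S hbr hP y hy * subOf S hbr hP x hx :=
  (uQuadRep (sub_isQuadratic hq S hbr hP)).map_br h ⟨x, hx⟩ ⟨y, hy⟩

/-- The operator ad e preserves S, since S contains all brackets of L, and it extends to a
derivation of the enveloping algebra of S. It sends generators to generators, so its values have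
augmentation zero. -/
theorem exists_ad_derivation (hq : L.IsQuadratic) {n : ℕ} (hn : n ≠ 0) (e : L.carrier n) :
    ∃ δ : (L.sub S hbr hP).UQuad →+ (L.sub S hbr hP).UQuad,
      (∀ {i k : ℕ} (h : n + i = k) (x : L.carrier i) (hx : x ∈ S i),
        δ (subOf _ hbr hP x hx) = subOf _ hbr hP (L.br h e x) (hbr h _ x)) ∧
      (∀ a b, δ (a * b) = a * δ b + δ a * b) ∧ ∀ a, uQuadAug _ (δ a) = 0 := by
  have hqS : (L.sub S hbr hP).IsQuadratic := sub_isQuadratic hq S hbr hP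
  obtain ⟨δ, hδ, hδm⟩ := exists_uQuad_derivation hqS
    (fun i => AddMonoidHom.mk' (fun y : S i => subOf S hbr hP (L.br rfl e y.1) (hbr rfl e y.1))
      (fun x y => by
        rw [← subOf_add hq]
        exact subOf_congr (map_add (L.br rfl e) x.1 y.1) _))
    (fun {a b k} h x y => by
      have := L.leibniz h rfl rfl (by omega : (n + a) + b = n + k) rfl
        (by omega : a + (n + b) = n + k) e x.1 y.1
      refine (subOf_congr this _).trans ((subOf_add hq _ _ (hbr _ _ _) (hbr _ _ _)).trans ?_)
      rw [subOf_br hq _ _ _ (hbr _ _ _) y.2, subOf_br hq _ _ _ x.2 (hbr _ _ _)]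
      exact derivation_br_aux _ _ _ _)
    (fun {k} h x => by
      -- Since n ≠ 0, the element [x, e] has degree > 1, where P vanishes; hence [Px, e] = [x, [x,
      -- e]].
      have : L.br (rfl : n + k = n + k) e (L.P h x.1) =
          L.br (by omega : 1 + (n + 1) = n + k) x.1 (L.br rfl e x.1) := by
        rw [L.br_comm _ (by omega : k + n = n + k),
          L.br_P_one (b := n + 1) h _ (by omega) (by omega) (by omega) x.1 e, hq _ (by omega),
          zero_add, ZModModule.neg_eq_self, L.br_comm (k := n + 1) rfl (by omega) e x.1, map_neg,
          ZModModule.neg_eq_self]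
      refine (subOf_congr this _).trans ?_
      rw [subOf_br hq _ _ _ x.2 (hbr _ _ _), sub_eq_add_neg, ZModModule.neg_eq_self]
      rfl)
  have hδ' : ∀ {i k : ℕ} (h : n + i = k) (x : L.carrier i) (hx : x ∈ S i),
        δ (subOf _ hbr hP x hx) = subOf _ hbr hP (L.br h e x) (hbr h _ x) := fun {i k} h x hx => by
    subst h
    exact hδ i ⟨x, hx⟩
  refine ⟨δ, hδ', hδm, fun a => ?_⟩
  have h1 : δ 1 = 0 := by simpa using hδm 1 1
  let T : Subsemiring (L.sub S hbr hP).UQuad :=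
    { carrier := {a | uQuadAug _ (δ a) = 0}
      mul_mem' := fun {a b} ha hb => by
        change uQuadAug _ (δ (a * b)) = 0
        rw [hδm, map_add, map_mul, map_mul, ha, hb, mul_zero, zero_mul, add_zero]
      one_mem' := by
        change uQuadAug _ (δ 1) = 0
        rw [h1, map_zero]
      add_mem' := fun {a b} ha hb => by
        change uQuadAug _ (δ (a + b)) = 0
        rw [map_add, map_add, ha, hb, add_zero]
      zero_mem' := by
        change uQuadAug _ (δ 0) = 0
        rw [map_zero, map_zero] }
  refine uQuad_mem T (fun i x => ?_) a
  change uQuadAug _ (δ (subOf S hbr hP x.1 x.2)) = 0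
  rw [hδ' rfl]
  exact uQuadAug_of _

/-- The identity [Pe, x] = [e, [e, x]] gives the formula on generators. In characteristic 2 the
square of a derivation is again a derivation, so the formula extends to products. -/
theorem derivation_sq {n : ℕ} (hq : L.IsQuadratic) (e : L.carrier 1)
    (δ : (L.sub S hbr hP).UQuad →+ (L.sub S hbr hP).UQuad)
    (hδ : ∀ {i k : ℕ} (h : 1 + i = k) (x : L.carrier i) (hx : x ∈ S i),
      δ (subOf _ hbr hP x hx) = subOf _ hbr hP (L.br h e x) (hbr h _ x))
    (hδm : ∀ a b, δ (a * b) = a * δ b + δ a * b) (h : 1 + 1 = n) (a) :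
    δ (δ a) = subOf _ hbr hP (L.P h e) (hP h e) * a - a * subOf _ hbr hP (L.P h e) (hP h e) := by
  set Q := subOf _ hbr hP (L.P h e) (hP h e)
  have h1 : δ 1 = 0 := by simpa using hδm 1 1
  let T : Subsemiring (L.sub S hbr hP).UQuad :=
    { carrier := {a | δ (δ a) = Q * a - a * Q}
      mul_mem' := fun {a b} ha hb => by
        change δ (δ (a * b)) = Q * (a * b) - a * b * Q
        replace ha : δ (δ a) = Q * a - a * Q := ha
        replace hb : δ (δ b) = Q * b - b * Q := hb
        have e2 := ZModModule.add_self (δ a * δ b)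
        rw [hδm, map_add, hδm, hδm, ha, hb]
        rw [commutator_mul_aux, e2, add_zero]
      one_mem' := by
        change δ (δ 1) = Q * 1 - 1 * Q
        rw [h1, map_zero, mul_one, one_mul, sub_self]
      add_mem' := fun {a b} ha hb => by
        change δ (δ (a + b)) = Q * (a + b) - (a + b) * Q
        rw [map_add, map_add, ha, hb, mul_add, add_mul, add_sub_add_comm]
      zero_mem' := by
        change δ (δ 0) = Q * 0 - 0 * Q
        simp }
  refine uQuad_mem T (fun i x => ?_) a
  change δ (δ (subOf S hbr hP x.1 x.2)) = Q * subOf S hbr hP x.1 x.2 - subOf S hbr hP x.1 x.2 * Q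
  rw [hδ rfl _ x.2, hδ (rfl : 1 + (1 + i) = _) _ (hbr _ _ _),
    ← subOf_br hq (by omega : n + i = 1 + (1 + i)) _ _ (hP h e) x.2]
  refine subOf_congr ?_ _
  rw [L.br_P_one h _ rfl (by omega) rfl]
  by_cases hi : i = 0
  · subst hi
    have := L.subsingleton_zero
    obtain ⟨x, hx⟩ := x
    obtain rfl : x = 0 := Subsingleton.elim _ _
    simp [P_zero]
  · rw [hq _ (by omega), zero_add]

end SubOf

theorem exists_functional_step {L : MixedLieAlgebra.{u}} (hq : L.IsQuadratic) {n : ℕ} (hn : n ≠ 0)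
    (e : ∀ i, L.carrier i) (c : ∀ i, L.carrier i →ₗ[ZMod 2] ZMod 2)
    (hcn : ∀ i, i ≠ n → c i = 0) (hce : c n (e n) = 1)
    (hbr : ∀ {m n k : ℕ} (h : m + n = k) (x : L.carrier m) (y : L.carrier n),
      L.br h x y ∈ LinearMap.ker (c k))
    (hP : ∀ {n k : ℕ} (h : n + 1 = k) (x : L.carrier n), L.P h x ∈ LinearMap.ker (c k))
    {W : Type*} [AddCommGroup W] [Module (ZMod 2) W] (I : L.MIdeal)
    (hI : ∀ i, I.part i ≤ LinearMap.ker (c i)) (φ : ∀ i, L.carrier i →ₗ[ZMod 2] W)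
    (f : (L.sub (fun i => LinearMap.ker (c i)) hbr hP).UQuad →+ W)
    (hf : ∀ (i : ℕ) (x : L.carrier i) (hx : x ∈ I.part i) u,
      f (subOf _ hbr hP x (hI i hx) * u) = uQuadAug _ u • φ i x) :
    ∃ g : L.UQuad →+ W, ∀ (i : ℕ) (x : L.carrier i), x ∈ I.part i → ∀ u,
      g (L.uQuadOf x * u) = L.uQuadAug u • φ i x := by
  set B := (L.sub (fun i => LinearMap.ker (c i)) hbr hP).UQuad with hB
  obtain ⟨δ, hδ, hδm, hδaug⟩ := exists_ad_derivation (S := fun i => LinearMap.ker (c i))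
    (hbr := hbr) (hP := hP) hq hn (e n)
  by_cases h1 : n = 1
  · subst h1
    set Q : B := subOf _ hbr hP (L.P rfl (e 1)) (hP rfl (e 1))
    have hQ : δ Q = 0 := by
      have e0 : L.br rfl (e 1) (L.P (rfl : 1 + 1 = 1 + 1) (e 1)) = 0 := by
        rw [L.br_comm _ (by omega), L.br_P_one rfl (by omega) rfl (by omega) (by omega), L.br_self]
        simp [P_zero]
      exact (hδ rfl _ _).trans ((subOf_congr e0 _).trans (subOf_zero hq))
    have hδδ := derivation_sq (hbr := hbr) (hP := hP) hq (e 1) δ hδ hδm rfl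
    have haug : uQuadAug _ Q = 0 := uQuadAug_of _
    -- The pair (v₁, v₂) stands for v₁ + v₂e with e² = Q = Pe. Left multiplication by e, with eb =
    -- be + δ(b), gives this formula.
    let E₀ : B × B →+ B × B := AddMonoidHom.mk' (fun v => (δ v.1 + v.2 * Q, δ v.2 + v.1))
      (fun v w => by
        refine Prod.ext ?_ ?_
        · simp only [Prod.fst_add, Prod.snd_add, map_add, add_mul]; abel
        · simp only [Prod.fst_add, Prod.snd_add, map_add]; abel)
    refine exists_functional_of_derivation (V := B × B) hq e c hcn hce hbr hP δ hδ
      (E₀.toZModLinearMap 2) (fun b v => ?_) (fun _ v => ?_) (LinearMap.fst B B B) (1, 0) rfl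
      (fun v => ?_) I hI φ f hf
    · change (δ (b * v.1) + b * v.2 * Q, δ (b * v.2) + b * v.1) =
        (b * (δ v.1 + v.2 * Q) + δ b * v.1, b * (δ v.2 + v.1) + δ b * v.2)
      rw [hδm, hδm]
      refine Prod.ext ?_ ?_
      · noncomm_ring
      · noncomm_ring
    · change (δ (δ v.1 + v.2 * Q) + (δ v.2 + v.1) * Q, δ (δ v.2 + v.1) + (δ v.1 + v.2 * Q)) =
        (Q * v.1, Q * v.2)
      rw [map_add, map_add, hδm, hδδ, hδδ, hQ]
      refine Prod.ext ?_ ?_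
      · have := ZModModule.add_self (δ v.2 * Q)
        have e3 : Q * v.1 - v.1 * Q + (v.2 * 0 + δ v.2 * Q) + (δ v.2 + v.1) * Q =
          Q * v.1 + (δ v.2 * Q + δ v.2 * Q) := by noncomm_ring
        exact e3.trans (by rw [this, add_zero])
      · have := ZModModule.add_self (δ v.1)
        have e3 : Q * v.2 - v.2 * Q + δ v.1 + (δ v.1 + v.2 * Q) =
          Q * v.2 + (δ v.1 + δ v.1) := by abel
        exact e3.trans (by rw [this, add_zero])
    · change uQuadAug _ (δ v.1 + v.2 * Q) = 0
      rw [map_add, hδaug, map_mul, haug, mul_zero, add_zero]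
  -- In degree > 1 no relation constrains e², so all powers of e occur: the sequence v stands for Σ
  -- v_k e^k, finite or not, and e·Σ v_k e^k has coefficients v_{k−1} + δ(v_k). Only coordinate 0 of
  -- the start vector enters the argument.
  · let E₀ : (ℕ → B) →+ (ℕ → B) := AddMonoidHom.mk'
      (fun v k => (if k = 0 then 0 else v (k - 1)) + δ (v k))
      (fun v w => by
        funext k
        simp only [Pi.add_apply, map_add]
        split_ifs <;> abel)
    refine exists_functional_of_derivation (V := ℕ → B) hq e c hcn hce hbr hP δ hδ
      (E₀.toZModLinearMap 2) (fun b v => ?_) (fun h => absurd h h1)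
      (LinearMap.proj (R := B) (φ := fun _ : ℕ => B) 0) (fun _ => 1) rfl
      (fun v => ?_) I hI φ f hf
    · funext k
      change (if k = 0 then 0 else b * v (k - 1)) + δ (b * v k) =
        b * ((if k = 0 then 0 else v (k - 1)) + δ (v k)) + δ b * v k
      rw [hδm]
      split_ifs <;> noncomm_ring
    · change uQuadAug _ ((if 0 = 0 then 0 else v (0 - 1)) + δ (v 0)) = 0
      rw [if_pos rfl, zero_add, hδaug]

/-- The restriction of an ideal to a subalgebra. -/
def MIdeal.restrict {L : MixedLieAlgebra.{u}} (I : L.MIdeal)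
    (S : ∀ n, Submodule (ZMod 2) (L.carrier n))
    (hbr : ∀ {m n k : ℕ} (h : m + n = k) (x : L.carrier m) (y : L.carrier n), L.br h x y ∈ S k)
    (hP : ∀ {n k : ℕ} (h : n + 1 = k) (x : L.carrier n), L.P h x ∈ S k) :
    (L.sub S hbr hP).MIdeal where
  part n := (I.part n).comap (S n).subtype
  br_mem h x y hy := I.br_mem h x.1 (y := y.1) hy
  P_mem h x hx := I.P_mem h (x := x.1) hx

/-- The ideal obtained by adding everything in degree `> N`. -/
def MIdeal.truncate {L : MixedLieAlgebra.{u}} (I : L.MIdeal) (N : ℕ) : L.MIdeal where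
  part n := if n ≤ N then I.part n else ⊤
  br_mem {m n k} h x y hy := by
    by_cases hk : k ≤ N
    · rw [if_pos (by omega : n ≤ N)] at hy
      rw [if_pos hk]
      exact I.br_mem h x hy
    · simp [hk]
  P_mem {n k} h x hx := by
    by_cases hk : k ≤ N
    · rw [if_pos (by omega : n ≤ N)] at hx
      rw [if_pos hk]
      exact I.P_mem h hx
    · simp [hk]

/-- With L₁ = 0 there is no squaring relation, so x ↦ (0, φ(x)) is a representation in the
square-zero extension of 𝔽₂ by W. The W-component of the induced homomorphism is g. -/
theorem exists_functional_of_top {L : MixedLieAlgebra.{u}} (hq : L.IsQuadratic)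
    (h1 : Subsingleton (L.carrier 1)) {W : Type v} [AddCommGroup W] [Module (ZMod 2) W]
    (φ : ∀ i, L.carrier i →ₗ[ZMod 2] W)
    (hφ : ∀ {a b k : ℕ} (h : a + b = k) (x : L.carrier a) (y : L.carrier b), φ k (L.br h x y) = 0) :
    ∃ g : L.UQuad →+ W, ∀ (i : ℕ) (x : L.carrier i) u,
      g (L.uQuadOf x * u) = L.uQuadAug u • φ i x := by
  let _ : Module (ZMod 2)ᵐᵒᵖ W := Module.compHom W ((RingHom.id (ZMod 2)).fromOpposite mul_comm)
  have : IsCentralScalar (ZMod 2) W := ⟨fun _ _ => rfl⟩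
  let R : Rep L (TrivSqZeroExt (ZMod 2) W) 0 :=
    { toFun := fun i => (TrivSqZeroExt.inrHom (ZMod 2) W).toAddMonoidHom.comp (φ i).toAddMonoidHom
      map_br := fun h x y => by simp [hφ h]
      map_P_one := fun h x => by
        obtain rfl : x = 0 := Subsingleton.elim _ _
        simp [P_zero]
      map_P := fun h hn x => by simp [hq h hn] }
  obtain ⟨f, hf⟩ := R.exists_uQuad
  have hfst : ∀ u, (f u).fst = L.uQuadAug u := fun u =>
    uQuad_hom_ext (f := (TrivSqZeroExt.fstHom (ZMod 2) (ZMod 2) W).toRingHom.comp f)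
      (g := L.uQuadAug.toRingHom) (fun n x =>
        (congrArg TrivSqZeroExt.fst (hf n x)).trans (uQuadAug_of x).symm) u
  refine ⟨AddMonoidHom.mk' (fun u => (f u).snd) fun a b => by simp, fun i x u => ?_⟩
  change (f _).snd = _
  have hx : f (L.uQuadOf x) = TrivSqZeroExt.inr (φ i x) := hf i x
  rw [map_mul, hx, TrivSqZeroExt.snd_mul, TrivSqZeroExt.fst_inr, TrivSqZeroExt.snd_inr, hfst,
    zero_smul, zero_add, op_smul_eq_smul]

/-- Induction on the number of elements in degrees ≤ N. While I ≠ L, a hyperplane containing I in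
the lowest deficient degree cuts out a smaller subalgebra, and `exists_functional_step` returns from
it to L. -/
theorem exists_functional_of_eq_top {W : Type v} [AddCommGroup W] [Module (ZMod 2) W] (N s : ℕ)
    (L : MixedLieAlgebra.{u}) (hq : L.IsQuadratic) (hfin : ∀ n, Finite (L.carrier n)) (I : L.MIdeal)
    (hI1 : I.part 1 = ⊥) (hIN : ∀ i, N < i → I.part i = ⊤) (φ : ∀ i, L.carrier i →ₗ[ZMod 2] W)
    (hφ : ∀ {a b k : ℕ} (h : a + b = k) (x : L.carrier a) (y : L.carrier b), x ∈ I.part a →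
      y ∈ I.part b → φ k (L.br h x y) = 0)
    (hs : ∑ i ∈ Finset.range (N + 1), Nat.card (L.carrier i) = s) :
    ∃ g : L.UQuad →+ W, ∀ (i : ℕ) (x : L.carrier i), x ∈ I.part i → ∀ u,
      g (L.uQuadOf x * u) = L.uQuadAug u • φ i x := by
  induction s using Nat.strong_induction_on generalizing L with
  | _ s ih =>
  by_cases htop : ∀ i, I.part i = ⊤
  · have h1 : Subsingleton (L.carrier 1) := by
      rw [← Submodule.subsingleton_iff (ZMod 2)]
      exact subsingleton_of_bot_eq_top (hI1.symm.trans (htop 1))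
    obtain ⟨g, hg⟩ := exists_functional_of_top hq h1 φ fun h x y =>
      hφ h x y (by simp [htop]) (by simp [htop])
    exact ⟨g, fun i x _ u => hg i x u⟩
  push Not at htop
  classical
  -- By minimality I is everything below degree n. Brackets and P-values landing in degree n
  -- therefore lie in I, hence in every hyperplane containing I_n, and the hyperplane defines a
  -- subalgebra.
  let n := Nat.find htop
  have hn : I.part n ≠ ⊤ := Nat.find_spec htop
  have hlt : ∀ i, i < n → I.part i = ⊤ := fun i hi => not_not.mp (Nat.find_min htop hi)
  have hn0 : n ≠ 0 := fun h0 => hn (by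
    rw [h0]
    have := L.subsingleton_zero
    exact Subsingleton.elim _ _)
  obtain ⟨e₀, he₀⟩ : ∃ e₀ : L.carrier n, e₀ ∉ I.part n := by
    by_contra! hcon
    exact hn (eq_top_iff.mpr fun x _ => hcon x)
  obtain ⟨c₀, hc₀, hIc₀⟩ := Submodule.exists_le_ker_of_notMem he₀
  have hc₀1 : c₀ e₀ = 1 := (Fin.exists_fin_two.mp ⟨c₀ e₀, rfl⟩).elim (fun h => absurd h hc₀) id
  let e : ∀ i, L.carrier i := fun i => if h : n = i then h ▸ e₀ else 0
  let c : ∀ i, L.carrier i →ₗ[ZMod 2] ZMod 2 := fun i => if h : n = i then h ▸ c₀ else 0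
  have hen : e n = e₀ := dif_pos rfl
  have hcn : c n = c₀ := dif_pos rfl
  have hci : ∀ i, i ≠ n → c i = 0 := fun i hi => dif_neg (Ne.symm hi)
  have hIc : ∀ i, I.part i ≤ LinearMap.ker (c i) := fun i => by
    by_cases hi : i = n
    · subst hi
      rw [hcn]
      exact hIc₀
    · rw [hci i hi, LinearMap.ker_zero]
      exact le_top
  have hbr : ∀ {a b k : ℕ} (h : a + b = k) (x : L.carrier a) (y : L.carrier b),
      L.br h x y ∈ LinearMap.ker (c k) := fun {a b k} h x y => by
    by_cases hk : k = n
    · by_cases ha : a = 0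
      · subst ha
        have := L.subsingleton_zero
        obtain rfl : x = 0 := Subsingleton.elim _ _
        simp
      · refine hIc k (I.br_mem h x ?_)
        rw [hlt b (by omega)]
        trivial
    · simp [hci k hk]
  have hP : ∀ {a k : ℕ} (h : a + 1 = k) (x : L.carrier a), L.P h x ∈ LinearMap.ker (c k) :=
    fun {a k} h x => by
    by_cases hk : k = n
    · refine hIc k (I.P_mem h ?_)
      rw [hlt a (by omega)]
      trivial
    · simp [hci k hk]
  have hcard : ∑ i ∈ Finset.range (N + 1), Nat.card (LinearMap.ker (c i)) < s := by
    rw [← hs]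
    refine Finset.sum_lt_sum (fun i _ => ?_) ⟨n, ?_, ?_⟩
    · exact Nat.card_le_card_of_injective _ Subtype.val_injective
    · rw [Finset.mem_range]
      by_contra hlt'
      exact hn (hIN n (by omega))
    · refine (Finite.card_subtype_lt (p := fun x => x ∈ LinearMap.ker (c n)) (x := e₀) ?_)
      rw [hcn, LinearMap.mem_ker, hc₀1]
      exact one_ne_zero
  obtain ⟨f, hf⟩ := ih _ hcard (L.sub (fun i => LinearMap.ker (c i)) hbr hP)
    (sub_isQuadratic hq _ hbr hP)
    (fun i => inferInstanceAs (Finite (LinearMap.ker (c i)))) (I.restrict _ hbr hP)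
    (by
      refine (Submodule.eq_bot_iff _).mpr fun x hx => Subtype.ext ?_
      have hx' : x.1 ∈ I.part 1 := hx
      rw [hI1] at hx'
      exact hx')
    (fun i hi => by
      refine eq_top_iff.mpr fun x _ => ?_
      change x.1 ∈ I.part i
      rw [hIN i hi]
      trivial)
    (fun i => φ i ∘ₗ (LinearMap.ker (c i)).subtype)
    (fun h x y hx hy => hφ h x.1 y.1 hx hy) rfl
  exact exists_functional_step hq hn0 e c hci (by rw [hen, hcn, hc₀1]) hbr hP I hIc φ f
    fun i x hx u => hf i ⟨x, hIc i hx⟩ hx u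

theorem exists_functional {L : MixedLieAlgebra.{u}} (hq : L.IsQuadratic)
    (hfin : ∀ n, Finite (L.carrier n)) (I : L.MIdeal) (hI1 : I.part 1 = ⊥) {W : Type v}
    [AddCommGroup W] [Module (ZMod 2) W] (φ : ∀ i, L.carrier i →ₗ[ZMod 2] W) (N : ℕ)
    (hN : ∀ i, N < i → φ i = 0)
    (hφ : ∀ {a b k : ℕ} (h : a + b = k) (x : L.carrier a) (y : L.carrier b), x ∈ I.part a →
      y ∈ I.part b → φ k (L.br h x y) = 0) :
    ∃ g : L.UQuad →+ W, ∀ (i : ℕ) (x : L.carrier i), x ∈ I.part i → ∀ u,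
      g (L.uQuadOf x * u) = L.uQuadAug u • φ i x := by
  -- Truncation does not disturb the hypothesis on φ: a bracket of degree ≤ N has factors of degree
  -- ≤ N, where I is unchanged, and φ is zero above N. The cutoff N + 1, not N, keeps I₁ = 0 when N
  -- = 0.
  obtain ⟨g, hg⟩ := exists_functional_of_eq_top (N + 1) _ L hq hfin (I.truncate (N + 1))
    (by simp [MIdeal.truncate, hI1]) (fun i hi => if_neg (by omega)) φ
    (fun {a b k} h x y hx hy => by
      by_cases hk : N < k
      · rw [hN k hk, LinearMap.zero_apply]
      · simp only [MIdeal.truncate, if_pos (by omega : a ≤ N + 1)] at hx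
        simp only [MIdeal.truncate, if_pos (by omega : b ≤ N + 1)] at hy
        exact hφ h x y hx hy) rfl
  refine ⟨g, fun i x hx u => hg i x ?_ u⟩
  by_cases hi : i ≤ N + 1
  · simpa [MIdeal.truncate, hi] using hx
  · simp [MIdeal.truncate, hi]

/-- Everything in degree `≥ n`. -/
def degreeGe (L : MixedLieAlgebra.{u}) (n : ℕ) : L.MIdeal where
  part i := if i < n then ⊥ else ⊤
  br_mem {a b k} h x y hy := by
    by_cases hk : k < n
    · rw [if_pos (by omega : b < n), Submodule.mem_bot] at hy
      simp [hy]
    · simp [hk]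
  P_mem {a k} h x hx := by
    by_cases hk : k < n
    · rw [if_pos (by omega : a < n), Submodule.mem_bot] at hx
      simp [hx, P_zero]
    · simp [hk]

/-- Take φ to be the projection to degree n and I everything in degree ≥ n. Brackets in I have
degree ≥ 2n > n, so φ kills them, and the functional recovers x as g(x·1). -/
theorem uQuadOf_injective {L : MixedLieAlgebra.{u}} (hq : L.IsQuadratic)
    (hfin : ∀ n, Finite (L.carrier n)) {n : ℕ} (hn : 1 < n) (x : L.carrier n)
    (hx : L.uQuadOf x = 0) : x = 0 := by
  let φ : ∀ i, L.carrier i →ₗ[ZMod 2] L.carrier n := fun i =>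
    if h : n = i then h ▸ LinearMap.id else 0
  have hφn : φ n = LinearMap.id := dif_pos rfl
  have hφi : ∀ i, n ≠ i → φ i = 0 := fun i hi => dif_neg hi
  obtain ⟨g, hg⟩ := exists_functional hq hfin (L.degreeGe n) (if_pos hn) φ n
    (fun i hi => hφi i (by omega)) (fun {a b k} h x y hx hy => by
      by_cases hk : n = k
      · by_cases ha : a < n
        · simp only [degreeGe, if_pos ha, Submodule.mem_bot] at hx
          simp [hx]
        · simp only [degreeGe, if_pos (by omega : b < n), Submodule.mem_bot] at hy
          simp [hy]
      · rw [hφi k hk, LinearMap.zero_apply])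
  have := hg n x (by simp [degreeGe]) 1
  rw [hx, zero_mul, map_zero, map_one, one_smul, hφn, LinearMap.id_apply] at this
  exact this.symm

/-- The functional attached to the class map I → I/[I,I], extended linearly from I to L, for one
degree n at a time. -/
theorem exists_abel_functional {L : MixedLieAlgebra.{u}} (hq : L.IsQuadratic)
    (hfin : ∀ n, Finite (L.carrier n)) (I : L.MIdeal) (hI1 : I.part 1 = ⊥) (n : ℕ) :
    ∃ g : L.UQuad →+ abelPart I n, ∀ (i : ℕ) (x : L.carrier i) (hx : x ∈ I.part i) u,
      g (L.uQuadOf x * u) = L.uQuadAug u • DirectSum.component (ZMod 2) ℕ _ n (abelMk I ⟨x, hx⟩) := by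
  have hext : ∀ i, ∃ φ : L.carrier i →ₗ[ZMod 2] abelPart I n, ∀ x (hx : x ∈ I.part i),
      φ x = DirectSum.component (ZMod 2) ℕ _ n (abelMk I ⟨x, hx⟩) := fun i => by
    obtain ⟨φ, hφ⟩ := LinearMap.exists_extend
      (DirectSum.component (ZMod 2) ℕ _ n ∘ₗ abelMk I (n := i))
    exact ⟨φ, fun x hx => LinearMap.congr_fun hφ ⟨x, hx⟩⟩
  choose φ hφ using hext
  have hne : ∀ i, i ≠ n → ∀ x (hx : x ∈ I.part i),
      DirectSum.component (ZMod 2) ℕ _ n (abelMk I ⟨x, hx⟩) = 0 := fun i hi x hx => by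
    rw [abelMk, LinearMap.comp_apply, DirectSum.component.of, dif_neg hi]
  -- Cutting φ off above n costs nothing: a class of degree i ≠ n has zero component in degree n.
  obtain ⟨g, hg⟩ := exists_functional hq hfin I hI1 (fun i => if i ≤ n then φ i else 0) n
    (fun i hi => if_neg (by omega)) (fun {a b k} h x y hx hy => by
      by_cases hk : k ≤ n
      · rw [if_pos hk, hφ k _ (I.br_mem h x hy),
          abelMk_derived I _ (Submodule.subset_span ⟨_, _, _, _, _, hx, hy, rfl⟩), map_zero]
      · rw [if_neg hk, LinearMap.zero_apply])
  refine ⟨g, fun i x hx u => (hg i x hx u).trans ?_⟩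
  by_cases hi : i ≤ n
  · rw [if_pos hi, hφ i x hx]
  · rw [if_neg hi, hne i (by omega), LinearMap.zero_apply]

/-! ### The module `r / [r, r]` -/

theorem abel_induction {L : MixedLieAlgebra.{u}} {I : L.MIdeal} (W : Submodule (ZMod 2) (Abel I))
    (h : ∀ n (y : L.carrier n) (hy : y ∈ I.part n), abelMk I ⟨y, hy⟩ ∈ W) (z : Abel I) : z ∈ W := by
  classical
  rw [← DirectSum.sum_support_of z]
  refine sum_mem fun n _ => ?_
  obtain ⟨⟨y, hy⟩, hz⟩ := abelPartMk_surjective I n (z n)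
  rw [← hz]
  exact h n y hy

/-- The map on a component of `r / [r, r]` induced by a linear map that kills `[r, r]`. -/
def abelPartLift {L : MixedLieAlgebra.{u}} (I : L.MIdeal) {N : Type v} [AddCommGroup N]
    [Module (ZMod 2) N] {n : ℕ} (φ : I.part n →ₗ[ZMod 2] N)
    (hφ : (derivedPart I n).submoduleOf (I.part n) ≤ LinearMap.ker φ) :
    abelPart I n →ₗ[ZMod 2] N := Submodule.liftQ _ φ hφ

theorem exists_abel_lift {L : MixedLieAlgebra.{u}} (I : L.MIdeal) {N : Type v} [AddCommGroup N]
    [Module (ZMod 2) N] (φ : ∀ n, I.part n →ₗ[ZMod 2] N)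
    (hφ : ∀ {a b k : ℕ} (h : a + b = k) (x : L.carrier a) (y : L.carrier b) (_ : x ∈ I.part a)
      (hy : y ∈ I.part b), φ k ⟨L.br h x y, I.br_mem h x hy⟩ = 0) :
    ∃ Ψ : Abel I →ₗ[ZMod 2] N, ∀ n (y : I.part n), Ψ (abelMk I y) = φ n y := by
  have hker : ∀ n, (derivedPart I n).submoduleOf (I.part n) ≤ LinearMap.ker (φ n) := fun n => by
    have hle : derivedPart I n ≤ (LinearMap.ker (φ n)).map (I.part n).subtype := by
      refine Submodule.span_le.mpr ?_
      rintro _ ⟨a, b, h, x, y, hx, hy, rfl⟩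
      exact ⟨⟨_, I.br_mem h x hy⟩, hφ h x y hx hy, rfl⟩
    intro y hy
    obtain ⟨y', hy', he⟩ := hle hy
    rwa [← Subtype.ext (a1 := y') (a2 := y) he]
  refine ⟨DirectSum.toModule (ZMod 2) ℕ N fun n => abelPartLift I (φ n) (hker n), fun n y => ?_⟩
  rw [abelMk, LinearMap.comp_apply, DirectSum.toModule_lof]
  rfl

theorem abelMk_eq_zero {L : MixedLieAlgebra.{u}} {I : L.MIdeal} {n : ℕ} {y : L.carrier n}
    {hy : y ∈ I.part n} (h : DirectSum.component (ZMod 2) ℕ _ n (abelMk I ⟨y, hy⟩) = 0) :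
    y ∈ derivedPart I n := by
  rw [abelMk, LinearMap.comp_apply, DirectSum.component.lof_self] at h
  exact (Submodule.Quotient.mk_eq_zero ((derivedPart I n).submoduleOf (I.part n))).mp h

/-- The elements of 𝔯 whose class lies in W form an ideal containing every ρ_i, hence all of 𝔯. -/
theorem abel_span {L : MixedLieAlgebra.{u}} {ι : Type v} {deg : ι → ℕ} (ρ : ∀ i, L.carrier (deg i))
    (hI1 : (idealSpan ρ).part 1 = ⊥) (W : AddSubmonoid (Abel (idealSpan ρ)))
    (hρ : ∀ i, abelMk (idealSpan ρ) ⟨ρ i, mem_idealSpan ρ i⟩ ∈ W)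
    (had : ∀ {m} (x : L.carrier m), ∀ z ∈ W, adEnd (idealSpan ρ) x z ∈ W)
    (hpi : ∀ z ∈ W, piEnd (idealSpan ρ) z ∈ W) (z : Abel (idealSpan ρ)) : z ∈ W := by
  let W' : Submodule (ZMod 2) (Abel (idealSpan ρ)) :=
    { W with
      smul_mem' := fun c x hx => by
        rw [← ZMod.natCast_zmod_val c, Nat.cast_smul_eq_nsmul]
        exact nsmul_mem (S := W) hx _ }
  let J : L.MIdeal :=
    { part := fun n => (W'.comap (abelMk (idealSpan ρ))).map ((idealSpan ρ).part n).subtype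
      br_mem := fun {m n k} h x y hy => by
        obtain ⟨⟨y, hyI⟩, hyW, rfl⟩ := hy
        refine ⟨⟨_, (idealSpan ρ).br_mem h x hyI⟩, ?_, rfl⟩
        change abelMk (idealSpan ρ) _ ∈ W
        rw [← adEnd_mk (idealSpan ρ) h x y hyI]
        exact had x _ hyW
      P_mem := fun {n k} h y hy => by
        obtain ⟨⟨y, hyI⟩, hyW, rfl⟩ := hy
        refine ⟨⟨_, (idealSpan ρ).P_mem h hyI⟩, ?_, rfl⟩
        change abelMk (idealSpan ρ) ⟨L.P h y, _⟩ ∈ W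
        by_cases hn : n = 1
        · subst hn
          have hy0 : y = 0 := by
            rw [hI1, Submodule.mem_bot] at hyI
            exact hyI
          subst hy0
          rw [abelMk_congr (idealSpan ρ) (P_zero h)]
          exact (map_zero (abelMk (n := k) (idealSpan ρ))).symm ▸ zero_mem W
        · rw [← piEnd_mk (idealSpan ρ) h hn y hyI]
          exact hpi _ hyW }
  refine abel_induction W' (fun n y hy => ?_) z
  obtain ⟨y', hy', rfl⟩ := idealSpan_le ρ J (fun i => ⟨⟨_, mem_idealSpan ρ i⟩, hρ i, rfl⟩) n hy
  exact hy'

/-- The identification of `r / [r, r]` with the underlying group of the `U_mix`-module. -/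
noncomputable def abelMixEquiv {L : MixedLieAlgebra.{u}} {I : L.MIdeal} (hI : I.part 1 = ⊥) :
    Abel I ≃+ AbelMix I hI := (Module.AEval'.of (piEnd I)).toAddEquiv

/-- The identification of `r / [r, r]` with the underlying group of the `U_quad`-module. -/
def abelQuadEquiv {L : MixedLieAlgebra.{u}} {I : L.MIdeal} (hq : L.IsQuadratic) :
    Abel I ≃+ AbelQuad I hq := AddEquiv.refl _

theorem uMixOf_smul_equiv {L : MixedLieAlgebra.{u}} {I : L.MIdeal} (hI : I.part 1 = ⊥) {n : ℕ}
    (x : L.carrier n) (z : Abel I) :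
    (L.quotient I).uMixOf (quotientMk I n x) • abelMixEquiv hI z =
      abelMixEquiv hI (adEnd I x z) := by
  change adRepMix I hI ((L.quotient I).uMixOf (quotientMk I n x)) (abelMixEquiv hI z) = _
  rw [adRepMix, uMixLift_of]
  rfl

theorem uMixPi_smul_equiv {L : MixedLieAlgebra.{u}} {I : L.MIdeal} (hI : I.part 1 = ⊥)
    (z : Abel I) :
    (L.quotient I).uMixPi • abelMixEquiv hI z = abelMixEquiv hI (piEnd I z) := by
  change adRepMix I hI (uMixPi _) (abelMixEquiv hI z) = _
  rw [uMixPi, AlgHom.commutes]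
  exact Module.AEval'.X_smul_of (piEnd I) z

theorem uQuadOf_smul_equiv {L : MixedLieAlgebra.{u}} {I : L.MIdeal} (hq : L.IsQuadratic) {n : ℕ}
    (x : L.carrier n) (z : Abel I) :
    (L.quotient I).uQuadOf (quotientMk I n x) • abelQuadEquiv hq z =
      abelQuadEquiv hq (adEnd I x z) :=
  LinearMap.congr_fun (uQuadLift_of (L := L.quotient I)
    (B := Module.End (ZMod 2) (Abel I)) (adQuot I) (adQuot_br I) (adQuot_P_one I hq)
    (quotientMk I n x)) z

theorem abelMix_span {L : MixedLieAlgebra.{u}} {ι : Type v} {deg : ι → ℕ}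
    (ρ : ∀ i, L.carrier (deg i)) (hI : (idealSpan ρ).part 1 = ⊥) :
    Submodule.span (L.quotient (idealSpan ρ)).UMix
      (Set.range fun i => abelMixMk (idealSpan ρ) hI ⟨ρ i, mem_idealSpan ρ i⟩) = ⊤ := by
  refine eq_top_iff.mpr fun z _ => ?_
  obtain ⟨z, rfl⟩ := (abelMixEquiv hI).surjective z
  refine abel_span ρ hI (AddSubmonoid.comap (abelMixEquiv hI).toAddMonoidHom
    (Submodule.span (L.quotient (idealSpan ρ)).UMix (Set.range fun i =>
      abelMixMk (idealSpan ρ) hI ⟨ρ i, mem_idealSpan ρ i⟩)).toAddSubmonoid)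
    (fun i => ?_) (fun x z hz => ?_) (fun z hz => ?_) z
  · change abelMixEquiv hI (abelMk _ _) ∈ Submodule.span _ _
    exact Submodule.subset_span ⟨i, rfl⟩
  · change abelMixEquiv hI (adEnd _ x z) ∈ Submodule.span _ _
    rw [← uMixOf_smul_equiv]
    exact Submodule.smul_mem _ _ hz
  · change abelMixEquiv hI (piEnd _ z) ∈ Submodule.span _ _
    rw [← uMixPi_smul_equiv]
    exact Submodule.smul_mem _ _ hz

theorem piEnd_eq_zero {L : MixedLieAlgebra.{u}} (hq : L.IsQuadratic) (I : L.MIdeal) (z : Abel I) :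
    piEnd I z = 0 := by
  refine abel_induction (LinearMap.ker (piEnd I)) (fun n y hy => ?_) z
  change piEnd I _ = 0
  simp only [piEnd, abelMk, LinearMap.comp_apply, DirectSum.toModule_lof, abelPartMap_mk]
  have : L.piMap (rfl : n + 1 = n + 1) y = 0 := by
    by_cases hn : n = 1
    · subst hn
      simp [piMap]
    · rw [piMap_apply _ hn, hq rfl hn]
  simp only [this]
  exact map_zero (abelMk I)

theorem abelQuad_span {L : MixedLieAlgebra.{u}} (hq : L.IsQuadratic) {ι : Type v} {deg : ι → ℕ}
    (ρ : ∀ i, L.carrier (deg i)) (hI : (idealSpan ρ).part 1 = ⊥) :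
    Submodule.span (L.quotient (idealSpan ρ)).UQuad
      (Set.range fun i => abelQuadMk (idealSpan ρ) hq ⟨ρ i, mem_idealSpan ρ i⟩) = ⊤ := by
  refine eq_top_iff.mpr fun z _ => ?_
  obtain ⟨z, rfl⟩ := (abelQuadEquiv hq).surjective z
  refine abel_span ρ hI (AddSubmonoid.comap (abelQuadEquiv hq).toAddMonoidHom
    (Submodule.span (L.quotient (idealSpan ρ)).UQuad (Set.range fun i =>
      abelQuadMk (idealSpan ρ) hq ⟨ρ i, mem_idealSpan ρ i⟩)).toAddSubmonoid)
    (fun i => ?_) (fun x z hz => ?_) (fun z hz => ?_) z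
  · change abelQuadEquiv hq (abelMk _ _) ∈ Submodule.span _ _
    exact Submodule.subset_span ⟨i, rfl⟩
  · change abelQuadEquiv hq (adEnd _ x z) ∈ Submodule.span _ _
    rw [← uQuadOf_smul_equiv]
    exact Submodule.smul_mem _ _ hz
  · rw [piEnd_eq_zero hq]
    exact zero_mem _

/-- Maps out of `r / [r, r]` that are compatible with the operators of `L` and with `π` are
semilinear over the enveloping algebra. -/
theorem abelMix_semilinear {L : MixedLieAlgebra.{u}} {I : L.MIdeal} (hI : I.part 1 = ⊥)
    {S : Type*} [Ring S] {N : Type*} [AddCommGroup N] [Module S N]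
    (g : (L.quotient I).UMix →+* S) (F : Abel I →+ N)
    (had : ∀ {n} (x : L.carrier n) z, F (adEnd I x z) =
      g ((L.quotient I).uMixOf (quotientMk I n x)) • F z)
    (hpi : ∀ z, F (piEnd I z) = g (uMixPi _) • F z) (a : (L.quotient I).UMix) (z : AbelMix I hI) :
    F ((abelMixEquiv hI).symm (a • z)) = g a • F ((abelMixEquiv hI).symm z) := by
  let T : Subsemiring (L.quotient I).UMix :=
    { carrier := {a | ∀ z : AbelMix I hI, F ((abelMixEquiv hI).symm (a • z)) =
        g a • F ((abelMixEquiv hI).symm z)}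
      mul_mem' := fun {a b} ha hb z => by rw [mul_smul, ha, hb, map_mul, mul_smul]
      one_mem' := fun z => by rw [one_smul, map_one, one_smul]
      add_mem' := fun {a b} ha hb z => by
        rw [add_smul, map_add, map_add, ha, hb, map_add, add_smul]
      zero_mem' := fun z => by rw [zero_smul, map_zero, map_zero, map_zero, zero_smul] }
  refine uMix_mem T (fun n x z => ?_) (fun z => ?_) a z
  · obtain ⟨x, rfl⟩ := quotientMk_surjective I n x
    obtain ⟨z, rfl⟩ := (abelMixEquiv hI).surjective z
    rw [uMixOf_smul_equiv, AddEquiv.symm_apply_apply, AddEquiv.symm_apply_apply, had]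
  · obtain ⟨z, rfl⟩ := (abelMixEquiv hI).surjective z
    rw [uMixPi_smul_equiv, AddEquiv.symm_apply_apply, AddEquiv.symm_apply_apply, hpi]

/-! ### Ideals and reduction modulo `π` -/

theorem mem_idealSpan_quotient {L : MixedLieAlgebra.{u}} (K : L.MIdeal) {ι : Type v} {deg : ι → ℕ}
    (ρ : ∀ i, L.carrier (deg i)) {n : ℕ} {y : L.carrier n} (hy : y ∈ (idealSpan ρ).part n) :
    quotientMk K n y ∈ (idealSpan (L := L.quotient K) fun i => quotientMk K _ (ρ i)).part n := by
  let It := idealSpan (L := L.quotient K) fun i => quotientMk K _ (ρ i)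
  let J : L.MIdeal :=
    { part := fun n => (It.part n).comap (quotientMk K n)
      br_mem := fun h x y hy => It.br_mem h (quotientMk K _ x) hy
      P_mem := fun h x hx => It.P_mem (x := quotientMk K _ x) h hx }
  exact idealSpan_le ρ J (fun i => mem_idealSpan (L := L.quotient K) _ i) n hy

theorem exists_mem_idealSpan {L : MixedLieAlgebra.{u}} (K : L.MIdeal) {ι : Type v} {deg : ι → ℕ}
    (ρ : ∀ i, L.carrier (deg i)) {n : ℕ} {z : (L.quotient K).carrier n}
    (hz : z ∈ (idealSpan (L := L.quotient K) fun i => quotientMk K _ (ρ i)).part n) :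
    ∃ y ∈ (idealSpan ρ).part n, quotientMk K n y = z := by
  let J : (L.quotient K).MIdeal :=
    { part := fun n => ((idealSpan ρ).part n).map (quotientMk K n)
      br_mem := fun {m n k} h x y hy => by
        obtain ⟨y, hy, rfl⟩ := hy
        obtain ⟨x, rfl⟩ := quotientMk_surjective K m x
        exact ⟨_, (idealSpan ρ).br_mem h x hy, rfl⟩
      P_mem := fun {n k} h x hx => by
        obtain ⟨x, hx, rfl⟩ := hx
        exact ⟨_, (idealSpan ρ).P_mem h hx, rfl⟩ }
  exact idealSpan_le _ J (fun i => ⟨_, mem_idealSpan ρ i, rfl⟩) n hz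

/-- The supremum defining `piIdeal` in degree k has at most the one term of source degree k − 1, and
P is linear in degrees > 1, so its range is already a subspace. -/
theorem mem_piIdeal {L : MixedLieAlgebra.{u}} {k : ℕ} {z : L.carrier k}
    (hz : z ∈ L.piIdeal.part k) :
    z = 0 ∨ ∃ (n : ℕ) (h : n + 1 = k) (_ : 1 < n) (x : L.carrier n), z = L.P h x := by
  rcases k with _ | n
  · have := L.subsingleton_zero
    exact Or.inl (Subsingleton.elim _ _)
  · have hle : L.piIdeal.part (n + 1) ≤ LinearMap.range (L.piMap (rfl : n + 1 = n + 1)) := by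
      refine iSup_le fun a => iSup_le fun ha => ?_
      obtain rfl : a = n := by omega
      exact le_rfl
    obtain ⟨x, rfl⟩ := hle hz
    by_cases hn : 1 < n
    · exact Or.inr ⟨n, rfl, hn, x, piMap_apply _ (by omega) x⟩
    · refine Or.inl ?_
      by_cases h1 : n = 1
      · subst h1
        simp [piMap]
      · obtain rfl : n = 0 := by omega
        have := L.subsingleton_zero
        rw [Subsingleton.elim x 0, map_zero]

theorem derivedPart_quotient {L : MixedLieAlgebra.{u}} (K : L.MIdeal) {ι : Type v} {deg : ι → ℕ}
    (ρ : ∀ i, L.carrier (deg i)) {n : ℕ} {z : (L.quotient K).carrier n}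
    (hz : z ∈ derivedPart (idealSpan (L := L.quotient K) fun i => quotientMk K _ (ρ i)) n) :
    ∃ y ∈ derivedPart (idealSpan ρ) n, quotientMk K n y = z := by
  have hle : derivedPart (idealSpan (L := L.quotient K) fun i => quotientMk K _ (ρ i)) n ≤
      (derivedPart (idealSpan ρ) n).map (quotientMk K n) := by
    refine Submodule.span_le.mpr ?_
    rintro _ ⟨a, b, h, x, y, hx, hy, rfl⟩
    obtain ⟨x', hx', rfl⟩ := exists_mem_idealSpan K ρ hx
    obtain ⟨y', hy', rfl⟩ := exists_mem_idealSpan K ρ hy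
    exact ⟨_, Submodule.subset_span ⟨_, _, h, _, _, hx', hy', rfl⟩, rfl⟩
  exact hle hz

theorem derivedPart_le {L : MixedLieAlgebra.{u}} (I : L.MIdeal) (n : ℕ) :
    derivedPart I n ≤ I.part n := by
  refine Submodule.span_le.mpr ?_
  rintro _ ⟨a, b, h, x, y, hx, hy, rfl⟩
  exact I.br_mem h x hy

theorem exists_abel_quotient {L : MixedLieAlgebra.{u}} (K : L.MIdeal) {ι : Type v} {deg : ι → ℕ}
    (ρ : ∀ i, L.carrier (deg i)) :
    ∃ Ψ : Abel (idealSpan ρ) →ₗ[ZMod 2]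
        Abel (idealSpan (L := L.quotient K) fun i => quotientMk K _ (ρ i)),
      (∀ n (y : L.carrier n) (hy : y ∈ (idealSpan ρ).part n),
        Ψ (abelMk _ ⟨y, hy⟩) = abelMk _ ⟨quotientMk K n y, mem_idealSpan_quotient K ρ hy⟩) ∧
      Function.Surjective Ψ := by
  obtain ⟨Ψ, hΨ⟩ := exists_abel_lift (idealSpan ρ) (fun n => abelMk
    (idealSpan (L := L.quotient K) fun i => quotientMk K _ (ρ i)) ∘ₗ
      (quotientMk K n).restrict fun y hy => mem_idealSpan_quotient K ρ hy)
    (fun h x y hx hy => abelMk_derived _ _ (Submodule.subset_span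
      ⟨_, _, h, quotientMk K _ x, quotientMk K _ y, mem_idealSpan_quotient K ρ hx,
        mem_idealSpan_quotient K ρ hy, rfl⟩))
  refine ⟨Ψ, fun n y hy => hΨ n ⟨y, hy⟩, fun z => ?_⟩
  refine abel_induction (LinearMap.range Ψ) (fun n y hy => ?_) z
  obtain ⟨y', hy', rfl⟩ := exists_mem_idealSpan K ρ hy
  exact ⟨_, hΨ n ⟨y', hy'⟩⟩

/-- If the reduction of y in 𝔯 lies in [𝔯̃,𝔯̃], subtracting an element of [𝔯,𝔯] puts y in 𝔯 ∩ πL⁺.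
There y = Px or y = 0, and saturation places x in 𝔯, so the class of y is π times a class. -/
theorem exists_piEnd_eq {L : MixedLieAlgebra.{u}} {ι : Type v} {deg : ι → ℕ}
    (ρ : ∀ i, L.carrier (deg i))
    (hsat : ∀ {n k : ℕ} (h : n + 1 = k) (x : L.carrier n), 1 < n →
      L.P h x ∈ (idealSpan ρ).part k → x ∈ (idealSpan ρ).part n)
    (Ψ : Abel (idealSpan ρ) →ₗ[ZMod 2]
        Abel (idealSpan (L := L.quotient L.piIdeal) fun i => quotientMk L.piIdeal _ (ρ i)))
    (hΨ : ∀ n (y : L.carrier n) (hy : y ∈ (idealSpan ρ).part n),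
        Ψ (abelMk _ ⟨y, hy⟩) =
          abelMk _ ⟨quotientMk L.piIdeal n y, mem_idealSpan_quotient L.piIdeal ρ hy⟩)
    (z : Abel (idealSpan ρ)) (hz : Ψ z = 0) : ∃ z', piEnd (idealSpan ρ) z' = z := by
  classical
  -- Ψ preserves degrees, so its kernel can be studied one homogeneous component at a time.
  have hcomp : ∀ n z, DirectSum.component (ZMod 2) ℕ _ n (Ψ z) =
      DirectSum.component (ZMod 2) ℕ _ n (Ψ (DirectSum.lof (ZMod 2) ℕ (abelPart (idealSpan ρ)) n
        (z n))) := fun n z => by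
    let A := DirectSum.component (ZMod 2) ℕ 
      (abelPart (idealSpan (L := L.quotient L.piIdeal) fun i => quotientMk L.piIdeal _ (ρ i))) n ∘ₗ Ψ
    let B := A ∘ₗ (DirectSum.lof (ZMod 2) ℕ (abelPart (idealSpan ρ)) n ∘ₗ
      DirectSum.component (ZMod 2) ℕ (abelPart (idealSpan ρ)) n)
    refine abel_induction (LinearMap.eqLocus A B) (fun k y hy => ?_) z
    rw [LinearMap.mem_eqLocus]
    simp only [A, B, LinearMap.comp_apply]
    by_cases hk : k = n
    · subst hk
      rw [abelMk, LinearMap.comp_apply, DirectSum.component.lof_self]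
    · have h1 : DirectSum.component (ZMod 2) ℕ _ n (abelMk (idealSpan ρ) ⟨y, hy⟩) = 0 := by
        rw [abelMk, LinearMap.comp_apply, DirectSum.component.of, dif_neg hk]
      rw [h1, map_zero, map_zero, map_zero, hΨ, abelMk, LinearMap.comp_apply,
        DirectSum.component.of, dif_neg hk]
  change z ∈ LinearMap.range (piEnd (idealSpan ρ))
  rw [← DirectSum.sum_support_of z]
  refine sum_mem fun n _ => ?_
  obtain ⟨⟨y, hy⟩, hyz⟩ := abelPartMk_surjective (idealSpan ρ) n (z n)
  have h0 := hcomp n z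
  rw [hz, map_zero, ← hyz] at h0
  change 0 = DirectSum.component (ZMod 2) ℕ _ n (Ψ (abelMk _ ⟨y, hy⟩)) at h0
  rw [hΨ] at h0
  obtain ⟨y', hy', he⟩ := derivedPart_quotient L.piIdeal ρ (abelMk_eq_zero h0.symm)
  rw [← hyz]
  change abelMk _ ⟨y, hy⟩ ∈ _
  have hyI := derivedPart_le _ n hy'
  have hd : y - y' ∈ (idealSpan ρ).part n := sub_mem hy hyI
  have hpi : y - y' ∈ L.piIdeal.part n := (Submodule.Quotient.eq _).mp he.symm
  have hyy : abelMk (idealSpan ρ) ⟨y, hy⟩ = abelMk (idealSpan ρ) ⟨y - y', hd⟩ := by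
    have : abelMk (idealSpan ρ) ⟨y - y', hd⟩ =
        abelMk (idealSpan ρ) ⟨y, hy⟩ - abelMk (idealSpan ρ) ⟨y', hyI⟩ :=
      map_sub (abelMk (idealSpan ρ)) ⟨y, hy⟩ ⟨y', hyI⟩
    rw [this, abelMk_derived _ _ hy', sub_zero]
  rw [hyy]
  rcases mem_piIdeal hpi with h0 | ⟨k, hk, hk1, x, hx⟩
  · rw [abelMk_congr _ h0]
    exact (map_zero (abelMk (n := n) (idealSpan ρ))).symm ▸ zero_mem _
  · have hxI : x ∈ (idealSpan ρ).part k := hsat hk x hk1 (hx ▸ hd)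
    exact ⟨abelMk _ ⟨x, hxI⟩, by rw [piEnd_mk _ hk (by omega), abelMk_congr _ hx]⟩

theorem quotientMk_eq_zero {L : MixedLieAlgebra.{u}} {I : L.MIdeal} {n : ℕ} {x : L.carrier n} :
    quotientMk I n x = 0 ↔ x ∈ I.part n :=
  Submodule.Quotient.mk_eq_zero _

theorem P_mem_piIdeal {L : MixedLieAlgebra.{u}} {n k : ℕ} (h : n + 1 = k) (hn : n ≠ 1)
    (x : L.carrier n) : L.P h x ∈ L.piIdeal.part k := by
  rw [← piMap_apply h hn]
  exact Submodule.mem_iSup_of_mem _ (Submodule.mem_iSup_of_mem h ⟨_, rfl⟩)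

theorem quotient_piIdeal_isQuadratic (L : MixedLieAlgebra.{u}) :
    (L.quotient L.piIdeal).IsQuadratic := L.reduced_isQuadratic

/-- The quotient of a ring by the two-sided ideal generated by a set. -/
theorem exists_quotient_by_set {U : Type v} [Ring U] [Algebra (ZMod 2) U] (s : Set U) :
    ∃ (B : Type v) (_ : Ring B) (_ : Algebra (ZMod 2) B) (f : U →+* B), (∀ x ∈ s, f x = 0) ∧
      Function.Surjective f ∧ ∀ a, f a = 0 → ∀ C : AddSubmonoid U, (∀ x ∈ s, ∀ u v, u * x * v ∈ C) → a ∈ C := by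
  -- The generators are stable under right multiplication, so the left ideal they span is two-sided.
  let J : Ideal U := Ideal.span {a | ∃ x ∈ s, ∃ v, a = x * v}
  have : J.IsTwoSided := ⟨fun {a} b ha => by
    refine Submodule.span_induction (p := fun a _ => a * b ∈ J) ?_ ?_ ?_ ?_ ha
    · rintro _ ⟨x, hx, v, rfl⟩
      exact Ideal.subset_span ⟨x, hx, v * b, mul_assoc _ _ _⟩
    · rw [zero_mul]
      exact zero_mem J
    · intro x y _ _ hx hy
      rw [add_mul]
      exact add_mem hx hy
    · intro r x _ hx
      rw [smul_eq_mul, mul_assoc]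
      exact J.mul_mem_left r hx⟩
  refine ⟨U ⧸ J, inferInstance, inferInstance, Ideal.Quotient.mk J, fun x hx => ?_,
    Ideal.Quotient.mk_surjective, fun a ha C hC => ?_⟩
  · exact Ideal.Quotient.eq_zero_iff_mem.mpr (Ideal.subset_span ⟨x, hx, 1, (mul_one x).symm⟩)
  · suffices H : ∀ u, u * a ∈ C by simpa using H 1
    refine Submodule.span_induction (p := fun a _ => ∀ u, u * a ∈ C) ?_ ?_ ?_ ?_
      (Ideal.Quotient.eq_zero_iff_mem.mp ha)
    · rintro _ ⟨x, hx, v, rfl⟩ u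
      rw [← mul_assoc]
      exact hC x hx u v
    · intro u
      rw [mul_zero]
      exact zero_mem C
    · intro x y _ _ hx hy u
      rw [mul_add]
      exact add_mem (hx u) (hy u)
    · intro r x _ hx u
      rw [smul_eq_mul, ← mul_assoc]
      exact hx _

/-! ### Saturation of 𝔯 and passage of strong freeness to the reduction. -/

section Reduction

variable {L : MixedLieAlgebra.{u}} {ι : Type v} {deg : ι → ℕ} (ρ : ∀ i, L.carrier (deg i))

/-- The ideal of the reduced algebra generated by the reductions of the `ρ_i`. -/
abbrev reducedSpan : (L.quotient L.piIdeal).MIdeal :=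
  idealSpan (L := L.quotient L.piIdeal) fun i => quotientMk L.piIdeal _ (ρ i)

/-- The enveloping algebra of the reduction of `L / r` is the reduction modulo `π` of the
enveloping algebra of `L / r`. -/
theorem exists_uMix_reduction :
    ∃ q : (L.quotient (idealSpan ρ)).UMix →+* ((L.quotient L.piIdeal).quotient (reducedSpan ρ)).UQuad,
      (∀ n (x : L.carrier n), q ((L.quotient (idealSpan ρ)).uMixOf (quotientMk _ n x)) =
        ((L.quotient L.piIdeal).quotient (reducedSpan ρ)).uQuadOf
          (quotientMk _ n (quotientMk L.piIdeal n x))) ∧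
      q (uMixPi _) = 0 ∧ Function.Surjective q ∧
      ∀ a, q a = 0 → ∃ b, a = uMixPi _ * b := by
  have hqt : ((L.quotient L.piIdeal).quotient (reducedSpan ρ)).IsQuadratic :=
    IsQuadratic.quotient (quotient_piIdeal_isQuadratic L) _
  obtain ⟨q, hq, hqpi⟩ := ((((uQuadRep hqt).comp (quotientHom _)).comp
    (quotientHom L.piIdeal)).descend (idealSpan ρ) (fun n x hx => by
      change (uQuadRep hqt).toFun n (quotientMk _ n (quotientMk L.piIdeal n x)) = 0
      rw [quotientMk_eq_zero.mpr (mem_idealSpan_quotient L.piIdeal ρ hx), map_zero])).exists_uMix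
    Commute.zero_left
  have hq' : ∀ n (x : L.carrier n), q ((L.quotient (idealSpan ρ)).uMixOf (quotientMk _ n x)) =
        ((L.quotient L.piIdeal).quotient (reducedSpan ρ)).uQuadOf
          (quotientMk _ n (quotientMk L.piIdeal n x)) := fun n x => hq n (quotientMk _ n x)
  obtain ⟨B, _, _, mk, hpi, -, hmk⟩ :=
    exists_quotient_by_set (U := (L.quotient (idealSpan ρ)).UMix) {uMixPi _}
  replace hpi := hpi _ (Set.mem_singleton _)
  -- In B = U/πU the elements of πL⁺ and of 𝔯 vanish, so B receives a homomorphism r from Ũ with r∘q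
  -- the quotient map. Hence ker q lies in the two-sided ideal of π, which is πU because π is
  -- central.
  let R₀ : Rep L B 0 := ((uMixRep (L.quotient (idealSpan ρ))).comp (quotientHom _)).map mk hpi
  let R₁ := R₀.descend L.piIdeal (fun k x hx => by
    rcases mem_piIdeal hx with rfl | ⟨n, h, hn, x, rfl⟩
    · exact map_zero _
    · rw [R₀.map_P h (by omega), zero_mul])
  let R₂ := R₁.descend (reducedSpan ρ) (fun n z hz => by
    obtain ⟨y, hy, rfl⟩ := exists_mem_idealSpan L.piIdeal ρ hz
    change mk ((uMixRep _).toFun n (quotientMk _ n y)) = 0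
    rw [quotientMk_eq_zero.mpr hy, map_zero, map_zero])
  obtain ⟨r, hr⟩ := R₂.exists_uQuad
  have hrq : ∀ a, r (q a) = mk a := uMix_hom_ext (f := r.comp q)
    (g := mk) (fun n x => by
      obtain ⟨x, rfl⟩ := quotientMk_surjective _ n x
      change r (q _) = _
      rw [hq', hr]
      rfl) (by
      change r (q _) = _
      rw [hqpi, map_zero, hpi])
  refine ⟨q, hq', hqpi, fun b => ?_, fun a ha => ?_⟩
  · refine uQuad_mem q.rangeS (fun n x => ?_) b
    obtain ⟨x, rfl⟩ := quotientMk_surjective _ n x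
    obtain ⟨x, rfl⟩ := quotientMk_surjective _ n x
    exact ⟨_, hq' n x⟩
  · have h0 : mk a = 0 := by rw [← hrq, ha, map_zero]
    obtain ⟨c, rfl⟩ := hmk a h0 (AddMonoidHom.mrange (AddMonoidHom.mulLeft (uMixPi _)))
      (fun x hx c d => ⟨c * d, by
        rw [Set.mem_singleton_iff.mp hx, ← (uMixPi_commute c).eq, AddMonoidHom.coe_mulLeft,
          mul_assoc]⟩)
    exact ⟨c, rfl⟩

/-- If x dies in U it dies in Ũ, so by `uQuadOf_injective` x = y + Pz or x = y with y in 𝔯. In the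
first case πz = 0 in U, so z dies there by absence of torsion, and z has smaller degree. -/
theorem mem_of_uMixOf_eq_zero (hfin : ∀ n, Finite (L.carrier n))
    (htf : ∀ a : (L.quotient (idealSpan ρ)).UMix, uMixPi _ * a = 0 → a = 0) {n : ℕ} (hn : 1 < n)
    (x : L.carrier n) (hx : (L.quotient (idealSpan ρ)).uMixOf (quotientMk _ n x) = 0) :
    x ∈ (idealSpan ρ).part n := by
  obtain ⟨q, hq, -⟩ := exists_uMix_reduction ρ
  have hqt : ((L.quotient L.piIdeal).quotient (reducedSpan ρ)).IsQuadratic :=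
    IsQuadratic.quotient (quotient_piIdeal_isQuadratic L) _
  induction n using Nat.strong_induction_on with
  | _ n ih =>
  have h0 : quotientMk (reducedSpan ρ) n (quotientMk L.piIdeal n x) = 0 := by
    refine uQuadOf_injective hqt (fun n => ?_) hn _ ?_
    · have : Finite ((L.quotient L.piIdeal).carrier n) := quotient_finite _
      exact quotient_finite _
    · rw [← hq, hx, map_zero]
  obtain ⟨y, hy, hyx⟩ := exists_mem_idealSpan L.piIdeal ρ (quotientMk_eq_zero.mp h0)
  have hd : x - y ∈ L.piIdeal.part n := (Submodule.Quotient.eq _).mp hyx.symm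
  rcases mem_piIdeal hd with h1 | ⟨k, hk, hk1, z, hz⟩
  · rwa [sub_eq_zero.mp h1]
  · have hxy : x = y + L.P hk z := by rw [← hz]; abel
    rw [hxy]
    refine add_mem hy ((idealSpan ρ).P_mem hk (ih k (by omega) hk1 z (htf _ ?_)))
    have e1 := (uMixRep (L.quotient (idealSpan ρ))).map_P hk (by omega : k ≠ 1)
      (quotientMk _ k z)
    rw [uMixRep_apply, uMixRep_apply] at e1
    rw [← e1, quotientMk_P, ← hx, hxy, map_add, quotientMk_eq_zero.mpr hy, zero_add]

/-- Saturation: Px in 𝔯 gives πx = 0 in U, so x dies in U and therefore lies in 𝔯. -/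
theorem mem_of_P_mem (hfin : ∀ n, Finite (L.carrier n))
    (htf : ∀ a : (L.quotient (idealSpan ρ)).UMix, uMixPi _ * a = 0 → a = 0) {n k : ℕ}
    (h : n + 1 = k) (x : L.carrier n) (hn : 1 < n) (hx : L.P h x ∈ (idealSpan ρ).part k) :
    x ∈ (idealSpan ρ).part n := by
  refine mem_of_uMixOf_eq_zero ρ hfin htf hn x (htf _ ?_)
  have e1 := (uMixRep (L.quotient (idealSpan ρ))).map_P h (by omega : n ≠ 1) (quotientMk _ n x)
  rw [uMixRep_apply, uMixRep_apply, quotientMk_P, quotientMk_eq_zero.mpr hx] at e1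
  rw [← e1]
  exact map_zero ((uMixRep (L.quotient (idealSpan ρ))).toFun k)

theorem reducedSpan_part_one (hdeg : ∀ i, 1 < deg i) : (reducedSpan ρ).part 1 = ⊥ :=
  idealSpan_part_one _ hdeg

/-- The semilinear map M → M̃ over U → Ũ has kernel πM, and ker(U → Ũ) = πU, so the basis of M
descends to M̃. Spanning holds for any family generating the ideal; only independence uses the
hypothesis. -/
theorem quadStronglyFree_of_stronglyFree [Fintype ι] (hfin : ∀ n, Finite (L.carrier n))
    (hdeg : ∀ i, 1 < deg i) (hρ : StronglyFree hdeg ρ) :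
    QuadStronglyFree (quotient_piIdeal_isQuadratic L) (fun i => quotientMk L.piIdeal _ (ρ i)) := by
  obtain ⟨htor, b, hb⟩ := hρ
  have hI := idealSpan_part_one ρ hdeg
  have htf : ∀ a : (L.quotient (idealSpan ρ)).UMix, uMixPi _ * a = 0 → a = 0 := fun a ha => by
    rw [← X_smul_eq] at ha
    exact (smul_eq_zero_iff_right Polynomial.X_ne_zero).mp ha
  obtain ⟨q, hq, hqpi, hqs, hqk⟩ := exists_uMix_reduction ρ
  obtain ⟨Ψ, hΨ, -⟩ := exists_abel_quotient L.piIdeal ρ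
  have hΨad : ∀ {n} (x : L.carrier n) z, Ψ (adEnd (idealSpan ρ) x z) =
      adEnd (reducedSpan ρ) (quotientMk L.piIdeal n x) (Ψ z) := fun {n} x z => by
    refine abel_induction (LinearMap.eqLocus (Ψ ∘ₗ adEnd (idealSpan ρ) x)
      (adEnd (reducedSpan ρ) (quotientMk L.piIdeal n x) ∘ₗ Ψ)) (fun k y hy => ?_) z
    rw [LinearMap.mem_eqLocus, LinearMap.comp_apply, LinearMap.comp_apply, adEnd_mk _ rfl, hΨ, hΨ,
      adEnd_mk _ rfl]
    rfl
  have hΨpi : ∀ z, Ψ (piEnd (idealSpan ρ) z) = 0 := fun z => by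
    refine abel_induction (LinearMap.ker (Ψ ∘ₗ piEnd (idealSpan ρ))) (fun k y hy => ?_) z
    rw [LinearMap.mem_ker, LinearMap.comp_apply]
    by_cases hk : k = 1
    · subst hk
      have hy0 : y = 0 := by
        rw [hI, Submodule.mem_bot] at hy
        exact hy
      subst hy0
      have : abelMk (idealSpan ρ) ⟨(0 : L.carrier 1), hy⟩ = 0 := map_zero (abelMk _)
      rw [this, map_zero, map_zero]
    · rw [piEnd_mk _ rfl hk, hΨ, abelMk_congr _ (quotientMk_eq_zero.mpr (P_mem_piIdeal rfl hk y))]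
      exact map_zero (abelMk _)
  let F : Abel (idealSpan ρ) →+ AbelQuad (reducedSpan ρ) (quotient_piIdeal_isQuadratic L) :=
    (abelQuadEquiv (quotient_piIdeal_isQuadratic L)).toAddMonoidHom.comp Ψ.toAddMonoidHom
  have hF : ∀ z, F z = abelQuadEquiv (quotient_piIdeal_isQuadratic L) (Ψ z) := fun z => rfl
  have hsl := abelMix_semilinear hI q F
    (fun x z => by rw [hF, hF, hΨad, hq, uQuadOf_smul_equiv])
    (fun z => by rw [hF, hΨpi, hqpi, zero_smul, map_zero])
  have hFρ : ∀ i, F ((abelMixEquiv hI).symm (b i)) =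
      abelQuadMk (reducedSpan ρ) (quotient_piIdeal_isQuadratic L)
        ⟨quotientMk L.piIdeal _ (ρ i), mem_idealSpan (L := L.quotient L.piIdeal) _ i⟩ := fun i => by
    rw [hb i]
    exact hΨ _ (ρ i) (mem_idealSpan ρ i)
  have hli : LinearIndependent ((L.quotient L.piIdeal).quotient (reducedSpan ρ)).UQuad
      (fun i => abelQuadMk (reducedSpan ρ) (quotient_piIdeal_isQuadratic L)
        ⟨quotientMk L.piIdeal _ (ρ i), mem_idealSpan (L := L.quotient L.piIdeal) _ i⟩) := by
    refine Fintype.linearIndependent_iff.mpr fun c hc => ?_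
    choose a ha using fun i => hqs (c i)
    have h0 : F ((abelMixEquiv hI).symm (∑ i, a i • b i)) = 0 := by
      rw [map_sum, map_sum, ← hc]
      refine Finset.sum_congr rfl fun i _ => ?_
      rw [hsl, hFρ, ha]
    -- The lifted combination Σ a_i ρ_i dies in M̃, so it equals πz'. Comparing coordinates in the
    -- basis b shows that each a_i is divisible by π, so its image c_i in Ũ is zero.
    obtain ⟨z', hz'⟩ := exists_piEnd_eq ρ (fun h x hn hx => mem_of_P_mem ρ hfin htf h x hn hx) Ψ hΨ
      _ ((abelQuadEquiv (quotient_piIdeal_isQuadratic L)).map_eq_zero_iff.mp h0)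
    have h1 : ∑ i, a i • b i = uMixPi (L.quotient (idealSpan ρ)) • abelMixEquiv hI z' := by
      rw [uMixPi_smul_equiv, hz', AddEquiv.apply_symm_apply]
    intro i
    have h2 : a i = uMixPi (L.quotient (idealSpan ρ)) * b.repr (abelMixEquiv hI z') i := by
      have := congrFun (b.repr_sum_self a) i
      rw [h1, map_smul] at this
      exact this.symm
    rw [← ha, h2, map_mul, hqpi, zero_mul]
  refine ⟨Module.Basis.mk hli (abelQuad_span (quotient_piIdeal_isQuadratic L) _
    (reducedSpan_part_one ρ hdeg)).ge, fun i => ?_⟩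
  exact Module.Basis.mk_apply _ _ i

end Reduction

/-! ### Enveloping algebras of quotients -/

/-- The quotient of U(L) by the two-sided ideal of I carries a representation of L/I, hence a
homomorphism from U(L/I); so the kernel of p is contained in that ideal. The clause on C is
induction over this kernel. -/
theorem exists_uMix_quotient {L : MixedLieAlgebra.{u}} (I : L.MIdeal) :
    ∃ p : L.UMix →+* (L.quotient I).UMix,
      (∀ n (x : L.carrier n), p (L.uMixOf x) = (L.quotient I).uMixOf (quotientMk I n x)) ∧
      p (uMixPi _) = uMixPi _ ∧ Function.Surjective p ∧
      ∀ a, p a = 0 → ∀ C : AddSubmonoid L.UMix,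
        (∀ n (x : L.carrier n), x ∈ I.part n → ∀ u v, u * L.uMixOf x * v ∈ C) → a ∈ C := by
  obtain ⟨p, hp, hpi⟩ := (quotientHom I).exists_uMix
  obtain ⟨B, _, _, mk, h0, hs, hmk⟩ := exists_quotient_by_set (U := L.UMix)
    {a | ∃ n, ∃ x : L.carrier n, x ∈ I.part n ∧ a = L.uMixOf x}
  obtain ⟨r, hr, hrpi⟩ := (((uMixRep L).map mk rfl).descend I (fun n x hx =>
    h0 _ ⟨n, x, hx, rfl⟩)).exists_uMix (fun b => by
      obtain ⟨b, rfl⟩ := hs b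
      exact (uMixPi_commute b).map mk)
  have hrp : ∀ a, r (p a) = mk a := uMix_hom_ext (f := r.comp p) (g := mk) (fun n x => by
    change r (p _) = _
    rw [hp]
    exact hr n (quotientMk I n x)) (by
    change r (p _) = _
    rw [hpi, hrpi])
  refine ⟨p, hp, hpi, fun b => ?_, fun a ha C hC => hmk a ?_ C ?_⟩
  · refine uMix_mem p.rangeS (fun n x => ?_) ⟨_, hpi⟩ b
    obtain ⟨x, rfl⟩ := quotientMk_surjective _ n x
    exact ⟨_, hp n x⟩
  · rw [← hrp, ha, map_zero]
  · rintro _ ⟨n, x, hx, rfl⟩ u v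
    exact hC n x hx u v

theorem exists_uQuad_quotient {L : MixedLieAlgebra.{u}} (hq : L.IsQuadratic) (I : L.MIdeal) :
    ∃ p : L.UQuad →+* (L.quotient I).UQuad,
      (∀ n (x : L.carrier n), p (L.uQuadOf x) = (L.quotient I).uQuadOf (quotientMk I n x)) ∧
      Function.Surjective p ∧
      ∀ a, p a = 0 → ∀ C : AddSubmonoid L.UQuad,
        (∀ n (x : L.carrier n), x ∈ I.part n → ∀ u v, u * L.uQuadOf x * v ∈ C) → a ∈ C := by
  obtain ⟨p, hp⟩ := (quotientHom I).exists_uQuad (hq.quotient I)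
  obtain ⟨B, _, _, mk, h0, -, hmk⟩ := exists_quotient_by_set (U := L.UQuad)
    {a | ∃ n, ∃ x : L.carrier n, x ∈ I.part n ∧ a = L.uQuadOf x}
  obtain ⟨r, hr⟩ := (((uQuadRep hq).map mk (map_zero mk)).descend I (fun n x hx =>
    h0 _ ⟨n, x, hx, rfl⟩)).exists_uQuad
  have hrp : ∀ a, r (p a) = mk a := uQuad_hom_ext (f := r.comp p) (g := mk) (fun n x => by
    change r (p _) = _
    rw [hp]
    exact hr n (quotientMk I n x))
  refine ⟨p, hp, fun b => ?_, fun a ha C hC => hmk a ?_ C ?_⟩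
  · refine uQuad_mem p.rangeS (fun n x => ?_) b
    obtain ⟨x, rfl⟩ := quotientMk_surjective _ n x
    exact ⟨_, hp n x⟩
  · rw [← hrp, ha, map_zero]
  · rintro _ ⟨n, x, hx, rfl⟩ u v
    exact hC n x hx u v

/-! ### Relations in the enveloping algebra that descend to 𝔯/[𝔯,𝔯]. -/

section QuadRelation

variable {L : MixedLieAlgebra.{u}} (hq : L.IsQuadratic) (I : L.MIdeal)

theorem mul_swap_mul {R : Type v} [Ring R] (u x y w : R) :
    u * x * y * w = u * y * (x * w) + u * (x * y - y * x) * w := by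
  noncomm_ring

/-- Moving y to the left past a generator x gives uxyw = uy(xw) + u[x,y]w. The first term
contributes zero since ε(xw) = 0, and the second turns x into its adjoint action on the class of y.
-/
theorem functional_mul {n : ℕ} (g : L.UQuad →+ abelPart I n)
    (hg : ∀ (i : ℕ) (x : L.carrier i) (hx : x ∈ I.part i) u, g (L.uQuadOf x * u) =
      L.uQuadAug u • DirectSum.component (ZMod 2) ℕ _ n (abelMk I ⟨x, hx⟩))
    (p : L.UQuad →+* (L.quotient I).UQuad)
    (hp : ∀ n (x : L.carrier n), p (L.uQuadOf x) = (L.quotient I).uQuadOf (quotientMk I n x))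
    (u : L.UQuad) {k : ℕ} (y : L.carrier k) (hy : y ∈ I.part k) (w : L.UQuad) :
    g (u * L.uQuadOf y * w) = L.uQuadAug w • DirectSum.component (ZMod 2) ℕ _ n
      ((abelQuadEquiv hq).symm (p u • abelQuadEquiv hq (abelMk I ⟨y, hy⟩))) := by
  let C : L.UQuad → Prop := fun u => ∀ k (y : L.carrier k) (hy : y ∈ I.part k) w,
    g (u * L.uQuadOf y * w) = L.uQuadAug w • DirectSum.component (ZMod 2) ℕ _ n
      ((abelQuadEquiv hq).symm (p u • abelQuadEquiv hq (abelMk I ⟨y, hy⟩)))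
  have h1 : C 1 := fun k y hy w => by
    rw [one_mul, map_one, one_smul, AddEquiv.symm_apply_apply, hg]
  -- The induction adds factors at the right end of u, next to y; quantifying over every u with the
  -- property makes the set closed under products.
  let S : Subsemiring L.UQuad :=
    { carrier := {s | ∀ u, C u → C (u * s)}
      mul_mem' := fun {a b} ha hb u hu => by
        rw [← mul_assoc]
        exact hb _ (ha _ hu)
      one_mem' := fun u hu => by rwa [mul_one]
      add_mem' := fun {a b} ha hb u hu k y hy w => by
        rw [mul_add, add_mul, add_mul, map_add, ha u hu, hb u hu, map_add, add_smul, map_add,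
          map_add, smul_add]
      zero_mem' := fun u hu k y hy w => by
        rw [mul_zero, zero_mul, zero_mul, map_zero, map_zero, zero_smul, map_zero, map_zero,
          smul_zero] }
  have hS : u ∈ S := uQuad_mem S (fun i x u hu k y hy w => by
    have e : L.uQuadOf (L.br rfl x y) = L.uQuadOf x * L.uQuadOf y - L.uQuadOf y * L.uQuadOf x :=
      (uQuadRep hq).map_br rfl x y
    rw [mul_swap_mul, ← e, map_add, hu k y hy, hu _ _ (I.br_mem rfl x hy), map_mul, uQuadAug_of, zero_mul,
      zero_smul, zero_add, map_mul, mul_smul, hp, uQuadOf_smul_equiv, adEnd_mk I rfl x y hy]) u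
  have := hS 1 h1
  rw [one_mul] at this
  exact this k y hy w

/-- Each s_i lies in the two-sided ideal of I and each x_i has augmentation zero, so g(s_i x_i) = 0
by `functional_mul`. On the other side g yields the degree-n component of the desired sum. -/
theorem sum_smul_abelQuadMk_eq_zero (hfin : ∀ n, Finite (L.carrier n)) (hI1 : I.part 1 = ⊥)
    (p : L.UQuad →+* (L.quotient I).UQuad)
    (hp : ∀ n (x : L.carrier n), p (L.uQuadOf x) = (L.quotient I).uQuadOf (quotientMk I n x))
    (hker : ∀ a, p a = 0 → ∀ C : AddSubmonoid L.UQuad,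
        (∀ n (x : L.carrier n), x ∈ I.part n → ∀ u v, u * L.uQuadOf x * v ∈ C) → a ∈ C)
    {ι : Type*} [Fintype ι] {deg : ι → ℕ} (y : ∀ j, L.carrier (deg j)) (hy : ∀ j, y j ∈ I.part _)
    (v : ι → L.UQuad) {κ : Type*} [Fintype κ] {wt : κ → ℕ} (x : ∀ i, L.carrier (wt i))
    (s : κ → L.UQuad) (hs : ∀ i, p (s i) = 0)
    (h : ∑ j, v j * L.uQuadOf (y j) = ∑ i, s i * L.uQuadOf (x i)) :
    ∑ j, p (v j) • abelQuadMk I hq ⟨y j, hy j⟩ = 0 := by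
  refine (abelQuadEquiv hq).symm.map_eq_zero_iff.mp (DirectSum.ext_component (ZMod 2) fun n => ?_)
  obtain ⟨g, hg⟩ := exists_abel_functional hq hfin I hI1 n
  have h1 : ∀ i, g (s i * L.uQuadOf (x i)) = 0 := fun i => by
    refine hker (s i) (hs i) (AddMonoidHom.mker (g.comp (AddMonoidHom.mulRight (L.uQuadOf (x i)))))
      (fun k z hz u v => ?_)
    change g (u * L.uQuadOf z * v * L.uQuadOf (x i)) = 0
    rw [mul_assoc, functional_mul hq I g hg p hp u z hz, map_mul, uQuadAug_of, mul_zero, zero_smul]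
  have h2 : g (∑ i, s i * L.uQuadOf (x i)) = 0 := by
    rw [map_sum]
    exact Finset.sum_eq_zero fun i _ => h1 i
  rw [← h, map_sum] at h2
  rw [map_sum, map_sum, map_zero, ← h2]
  refine Finset.sum_congr rfl fun j _ => ?_
  have := functional_mul hq I g hg p hp (v j) (y j) (hy j) 1
  rw [mul_one, map_one, one_smul] at this
  exact this.symm

end QuadRelation

/-! ### The augmentation and the grading of `U_mix(L)` -/

/-- The augmentation of `U_mix(L)`. -/
noncomputable def uMixAug (L : MixedLieAlgebra.{u}) : L.UMix →ₐ[(ZMod 2)[X]] (ZMod 2)[X] :=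
  uMixLift (fun _ => 0) (by simp) (by simp) (by simp)

theorem uMixAug_of {L : MixedLieAlgebra.{u}} {n : ℕ} (x : L.carrier n) :
    L.uMixAug (L.uMixOf x) = 0 := uMixLift_of _ _ _ _ x

theorem uMixAug_pi (L : MixedLieAlgebra.{u}) : L.uMixAug (uMixPi L) = Polynomial.X :=
  L.uMixAug.commutes _

theorem map_algebraMap_uMix {L : MixedLieAlgebra.{u}} {L' : MixedLieAlgebra.{v}}
    (p : L.UMix →+* L'.UMix) (hp : p (uMixPi L) = uMixPi L') (r : (ZMod 2)[X]) :
    p (algebraMap _ _ r) = algebraMap _ _ r :=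
  subsemiring_polynomial_eq_top (RingHom.eqLocusS (p.comp (algebraMap _ _)) (algebraMap _ _)) hp r

theorem coeff_mul_monomial_ite {R : Type v} [Ring R] (p : Polynomial R) (n k : ℕ) (r : R) :
    (p * Polynomial.monomial n r).coeff k = if n ≤ k then p.coeff (k - n) * r else 0 := by
  rw [← Polynomial.C_mul_X_pow_eq_monomial, ← mul_assoc, Polynomial.coeff_mul_X_pow',
    Polynomial.coeff_mul_C]

/-- The relations of U are homogeneous with π in degree 1, so x ↦ x tⁿ (x of degree n) and π ↦ πt
define a homomorphism to B[t]. Its coefficients are the homogeneous components, and setting t = 1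
recovers f. -/
theorem Rep.exists_coeff {L : MixedLieAlgebra.{u}} {B : Type v} [Ring B] [Algebra (ZMod 2) B] {z : B}
    (R : Rep L B z) (hz : ∀ b, Commute z b) (f : L.UMix →+* B)
    (hf : ∀ n (x : L.carrier n), f (L.uMixOf x) = R.toFun n x) (hfpi : f (uMixPi L) = z) :
    ∃ c : ℕ → L.UMix →+ B,
      (∀ k n a (x : L.carrier n), c k (a * L.uMixOf x) =
        if n ≤ k then c (k - n) a * f (L.uMixOf x) else 0) ∧
      (∀ k n a, c k (a * uMixPi L ^ n) =
        if n ≤ k then c (k - n) a * f (uMixPi L) ^ n else 0) ∧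
      ∀ a, (∀ k, c k a = 0) → f a = 0 := by
  let R' : Rep L (Polynomial B) (Polynomial.monomial 1 z) :=
    { toFun := fun n => (Polynomial.monomial n).toAddMonoidHom.comp (R.toFun n)
      map_br := fun {m n k} h x y => by
        subst h
        change Polynomial.monomial _ (R.toFun _ _) =
          Polynomial.monomial _ (R.toFun _ _) * Polynomial.monomial _ (R.toFun _ _) -
          Polynomial.monomial _ (R.toFun _ _) * Polynomial.monomial _ (R.toFun _ _)
        rw [R.map_br, Polynomial.monomial_mul_monomial, Polynomial.monomial_mul_monomial,
          add_comm n m, map_sub]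
      map_P_one := fun {k} h x => by
        subst h
        change Polynomial.monomial _ (R.toFun _ _) = _ * Polynomial.monomial _ (R.toFun _ _) +
          Polynomial.monomial _ (R.toFun _ _) * Polynomial.monomial _ (R.toFun _ _)
        rw [R.map_P_one, Polynomial.monomial_mul_monomial, Polynomial.monomial_mul_monomial,
          map_add]
      map_P := fun {n k} h hn x => by
        subst h
        change Polynomial.monomial _ (R.toFun _ _) = _ * Polynomial.monomial _ (R.toFun _ _)
        rw [R.map_P _ hn, Polynomial.monomial_mul_monomial, add_comm 1 n] }
  have hc : ∀ b : Polynomial B, Commute (Polynomial.monomial 1 z) b := fun b => by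
    induction b using Polynomial.induction_on' with
    | add p q hp hq => exact hp.add_right hq
    | monomial n a =>
      change _ * _ = _ * _
      rw [Polynomial.monomial_mul_monomial, Polynomial.monomial_mul_monomial, add_comm n 1,
        (hz a).eq]
  obtain ⟨γ, hγ, hγpi⟩ := R'.exists_uMix hc
  replace hγ : ∀ n (x : L.carrier n), γ (L.uMixOf x) = Polynomial.monomial n (f (L.uMixOf x)) :=
    fun n x => by rw [hγ, hf]; rfl
  let ev : Polynomial B →+* B :=
    Polynomial.eval₂RingHom' (RingHom.id _) 1 fun a => Commute.one_right a
  have hev : ∀ n (a : B), ev (Polynomial.monomial n a) = a := fun n a => by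
    change Polynomial.eval₂ _ _ _ = _
    rw [Polynomial.eval₂_monomial, one_pow, mul_one, RingHom.id_apply]
  have hinv : ∀ a, ev (γ a) = f a := uMix_hom_ext (f := ev.comp γ) (g := f)
    (fun n x => (congrArg ev (hγ n x)).trans (hev _ _))
    ((congrArg ev hγpi).trans ((hev _ _).trans hfpi.symm))
  refine ⟨fun k => AddMonoidHom.mk' (fun a => (γ a).coeff k) fun a b => by
    rw [map_add, Polynomial.coeff_add], fun k n a x => ?_, fun k n a => ?_, fun a ha => ?_⟩
  · change (γ _).coeff k = _
    rw [map_mul, hγ, coeff_mul_monomial_ite]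
    rfl
  · change (γ _).coeff k = _
    rw [map_mul, map_pow, hγpi, Polynomial.monomial_pow, coeff_mul_monomial_ite, one_mul, hfpi]
    rfl
  · have : γ a = 0 := Polynomial.ext ha
    rw [← hinv, this, map_zero]

/-- Homogeneous components in `U_mix(L)`. -/
theorem exists_uMix_coeff (L : MixedLieAlgebra.{u}) :
    ∃ c : ℕ → L.UMix →+ L.UMix,
      (∀ k n a (x : L.carrier n), c k (a * L.uMixOf x) =
        if n ≤ k then c (k - n) a * L.uMixOf x else 0) ∧
      (∀ k n a, c k (a * uMixPi L ^ n) = if n ≤ k then c (k - n) a * uMixPi L ^ n else 0) ∧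
      ∀ a, (∀ k, c k a = 0) → a = 0 :=
  (uMixRep L).exists_coeff uMixPi_commute (RingHom.id _) (fun _ _ => rfl) rfl

/-- A multiple of π^(k+1) has no component in degree k, so the π-adic topology on U is separated. -/
theorem eq_zero_of_forall_eq_pow_mul {L : MixedLieAlgebra.{u}} {a : L.UMix}
    (h : ∀ n, ∃ b, a = uMixPi L ^ n * b) : a = 0 := by
  obtain ⟨c, -, hpi, hinj⟩ := exists_uMix_coeff L
  refine hinj a fun k => ?_
  obtain ⟨b, rfl⟩ := h (k + 1)
  have hc : Commute (uMixPi L ^ (k + 1)) b := (uMixPi_commute b).pow_left _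
  rw [hc.eq, hpi, if_neg (by omega)]

/-- A subset each of whose elements is a combination of fixed homogeneous elements of positive
degree with coefficients in the subset is zero. -/
theorem eq_zero_of_forall_eq_sum {L : MixedLieAlgebra.{u}} {κ : Type*} [Fintype κ] {wt : κ → ℕ}
    (hwt : ∀ i, 0 < wt i) (x : ∀ i, L.carrier (wt i)) (T : Set L.UMix)
    (hT : ∀ a ∈ T, ∃ c : κ → L.UMix, (∀ i, c i ∈ T) ∧ a = ∑ i, c i * L.uMixOf (x i)) {a : L.UMix}
    (ha : a ∈ T) : a = 0 := by
  obtain ⟨γ, hof, -, hinj⟩ := exists_uMix_coeff L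
  refine hinj a fun k => ?_
  induction k using Nat.strong_induction_on generalizing a with
  | _ k ih =>
  obtain ⟨c, hc, rfl⟩ := hT a ha
  rw [map_sum]
  refine Finset.sum_eq_zero fun i _ => ?_
  rw [hof]
  split_ifs with h
  · rw [ih _ (by have := hwt i; omega) (hc i), zero_mul]
  · rfl

/-- Torsion-freeness over 𝔽₂[π] follows from that for π alone plus separatedness: factors of X are
cancelled until the constant term of p is 1. -/
theorem smul_eq_zero_of_X {M : Type v} [AddCommGroup M] [Module (ZMod 2)[X] M]
    (h : ∀ m : M, (Polynomial.X : (ZMod 2)[X]) • m = 0 → m = 0)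
    (hsep : ∀ m : M, (∀ n, ∃ m', m = (Polynomial.X : (ZMod 2)[X]) ^ n • m') → m = 0)
    {p : (ZMod 2)[X]} {m : M} (hpm : p • m = 0) : p = 0 ∨ m = 0 := by
  refine or_iff_not_imp_left.mpr fun hp => ?_
  induction hn : p.natDegree using Nat.strong_induction_on generalizing p with
  | _ n ih =>
  have hdiv := Polynomial.X_mul_divX_add p
  by_cases h0 : p.coeff 0 = 0
  · rw [h0, map_zero, add_zero] at hdiv
    have hd : p.divX ≠ 0 := fun h => hp (by rw [← hdiv, h, mul_zero])
    refine ih _ ?_ (h _ (by rw [smul_smul, hdiv, hpm])) hd rfl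
    rw [← hn, Polynomial.natDegree_divX_eq_natDegree_tsub_one]
    have : p.natDegree ≠ 0 := fun h => by
      rw [Polynomial.eq_C_of_natDegree_eq_zero h, h0, map_zero] at hp
      exact hp rfl
    omega
  · have h1 : p.coeff 0 = 1 := by
      have : ∀ c : ZMod 2, c ≠ 0 → c = 1 := by decide
      exact this _ h0
    rw [h1, map_one] at hdiv
    -- Here p = 1 + Xs with s = `p.divX`, so pm = 0 reads m = (Xs)m. Iterating, m is divisible by
    -- every power of X.
    have hm : m = (Polynomial.X * p.divX) • m := by
      rw [← hdiv, add_smul, one_smul] at hpm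
      rw [eq_comm, ← sub_eq_zero, sub_eq_add_neg]
      have h2 : -m = m := by
        rw [neg_eq_iff_add_eq_zero, ← two_smul (ZMod 2)[X] m,
          show (2 : (ZMod 2)[X]) = 0 from CharP.cast_eq_zero (ZMod 2)[X] 2, zero_smul]
      rw [h2]
      exact hpm
    have hk : ∀ k : ℕ, m = (Polynomial.X * p.divX) ^ k • m := fun k => by
      induction k with
      | zero => rw [pow_zero, one_smul]
      | succ k ihk =>
        rw [pow_succ, mul_smul, ← hm]
        exact ihk
    refine hsep m fun k => ⟨p.divX ^ k • m, ?_⟩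
    rw [smul_smul, ← mul_pow]
    exact hk k

/-! ### Fox derivatives -/

section Fox

variable {X : Type u} (w : X → ℕ+)

/-- D is the upper right entry of a homomorphism to triangular matrices with rows (a, D(a)) and (0,
ε(a)). By freeness the entries b may be prescribed on generators, and π goes to a scalar matrix, so
D(π) = 0. -/
theorem exists_foxDerivative_of (b : X → (free w).UMix) :
    ∃ D : (free w).UMix →+ (free w).UMix,
      (∀ a c, D (a * c) = a * D c + D a * algebraMap _ _ ((free w).uMixAug c)) ∧
      D (uMixPi _) = 0 ∧ ∀ x, D ((free w).uMixOf (freeOf w x)) = b x := by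
  obtain ⟨R, hR⟩ := exists_freeRep w (B := Matrix (Fin 2) (Fin 2) (free w).UMix)
    (Matrix.scalar (Fin 2) (uMixPi (free w)))
    (fun M => Matrix.scalar_commute _ (fun c => uMixPi_commute c) M)
    (fun x => !![(free w).uMixOf (freeOf w x), b x; 0, 0])
  obtain ⟨f, hf, hpi⟩ := R.exists_uMix
    (fun M => Matrix.scalar_commute _ (fun c => uMixPi_commute c) M)
  let S : Subsemiring (free w).UMix :=
    { carrier := {a | f a 0 0 = a ∧ f a 1 0 = 0 ∧ f a 1 1 = algebraMap _ _ ((free w).uMixAug a)}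
      mul_mem' := fun {a b} ha hb => by
        refine ⟨?_, ?_, ?_⟩
        · rw [map_mul, Matrix.mul_apply, Fin.sum_univ_two, ha.1, hb.1, hb.2.1, mul_zero, add_zero]
        · rw [map_mul, Matrix.mul_apply, Fin.sum_univ_two, ha.2.1, hb.2.1, mul_zero, zero_mul,
            add_zero]
        · rw [map_mul, Matrix.mul_apply, Fin.sum_univ_two, ha.2.1, ha.2.2, hb.2.2, zero_mul,
            zero_add, map_mul, map_mul]
      one_mem' := ⟨by rw [map_one]; rfl, by rw [map_one]; rfl, by
        rw [map_one, map_one, map_one]; rfl⟩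
      add_mem' := fun {a b} ha hb => by
        refine ⟨?_, ?_, ?_⟩
        · rw [map_add, Matrix.add_apply, ha.1, hb.1]
        · rw [map_add, Matrix.add_apply, ha.2.1, hb.2.1, add_zero]
        · rw [map_add, Matrix.add_apply, ha.2.2, hb.2.2, map_add, map_add]
      zero_mem' := ⟨by rw [map_zero]; rfl, by rw [map_zero]; rfl, by
        rw [map_zero, map_zero, map_zero]; rfl⟩ }
  have hpiS : uMixPi _ ∈ S := by
    refine ⟨?_, ?_, ?_⟩
    · rw [hpi, Matrix.scalar_apply, Matrix.diagonal_apply_eq]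
    · rw [hpi, Matrix.scalar_apply, Matrix.diagonal_apply_ne _ (by decide)]
    · rw [hpi, Matrix.scalar_apply, Matrix.diagonal_apply_eq, uMixAug_pi]
      rfl
  have hfof : ∀ x, f ((free w).uMixOf (freeOf w x)) =
      !![(free w).uMixOf (freeOf w x), b x; 0, 0] := fun x => (hf _ _).trans (hR x)
  have hS : ∀ a, a ∈ S := uMix_mem S (fun n x => (uMixRep (free w)).free_mem S hpiS (fun x => by
    refine ⟨?_, ?_, ?_⟩
    · rw [uMixRep_apply, hfof]; rfl
    · rw [uMixRep_apply, hfof]; rfl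
    · rw [uMixRep_apply, hfof, uMixAug_of, map_zero]; rfl) x) hpiS
  refine ⟨AddMonoidHom.mk' (fun a => f a 0 1) fun a c => ?_, fun a c => ?_, ?_, fun x => ?_⟩
  · change f (a + c) 0 1 = _
    rw [map_add, Matrix.add_apply]
  · change f (a * c) 0 1 = a * f c 0 1 + f a 0 1 * _
    rw [map_mul, Matrix.mul_apply, Fin.sum_univ_two, (hS a).1, (hS c).2.2]
  · change f _ 0 1 = 0
    rw [hpi, Matrix.scalar_apply, Matrix.diagonal_apply_ne _ (by decide)]
  · change f _ 0 1 = b x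
    rw [hfof]
    rfl

theorem mul_fox_expansion {R : Type v} [Ring R] {ι : Type*} (s : Finset ι) {a c e f : R}
    {x d d' : ι → R} (hf : ∀ b, Commute f b) (ha : a = e + ∑ i ∈ s, d i * x i)
    (hc : c = f + ∑ i ∈ s, d' i * x i) :
    a * c = e * f + ∑ i ∈ s, (a * d' i + d i * f) * x i := by
  have h1 : ∑ i ∈ s, (a * d' i + d i * f) * x i =
      a * (∑ i ∈ s, d' i * x i) + (∑ i ∈ s, d i * x i) * f := by
    rw [Finset.mul_sum, Finset.sum_mul, ← Finset.sum_add_distrib]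
    refine Finset.sum_congr rfl fun i _ => ?_
    rw [add_mul, mul_assoc, mul_assoc, mul_assoc, (hf (x i)).eq]
  have h2 : ∑ i ∈ s, d i * x i = a - e := by rw [ha]; abel
  have h3 : ∑ i ∈ s, d' i * x i = c - f := by rw [hc]; abel
  rw [h1, h2, h3]
  noncomm_ring

theorem eq_zero_of_eq_add_self {R : Type v} [Ring R] {a : R} (h : a = a + a) : a = 0 :=
  left_eq_add.mp h

/-- The expansion a = ε(a) + Σ D_i(a) ξ_i holds for π and the generators and is stable under
products by the twisted Leibniz rule. It exhibits the augmentation ideal as generated on the left by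
the ξ_i. -/
theorem exists_foxDerivatives [Fintype X] :
    ∃ D : X → (free w).UMix →+ (free w).UMix,
      (∀ i a c, D i (a * c) = a * D i c + D i a * algebraMap _ _ ((free w).uMixAug c)) ∧
      (∀ i, D i (uMixPi _) = 0) ∧ (∀ i x, x ≠ i → D i ((free w).uMixOf (freeOf w x)) = 0) ∧
      (∀ i, D i ((free w).uMixOf (freeOf w i)) = 1) ∧
      ∀ a, a = algebraMap _ _ ((free w).uMixAug a) +
        ∑ i, D i a * (free w).uMixOf (freeOf w i) := by
  classical
  choose D hD hDpi hDof using fun i => exists_foxDerivative_of w (Pi.single i 1)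
  refine ⟨D, hD, hDpi, fun i x h => ?_, fun i => ?_, fun a => ?_⟩
  · rw [hDof, Pi.single_eq_of_ne h]
  · rw [hDof, Pi.single_eq_same]
  have hone : ∀ i, D i 1 = 0 := fun i => by
    have := hD i 1 1
    simp only [map_one, mul_one, one_mul] at this
    exact eq_zero_of_eq_add_self (R := (free w).UMix) (a := D i 1) this
  let S : Subsemiring (free w).UMix :=
    { carrier := {a | a = algebraMap _ _ ((free w).uMixAug a) +
        ∑ i, D i a * (free w).uMixOf (freeOf w i)}
      mul_mem' := fun {a b} ha hb => by
        change a * b = _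
        simp only [hD]
        rw [map_mul, map_mul]
        exact mul_fox_expansion Finset.univ (x := fun i => (free w).uMixOf (freeOf w i))
          (d := fun i => D i a) (d' := fun i => D i b) (fun c => Algebra.commutes _ c) ha hb
      one_mem' := by
        change (1 : (free w).UMix) = _
        simp only [hone, zero_mul, Finset.sum_const_zero, map_one, add_zero]
      add_mem' := fun {a b} ha hb => by
        change a + b = _
        simp only [map_add, add_mul, Finset.sum_add_distrib]
        rw [add_add_add_comm, ← ha, ← hb]
      zero_mem' := by
        change (0 : (free w).UMix) = _
        simp only [map_zero, zero_mul, Finset.sum_const_zero, add_zero] }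
  have hpiS : uMixPi _ ∈ S := by
    change uMixPi _ = _
    simp only [hDpi, zero_mul, Finset.sum_const_zero, add_zero, uMixAug_pi]
    rfl
  refine uMix_mem S (fun n x => (uMixRep (free w)).free_mem S hpiS (fun x => ?_) x) hpiS a
  change (free w).uMixOf (freeOf w x) = algebraMap _ _ ((free w).uMixAug
    ((free w).uMixOf (freeOf w x))) + ∑ i, D i ((free w).uMixOf (freeOf w x)) * _
  rw [uMixAug_of, map_zero, zero_add, Finset.sum_eq_single x, hDof, Pi.single_eq_same, one_mul]
  · intro i _ hi
    rw [hDof, Pi.single_eq_of_ne hi.symm, zero_mul]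
  · exact fun h => (h (Finset.mem_univ _)).elim

end Fox

theorem Rep.map_br_add {L : MixedLieAlgebra.{u}} {B : Type v} [Ring B] [Algebra (ZMod 2) B] {z : B}
    (R : Rep L B z) {m n k : ℕ} (h : m + n = k) (x : L.carrier m) (y : L.carrier n) :
    R.toFun k (L.br h x y) = R.toFun m x * R.toFun n y + R.toFun n y * R.toFun m x := by
  rw [R.map_br, sub_eq_add_neg, ZModModule.neg_eq_self]

theorem uMixOf_br {L : MixedLieAlgebra.{u}} {m n k : ℕ} (h : m + n = k) (x : L.carrier m)
    (y : L.carrier n) :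
    L.uMixOf (L.br h x y) = L.uMixOf x * L.uMixOf y + L.uMixOf y * L.uMixOf x :=
  (uMixRep L).map_br_add h x y

theorem uMixOf_P_one {L : MixedLieAlgebra.{u}} {k : ℕ} (h : 1 + 1 = k) (x : L.carrier 1) :
    L.uMixOf (L.P h x) = uMixPi L * L.uMixOf x + L.uMixOf x * L.uMixOf x :=
  (uMixRep L).map_P_one h x

theorem uMixOf_P {L : MixedLieAlgebra.{u}} {n k : ℕ} (h : n + 1 = k) (hn : n ≠ 1)
    (x : L.carrier n) : L.uMixOf (L.P h x) = uMixPi L * L.uMixOf x :=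
  (uMixRep L).map_P h hn x

theorem uMixOf_add {L : MixedLieAlgebra.{u}} {n : ℕ} (x y : L.carrier n) :
    L.uMixOf (x + y) = L.uMixOf x + L.uMixOf y :=
  ((uMixRep L).toFun n).map_add x y

theorem uMixOf_zero {L : MixedLieAlgebra.{u}} {n : ℕ} : L.uMixOf (0 : L.carrier n) = 0 :=
  ((uMixRep L).toFun n).map_zero

/-- A submonoid of a vector space over `𝔽₂` is a subspace. -/
def zmodTwoSubmodule {M : Type v} [AddCommGroup M] [Module (ZMod 2) M] (S : AddSubmonoid M) :
    Submodule (ZMod 2) M :=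
  { S with
    smul_mem' := fun c x hx => by
      change c • x ∈ S
      rw [← ZMod.natCast_zmod_val c, Nat.cast_smul_eq_nsmul]
      exact nsmul_mem hx _ }

/-! ### The Fox Jacobian of the relators. -/

section Relations

variable {X : Type u} {w : X → ℕ+} {ι : Type v} {deg : ι → ℕ}
  (ρ : ∀ j, (free w).carrier (deg j))
  (D : X → (free w).UMix →+ (free w).UMix)
  (p : (free w).UMix →+* ((free w).quotient (idealSpan ρ)).UMix)

/-- Modulo 𝔯 the Fox gradient is linear on elements of 𝔯: p kills y, so [x,y] has gradient x·∇y, and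
Py has gradient π·∇y, even in degree 1. The elements with the stated property therefore form an
ideal. -/
theorem fox_mem_span
    (hD : ∀ i a c, D i (a * c) = a * D i c + D i a * algebraMap _ _ ((free w).uMixAug c))
    (hDpi : ∀ i, D i (uMixPi _) = 0)
    (hp : ∀ n (x : (free w).carrier n), p ((free w).uMixOf x) =
      ((free w).quotient (idealSpan ρ)).uMixOf (quotientMk _ n x))
    {n : ℕ} (x : (free w).carrier n) (hx : x ∈ (idealSpan ρ).part n) :
    p ((free w).uMixOf x) = 0 ∧ (fun i => p (D i ((free w).uMixOf x))) ∈
      Submodule.span ((free w).quotient (idealSpan ρ)).UMix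
        (Set.range fun j i => p (D i ((free w).uMixOf (ρ j)))) := by
  let N := Submodule.span ((free w).quotient (idealSpan ρ)).UMix
    (Set.range fun j i => p (D i ((free w).uMixOf (ρ j))))
  let J : (free w).MIdeal :=
    { part := fun n => zmodTwoSubmodule
        { carrier := {x | p ((free w).uMixOf x) = 0 ∧ (fun i => p (D i ((free w).uMixOf x))) ∈ N}
          zero_mem' := by
            refine ⟨by rw [uMixOf_zero, map_zero], ?_⟩
            simp only [uMixOf_zero, map_zero]
            exact N.zero_mem
          add_mem' := fun {x y} hx hy => by
            refine ⟨by rw [uMixOf_add, map_add, hx.1, hy.1, add_zero], ?_⟩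
            simp only [uMixOf_add, map_add]
            exact N.add_mem hx.2 hy.2 }
      br_mem := fun {m n k} h x y hy => by
        refine ⟨by rw [uMixOf_br, map_add, map_mul, map_mul, hy.1, mul_zero, zero_mul, add_zero], ?_⟩
        simp only [uMixOf_br, map_add, hD, uMixAug_of, map_zero, mul_zero, add_zero, map_mul, hy.1,
          zero_mul]
        exact N.smul_mem (p ((free w).uMixOf x)) hy.2
      P_mem := fun {n k} h x hx => by
        by_cases hn : n = 1
        · subst hn
          refine ⟨by rw [uMixOf_P_one, map_add, map_mul, map_mul, hx.1, mul_zero, mul_zero,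
            add_zero], ?_⟩
          simp only [uMixOf_P_one, map_add, hD, hDpi, uMixAug_of, map_zero, mul_zero, add_zero,
            map_mul, hx.1, zero_mul]
          exact N.smul_mem (p (uMixPi _)) hx.2
        · refine ⟨by rw [uMixOf_P h hn, map_mul, hx.1, mul_zero], ?_⟩
          simp only [uMixOf_P h hn, hD, hDpi, uMixAug_of, map_zero, mul_zero, add_zero, map_mul]
          exact N.smul_mem (p (uMixPi _)) hx.2 }
  refine idealSpan_le ρ J (fun j => ⟨?_, Submodule.subset_span ⟨j, rfl⟩⟩) n hx
  rw [hp, quotientMk_eq_zero.mpr (mem_idealSpan ρ j)]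
  exact uMixOf_zero

/-- The congruence is read in Ũ. Lifting v modulo π to elements v' of the enveloping algebra of L̃,
one has Σ v'_j ρ̃_j = Σ_i s_i ξ_i with every s_i zero in Ũ. Then `sum_smul_abelQuadMk_eq_zero` gives
a relation among the ρ̃_j, freeness makes the coefficients zero in Ũ, and so v is divisible by π. -/
theorem exists_eq_pi_mul [Fintype X] [Fintype ι] (hfin : ∀ n, Finite ((free w).carrier n)) (hdeg : ∀ j, 1 < deg j)
    (hexp : ∀ a, a = algebraMap _ _ ((free w).uMixAug a) +
      ∑ i, D i a * (free w).uMixOf (freeOf w i))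
    (hp : ∀ n (x : (free w).carrier n), p ((free w).uMixOf x) =
      ((free w).quotient (idealSpan ρ)).uMixOf (quotientMk _ n x))
    (hpi : p (uMixPi _) = uMixPi _)
    (hρ : QuadStronglyFree (quotient_piIdeal_isQuadratic (free w))
      (fun j => quotientMk (free w).piIdeal _ (ρ j)))
    (v : ι → ((free w).quotient (idealSpan ρ)).UMix)
    (hv : ∀ i, ∃ b, ∑ j, v j * p (D i ((free w).uMixOf (ρ j))) = uMixPi _ * b) (j : ι) :
    ∃ b, v j = uMixPi _ * b := by
  obtain ⟨b, hb⟩ := hρ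
  obtain ⟨q, hq, hqpi, -, hqk⟩ := exists_uMix_reduction ρ
  have hqt : ((free w).quotient (free w).piIdeal).IsQuadratic :=
    quotient_piIdeal_isQuadratic (free w)
  obtain ⟨p', hp', hps, hpk⟩ := exists_uQuad_quotient hqt (reducedSpan ρ)
  obtain ⟨σ, hσ, hσpi⟩ := (quotientHom (free w).piIdeal).exists_uMix_uQuad hqt
  have hcomm : ∀ a, q (p a) = p' (σ a) := uMix_hom_ext (f := q.comp p) (g := p'.comp σ)
    (fun n x => by
      change q (p _) = p' (σ _)
      rw [hp, hq, hσ, hp']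
      rfl) (by
      change q (p _) = p' (σ _)
      rw [hpi, hqpi, hσpi, map_zero])
  choose v' hv' using fun j => hps (q (v j))
  have h0 : ∑ j, p' (v' j) • abelQuadMk (reducedSpan ρ) hqt
      ⟨quotientMk (free w).piIdeal _ (ρ j), mem_idealSpan (L := (free w).quotient _) _ j⟩ = 0 := by
    refine sum_smul_abelQuadMk_eq_zero hqt (reducedSpan ρ) (fun n => ?_)
      (reducedSpan_part_one ρ hdeg) p' hp' hpk
      (fun j => quotientMk (free w).piIdeal _ (ρ j)) _ v'
      (fun i => quotientMk (free w).piIdeal _ (freeOf w i))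
      (fun i => ∑ j, v' j * σ (D i ((free w).uMixOf (ρ j)))) (fun i => ?_) ?_
    · have := hfin n
      exact quotient_finite _
    · obtain ⟨c, hc⟩ := hv i
      have := congrArg q hc
      rw [map_mul, hqpi, zero_mul, map_sum] at this
      rw [map_sum, ← this]
      refine Finset.sum_congr rfl fun j _ => ?_
      rw [map_mul, map_mul, hv', hcomm]
    -- The Fox expansion of ρ_j, pushed to the enveloping algebra of L̃; its constant term ε(ρ_j) is
    -- zero.
    · have h1 : ∀ j, ((free w).quotient (free w).piIdeal).uQuadOf
          (quotientMk (free w).piIdeal _ (ρ j)) = ∑ i, σ (D i ((free w).uMixOf (ρ j))) *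
            ((free w).quotient (free w).piIdeal).uQuadOf (quotientMk _ _ (freeOf w i)) := fun j => by
        have := congrArg σ (hexp ((free w).uMixOf (ρ j)))
        rw [uMixAug_of, map_zero, zero_add, map_sum, hσ] at this
        refine this.trans (Finset.sum_congr rfl fun i _ => ?_)
        rw [map_mul, hσ]
        rfl
      simp only [h1, Finset.mul_sum, Finset.sum_mul]
      rw [Finset.sum_comm]
      refine Finset.sum_congr rfl fun i _ => Finset.sum_congr rfl fun j _ => ?_
      rw [mul_assoc]
  refine hqk _ ?_
  have h1 := congrArg (fun m => b.repr m j) h0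
  rw [← hv']
  have h2 : ∑ j, p' (v' j) • b j = 0 := by
    rw [← h0]
    exact Finset.sum_congr rfl fun j _ => congrArg _ (hb j)
  have h3 := congrFun (b.repr_sum_self (fun j => p' (v' j))) j
  rw [← h3, h2, map_zero]
  rfl

end Relations

theorem uMix_add_self {L : MixedLieAlgebra.{u}} (a : L.UMix) : a + a = 0 :=
  ZModModule.add_self (G := L.UMix) a

section Presentation

variable {X : Type u} [Fintype X] {w : X → ℕ+} {ι : Type v} [Fintype ι] {deg : ι → ℕ}
  (ρ : ∀ j, (free w).carrier (deg j))

/-- The beginning of a resolution of the trivial module over the enveloping algebra of `L / r`,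
where `L` is free, and its comparison with `r / [r, r]`. -/
theorem exists_relationMatrix (hdeg : ∀ j, 1 < deg j) :
    ∃ a : ι → X → ((free w).quotient (idealSpan ρ)).UMix,
      (∀ j, ∑ i, a j i *
        ((free w).quotient (idealSpan ρ)).uMixOf (quotientMk _ _ (freeOf w i)) = 0) ∧
      (∀ c : X → ((free w).quotient (idealSpan ρ)).UMix,
        ∑ i, c i * ((free w).quotient (idealSpan ρ)).uMixOf (quotientMk _ _ (freeOf w i)) = 0 →
        ∃ v : ι → ((free w).quotient (idealSpan ρ)).UMix, ∀ i, c i = ∑ j, v j * a j i) ∧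
      (∀ u, ((free w).quotient (idealSpan ρ)).uMixAug u = 0 →
        ∃ c : X → ((free w).quotient (idealSpan ρ)).UMix, u = ∑ i, c i *
          ((free w).quotient (idealSpan ρ)).uMixOf (quotientMk _ _ (freeOf w i))) ∧
      (∃ F : Abel (idealSpan ρ) →+ (X → ((free w).quotient (idealSpan ρ)).UMix),
        (∀ (b : ((free w).quotient (idealSpan ρ)).UMix) z,
          F ((abelMixEquiv (idealSpan_part_one ρ hdeg)).symm (b • z)) =
            b • F ((abelMixEquiv (idealSpan_part_one ρ hdeg)).symm z)) ∧
        ∀ j, F (abelMk _ ⟨ρ j, mem_idealSpan ρ j⟩) = a j) ∧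
      (QuadStronglyFree (quotient_piIdeal_isQuadratic (free w))
        (fun j => quotientMk (free w).piIdeal _ (ρ j)) →
        ∀ v : ι → ((free w).quotient (idealSpan ρ)).UMix,
          (∀ i, ∃ b, ∑ j, v j * a j i = uMixPi _ * b) → ∀ j, ∃ b, v j = uMixPi _ * b) := by
  obtain ⟨D, hD, hDpi, hDne, hDeq, hexp⟩ := exists_foxDerivatives w
  obtain ⟨p, hp, hpi, hps, hpk⟩ := exists_uMix_quotient (idealSpan ρ)
  have hmem := fun n x hx => fox_mem_span ρ D p hD hDpi hp (n := n) x hx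
  have hpexp : ∀ a, p a = algebraMap _ _ ((free w).uMixAug a) + ∑ i, p (D i a) *
      ((free w).quotient (idealSpan ρ)).uMixOf (quotientMk _ _ (freeOf w i)) := fun a => by
    have := congrArg p (hexp a)
    rw [map_add, map_algebraMap_uMix p hpi, map_sum] at this
    refine this.trans (congrArg _ (Finset.sum_congr rfl fun i _ => ?_))
    rw [map_mul, hp]
  refine ⟨fun j i => p (D i ((free w).uMixOf (ρ j))), fun j => ?_, fun c hc => ?_, fun u hu => ?_,
    ?_, fun hρ v hv => ?_⟩
  · have := hpexp ((free w).uMixOf (ρ j))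
    rw [(hmem _ _ (mem_idealSpan ρ j)).1, uMixAug_of, map_zero, zero_add] at this
    exact this.symm
  · choose c' hc' using fun i => hps (c i)
    let N := Submodule.span ((free w).quotient (idealSpan ρ)).UMix
      (Set.range fun j i => p (D i ((free w).uMixOf (ρ j))))
    let C : AddSubmonoid (free w).UMix :=
      { carrier := {a | (fun i => p (D i a)) ∈ N}
        zero_mem' := by
          simp only [Set.mem_ofPred_eq, map_zero]
          exact N.zero_mem
        add_mem' := fun {x y} hx hy => by
          simp only [Set.mem_ofPred_eq, map_add]
          exact N.add_mem hx hy }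
    -- A relation lifts to an element of ker p, the two-sided ideal of 𝔯, where gradients lie in the
    -- span of the rows. The gradient of the lift Σ c'_i ξ_i maps to c itself.
    have h1 : ∑ i, c' i * (free w).uMixOf (freeOf w i) ∈ C := by
      refine hpk _ ?_ C fun n x hx s t => ?_
      · rw [← hc, map_sum]
        refine Finset.sum_congr rfl fun i _ => ?_
        rw [map_mul, hp, hc']
      · change (fun i => p (D i (s * (free w).uMixOf x * t))) ∈ N
        -- The terms of the Leibniz rule that contain p(x) or ε(x) vanish, leaving s·∇x times the
        -- central scalar ε(t).
        have h2 : (fun i => p (D i (s * (free w).uMixOf x * t))) =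
            (p (algebraMap _ _ ((free w).uMixAug t)) * p s) •
              fun i => p (D i ((free w).uMixOf x)) := by
          funext i
          change _ = (p (algebraMap _ _ ((free w).uMixAug t)) * p s) * p (D i ((free w).uMixOf x))
          rw [hD, hD, uMixAug_of, map_zero, mul_zero, add_zero, map_add, map_mul, map_mul,
            (hmem n x hx).1, mul_zero, zero_mul, zero_add, ← Algebra.commutes, mul_assoc, ← map_mul,
            ← map_mul]
        rw [h2]
        exact N.smul_mem _ (hmem n x hx).2
    have h2 : (fun i => p (D i (∑ i, c' i * (free w).uMixOf (freeOf w i)))) = c := by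
      classical
      funext i
      rw [map_sum, Finset.sum_eq_single i, hD, hDeq, mul_one, uMixAug_of, map_zero, mul_zero,
        add_zero, hc']
      · intro l _ hl
        rw [hD, hDne i l hl, uMixAug_of, map_zero, mul_zero, mul_zero, add_zero]
      · exact fun h => (h (Finset.mem_univ _)).elim
    replace h1 : (fun i => p (D i (∑ i, c' i * (free w).uMixOf (freeOf w i)))) ∈ N := h1
    rw [h2] at h1
    obtain ⟨v, hv⟩ := (Submodule.mem_span_range_iff_exists_fun _).mp h1
    refine ⟨v, fun i => ?_⟩
    rw [← hv, Finset.sum_apply]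
    rfl
  · obtain ⟨u', rfl⟩ := hps u
    have haug : ∀ a, ((free w).quotient (idealSpan ρ)).uMixAug (p a) = (free w).uMixAug a :=
      uMix_hom_ext (f := ((free w).quotient (idealSpan ρ)).uMixAug.toRingHom.comp p)
        (g := (free w).uMixAug.toRingHom) (fun n x => by
          change uMixAug _ (p _) = uMixAug _ _
          rw [hp, uMixAug_of, uMixAug_of]) (by
          change uMixAug _ (p _) = uMixAug _ _
          rw [hpi, uMixAug_pi, uMixAug_pi])
    refine ⟨fun i => p (D i u'), ?_⟩
    have := hpexp u'
    rwa [← haug, hu, map_zero, zero_add] at this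
  -- The gradient of [x,y] is x·∇y + y·∇x modulo 𝔯, which is zero when x and y both lie in 𝔯. So the
  -- gradient descends to 𝔯/[𝔯,𝔯].
  · obtain ⟨Ψ, hΨ⟩ := exists_abel_lift (idealSpan ρ)
      (N := X → ((free w).quotient (idealSpan ρ)).UMix) (fun n => AddMonoidHom.toZModLinearMap 2
        (AddMonoidHom.mk' (fun y i => p (D i ((free w).uMixOf (y : (free w).carrier n))))
          fun x y => by
            funext i
            rw [Submodule.coe_add, uMixOf_add, map_add, map_add]
            rfl)) (fun {a b k} h x y hx hy => by
        funext i
        change p (D i ((free w).uMixOf ((free w).br h x y))) = 0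
        rw [uMixOf_br, map_add, hD, hD, uMixAug_of, uMixAug_of, map_zero, mul_zero, mul_zero,
          add_zero, add_zero, map_add, map_mul, map_mul, (hmem a x hx).1, (hmem b y hy).1,
          zero_mul, zero_mul, add_zero])
    have hlin : ∀ (f : Abel (idealSpan ρ) →ₗ[ZMod 2] Abel (idealSpan ρ))
        (u : ((free w).quotient (idealSpan ρ)).UMix),
        (∀ n (y : (free w).carrier n) (hy : y ∈ (idealSpan ρ).part n),
          Ψ (f (abelMk _ ⟨y, hy⟩)) = u • Ψ (abelMk _ ⟨y, hy⟩)) → ∀ z, Ψ (f z) = u • Ψ z :=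
      fun f u h z => abel_induction (zmodTwoSubmodule
        { carrier := {z | Ψ (f z) = u • Ψ z}
          zero_mem' := by
            simp only [Set.mem_ofPred_eq, map_zero, smul_zero]
          add_mem' := fun {x y} hx hy => by
            simp only [Set.mem_ofPred_eq] at hx hy
            simp only [Set.mem_ofPred_eq, map_add, smul_add, hx, hy] }) h z
    have hsl := abelMix_semilinear (S := ((free w).quotient (idealSpan ρ)).UMix)
      (N := X → ((free w).quotient (idealSpan ρ)).UMix) (idealSpan_part_one ρ hdeg)
      (RingHom.id ((free w).quotient (idealSpan ρ)).UMix) Ψ.toAddMonoidHom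
    refine ⟨Ψ.toAddMonoidHom, hsl (fun {n} x z => ?_) (fun z => ?_), fun j => hΨ _ _⟩
    · refine hlin (adEnd _ x) _ (fun k y hy => ?_) z
      rw [adEnd_mk _ rfl, hΨ, hΨ]
      funext i
      change p (D i ((free w).uMixOf ((free w).br rfl x y))) =
        uMixOf _ (quotientMk _ n x) * p (D i ((free w).uMixOf y))
      rw [uMixOf_br, map_add, hD, hD, uMixAug_of, uMixAug_of, map_zero, mul_zero, mul_zero,
        add_zero, add_zero, map_add, map_mul, map_mul, (hmem k y hy).1, zero_mul, add_zero, hp]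
    · refine hlin (piEnd _) _ (fun k y hy => ?_) z
      by_cases hk : k = 1
      · subst hk
        have hy0 : y = 0 := by
          rw [idealSpan_part_one ρ hdeg, Submodule.mem_bot] at hy
          exact hy
        subst hy0
        have : abelMk (idealSpan ρ) ⟨(0 : (free w).carrier 1), hy⟩ = 0 := map_zero (abelMk _)
        rw [this, map_zero, map_zero, smul_zero]
      · rw [piEnd_mk _ rfl hk, hΨ, hΨ]
        funext i
        change p (D i ((free w).uMixOf ((free w).P rfl y))) =
          uMixPi _ * p (D i ((free w).uMixOf y))
        rw [uMixOf_P rfl hk, hD, hDpi, zero_mul, add_zero, map_mul, hpi]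
  · exact exists_eq_pi_mul ρ D p (free_finite w) hdeg hexp hp hpi hρ v hv

end Presentation

/-! ### Lifting strong freeness from the reduction. -/

section Converse

variable {X : Type u} [Fintype X] {w : X → ℕ+} {ι : Type v} [Fintype ι] {deg : ι → ℕ}
  (ρ : ∀ j, (free w).carrier (deg j))

/-- Both conclusions are Nakayama arguments on the relation matrix: torsion is removed by descending
in degree, dependence by descending in powers of π. -/
theorem stronglyFree_of_quadStronglyFree (hdeg : ∀ j, 1 < deg j)
    (hρ : QuadStronglyFree (quotient_piIdeal_isQuadratic (free w))
      (fun j => quotientMk (free w).piIdeal _ (ρ j))) : StronglyFree hdeg ρ := by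
  obtain ⟨a, ha0, hrel, haug, ⟨F, hF, hFρ⟩, hdvd⟩ := exists_relationMatrix ρ hdeg
  replace hdvd := hdvd hρ
  have hpisum : ∀ (v : ι → ((free w).quotient (idealSpan ρ)).UMix) i,
      ∑ j, uMixPi _ * v j * a j i = uMixPi _ * ∑ j, v j * a j i := fun v i => by
    rw [Finset.mul_sum]
    exact Finset.sum_congr rfl fun j _ => mul_assoc _ _ _
  have htf : ∀ u : ((free w).quotient (idealSpan ρ)).UMix, uMixPi _ * u = 0 → u = 0 := by
    intro u hu
    refine eq_zero_of_forall_eq_sum (fun i => (w i).pos)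
      (fun i => quotientMk (idealSpan ρ) _ (freeOf w i)) {u | uMixPi _ * u = 0} (fun u hu => ?_) hu
    replace hu : uMixPi _ * u = 0 := hu
    -- Applying ε to πu = 0 in the domain 𝔽₂[π] gives ε(u) = 0, so u is a left combination of the
    -- ξ_i.
    obtain ⟨c, hc⟩ := haug u (by
      have := congrArg (uMixAug _) hu
      rw [map_mul, uMixAug_pi, map_zero] at this
      exact (mul_eq_zero.mp this).resolve_left Polynomial.X_ne_zero)
    obtain ⟨v, hv⟩ := hrel (fun i => uMixPi _ * c i) (by
      rw [← hu, hc, Finset.mul_sum]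
      exact Finset.sum_congr rfl fun i _ => mul_assoc _ _ _)
    choose v' hv' using hdvd v fun i => ⟨c i, (hv i).symm⟩
    obtain rfl : v = fun j => uMixPi _ * v' j := funext hv'
    -- This is c − v'a in characteristic 2. Since aξ = 0 it represents the same u, and since πc =
    -- πv'a its entries are killed by π, as `eq_zero_of_forall_eq_sum` requires.
    refine ⟨fun i => c i + ∑ j, v' j * a j i, fun i => ?_, ?_⟩
    · change uMixPi _ * (c i + ∑ j, v' j * a j i) = 0
      rw [mul_add, hv, hpisum]
      exact uMix_add_self _
    · simp only [add_mul, Finset.sum_add_distrib]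
      rw [← hc, Finset.sum_congr rfl fun i _ => Finset.sum_mul _ _ _, Finset.sum_comm,
        Finset.sum_eq_zero fun j _ => ?_, add_zero]
      have := congrArg (v' j * ·) (ha0 j)
      simp only [Finset.mul_sum, mul_zero, ← mul_assoc] at this
      exact this
  have hXpow : ∀ (n : ℕ) (u : ((free w).quotient (idealSpan ρ)).UMix),
      (Polynomial.X : (ZMod 2)[X]) ^ n • u = uMixPi _ ^ n * u := fun n u => by
    rw [Algebra.smul_def, map_pow]
    rfl
  have htor : Module.IsTorsionFree (ZMod 2)[X] ((free w).quotient (idealSpan ρ)).UMix :=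
    Module.IsTorsionFree.of_smul_eq_zero fun r m hrm =>
      smul_eq_zero_of_X (M := ((free w).quotient (idealSpan ρ)).UMix)
        (fun m hm => htf m (by rw [← X_smul_eq]; exact hm))
        (fun m hm => eq_zero_of_forall_eq_pow_mul fun n => by
          obtain ⟨m', hm'⟩ := hm n
          exact ⟨m', hm'.trans (hXpow n m')⟩) hrm
  -- From va = 0 comes v = πv', and torsion-freeness cancels π to give v'a = 0, so the division can
  -- be repeated n times.
  have hdvd' : ∀ (n : ℕ) (v : ι → ((free w).quotient (idealSpan ρ)).UMix),
      (∀ i, ∑ j, v j * a j i = 0) → ∀ j, ∃ b, v j = uMixPi _ ^ n * b := fun n => by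
    induction n with
    | zero => exact fun v _ j => ⟨v j, by rw [pow_zero, one_mul]⟩
    | succ n ih =>
      intro v hv
      choose v' hv' using hdvd v fun i => ⟨0, by rw [hv i, mul_zero]⟩
      obtain rfl : v = fun j => uMixPi _ * v' j := funext hv'
      intro j
      obtain ⟨b, hb⟩ := ih v' (fun i => htf _ (by rw [← hpisum]; exact hv i)) j
      exact ⟨b, (hv' j).trans (by rw [hb, pow_succ', mul_assoc])⟩
  have hli : LinearIndependent ((free w).quotient (idealSpan ρ)).UMix
      (fun j => abelMixMk (idealSpan ρ) (idealSpan_part_one ρ hdeg)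
        ⟨ρ j, mem_idealSpan ρ j⟩) := by
    refine (Fintype.linearIndependent_iff (R := ((free w).quotient (idealSpan ρ)).UMix)
      (M := AbelMix (idealSpan ρ) (idealSpan_part_one ρ hdeg))).mpr fun v hv j => ?_
    refine eq_zero_of_forall_eq_pow_mul fun n => hdvd' n v (fun i => ?_) j
    -- F sends a relation Σ v_j ρ_j = 0 in M to va = 0.
    have h1 := congrArg (fun z => F ((abelMixEquiv (idealSpan_part_one ρ hdeg)).symm z) i) hv
    simp only [map_sum, map_zero, hF, Finset.sum_apply] at h1
    refine (Finset.sum_congr rfl fun j _ => ?_).trans h1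
    rw [← hFρ]
    rfl
  refine ⟨htor, Module.Basis.mk hli (abelMix_span ρ (idealSpan_part_one ρ hdeg)).ge, fun j => ?_⟩
  exact Module.Basis.mk_apply _ _ j

end Converse

end MixedLieAlgebra

theorem theorem4p4 {d m : ℕ} (w : Fin d → ℕ+) (h : Fin m → ℕ) (hh : ∀ i, 1 < h i)
    (ρ : ∀ i, (MixedLieAlgebra.free w).carrier (h i)) :
    MixedLieAlgebra.StronglyFree hh ρ ↔
      MixedLieAlgebra.QuadStronglyFree (MixedLieAlgebra.free w).reduced_isQuadratic
        (fun i => (MixedLieAlgebra.free w).reduction (h i) (ρ i)) :=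
  ⟨MixedLieAlgebra.quadStronglyFree_of_stronglyFree ρ (MixedLieAlgebra.free_finite w) hh,
    MixedLieAlgebra.stronglyFree_of_quadStronglyFree ρ hh⟩
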